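/- A *polynomial in groupoids* $P : I \to J$ between (small) groupoids $I, J$ consists of a family of groupoids $\mathrm{Op}_P(j)$ ($j\in J$) of operations and, for each $i\in I$ and each operation $c\in \mathrm{Op}_P(j)$, a groupoid $\mathrm{Pm}_P(i,c)$ of parameters, all depending functorially (up to coherent isomorphism) on $i$, $j$, $c$. The identity polynomial on $J$ has one operation in each colour $j$, with $\mathrm{Pm}(i,j) = \mathrm{Hom}_J(i,j)$. The composite $P\cdot Q : I\to K$ of $P : I\to J$ and $Q : J\to K$ has as operations over $k$ the pairs $(c,a)$ of $c\in\mathrm{Op}_Q(k)$ and $a\in\prod_{j}\prod_{p\in \mathrm{Pm}_Q(j,c)}\mathrm{Op}_P(j)$ (pseudo-natural sections), and $\mathrm{Pm}_{P\cdot Q}(i,(c,a)) = \sum_j\sum_{p\in\mathrm{Pm}_Q(j,c)}\mathrm{Pm}_P(i,a(j,p))$. An equivalence $P\simeq P'$ consists of equivalences $\mathrm{Op}_P(j)\simeq\mathrm{Op}_{P'}(j)$, together with equivalences between the groupoids of parameters of corresponding operations. Groupoids, polynomials, and equivalences of polynomials (up to identification, i.e. up to invertible modifications) as 2-cells form a bicategory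 whose hom-categories $\hom(I,J)$ are groupoids. **Theorem.** This bicategory is cartesian. That is: 1. There is a terminal object: a groupoid $T$ such that $\hom(I,T)$ is equivalent to the one-point category for every groupoid $I$. 2. Any two groupoids $J$ and $K$ have a product, which is their coproduct $J\sqcup K$ as groupoids. The first projection $\mathrm{projl} : J\sqcup K\to J$ has exactly one operation in each colour $j\in J$, with parameters $\mathrm{Pm}(\mathrm{inl}\,j', j) = \mathrm{Hom}_J(j',j)$ and $\mathrm{Pm}(\mathrm{inr}\,k, j)=\emptyset$; the second projection $\mathrm{projr} : J\sqcup K\to K$ is defined symmetrically. For every groupoid $I$, the canonical functor $$\hom(I, J\sqcup K)\longrightarrow \hom(I,J)\times\hom(I,K),\qquad R\mapsto (R\cdot\mathrm{projl},\ R\cdot\mathrm{projr})$$ is an equivalence, and it has an inverse equivalence which sends $(P,Q)$ to the pairing $\mathrm{pair}(P,Q)$ defined by $\mathrm{Op}(\mathrm{inl}\,j)=\mathrm{Op}_P(j)$, $\mathrm{Op}(\mathrm{inr}\,k)=\mathrm{Op}_Q(k)$, with the parameters of $P$ on operations over $\mathrm{inl}\,j$ and those of $Q$ on operations over $\mathrm{inr}\,k$.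 Moreover this also holds before identifying 2-cells: for every groupoid $I$ and all polynomials $R,R' : I\to J\sqcup K$, post-composition with the two projections is an equivalence from the groupoid of morphisms of polynomials $R\to R'$ (a functorial map on operations, and a functorial map from the parameters of the image of an operation back to the parameters of that operation; arrows are the identifications between such morphisms) to the product of the groupoids of morphisms $R\cdot\mathrm{projl}\to R'\cdot\mathrm{projl}$ and $R\cdot\mathrm{projr}\to R'\cdot\mathrm{projr}$; and $T$ above can be chosen such that the groupoid of morphisms between any two polynomials $I\to T$ is equivalent to the point. -/

import Mathlib

set_option linter.unusedVariables false

open CategoryTheory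

universe u

namespace GrpdPoly

/-- The total space of a family of types. -/
structure Total {J : Type u} (El : J → Type u) where
  base : J
  el : El base

/-- A family of groupoids indexed by a groupoid `J`: a functor from a groupoid `Total El` to `J`
which is an isofibration, presented through its fibres `El j`. The groupoid of elements over `j`
has as morphisms the morphisms of `Total El` over the identity of `j`; a morphism of `Total El`
over `f : j ⟶ j'` is an identification of elements along `f`. -/
structure GFam (J : Type u) [Groupoid.{u} J] where
  El : J → Type u
  [groupoid : Groupoid.{u} (Total El)]
  proj : ∀ {x y : Total El}, (x ⟶ y) → (x.base ⟶ y.base)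
  proj_id : ∀ x : Total El, proj (𝟙 x) = 𝟙 x.base
  proj_comp : ∀ {x y z : Total El} (f : x ⟶ y) (g : y ⟶ z), proj (f ≫ g) = proj f ≫ proj g
  exists_lift : ∀ {j j' : J} (f : j ⟶ j') (x : El j),
    ∃ (y : El j') (m : (⟨j, x⟩ : Total El) ⟶ ⟨j', y⟩), proj m = f

attribute [instance] GFam.groupoid

attribute [simp] GFam.proj_id GFam.proj_comp

namespace GFam

variable {J : Type u} [Groupoid.{u} J]

abbrev Tot (A : GFam J) : Type u := Total A.El

abbrev Hom (A : GFam J) {j j' : J} (x : A.El j) (y : A.El j') : Type u :=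
  (⟨j, x⟩ : A.Tot) ⟶ ⟨j', y⟩

@[simp] theorem proj_inv (A : GFam J) {x y : A.Tot} (f : x ⟶ y) :
    A.proj (inv f) = inv (A.proj f) :=
  IsIso.eq_inv_of_inv_hom_id (by rw [← A.proj_comp]; simp)

/-- The end point of a chosen lift of `f`. -/
noncomputable def pushEl (A : GFam J) {j j' : J} (f : j ⟶ j') (x : A.El j) : A.El j' :=
  (A.exists_lift f x).choose

/-- A chosen lift of `f`. -/
noncomputable def push (A : GFam J) {j j' : J} (f : j ⟶ j') (x : A.El j) :
    A.Hom x (A.pushEl f x) :=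
  (A.exists_lift f x).choose_spec.choose

@[simp] theorem proj_push (A : GFam J) {j j' : J} (f : j ⟶ j') (x : A.El j) :
    A.proj (A.push f x) = f :=
  (A.exists_lift f x).choose_spec.choose_spec

end GFam

/-- A polynomial in groupoids from `I` to `J`: groupoids `Op j` of operations of colour `j` and,
for each operation, groupoids `Pm i c` of parameters of colour `i`, all of them functorial. -/
structure Poly (I J : Type u) [Groupoid.{u} I] [Groupoid.{u} J] where
  Op : GFam J
  Pm : GFam (I × Op.Tot)

@[simp] theorem prod_inv_fst {C D : Type u} [Groupoid.{u} C] [Groupoid.{u} D] {x y : C × D}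
    (f : x ⟶ y) : (inv f).1 = inv f.1 :=
  IsIso.eq_inv_of_inv_hom_id (by rw [← prod_comp_fst]; simp)

@[simp] theorem prod_inv_snd {C D : Type u} [Groupoid.{u} C] [Groupoid.{u} D] {x y : C × D}
    (f : x ⟶ y) : (inv f).2 = inv f.2 :=
  IsIso.eq_inv_of_inv_hom_id (by rw [← prod_comp_snd]; simp)

section Ext

variable {J K : Type u} [Groupoid.{u} J] [Groupoid.{u} K]

/-- The end point of a chosen lift of `γ` to parameters, colours being fixed. -/
noncomputable abbrev pushEl {Q : Poly J K} {c c' : Q.Op.Tot} (γ : c ⟶ c') {j : J}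
    (x : Q.Pm.El (j, c)) : Q.Pm.El (j, c') :=
  Q.Pm.pushEl (j := (j, c)) (j' := (j, c')) (𝟙 j, γ) x

/-- A chosen lift of `γ` to parameters, colours being fixed. -/
noncomputable abbrev push {Q : Poly J K} {c c' : Q.Op.Tot} (γ : c ⟶ c') {j : J}
    (x : Q.Pm.El (j, c)) : Q.Pm.Hom x (pushEl γ x) :=
  Q.Pm.push (j := (j, c)) (j' := (j, c')) (𝟙 j, γ) x

theorem proj_push {Q : Poly J K} {c c' : Q.Op.Tot} (γ : c ⟶ c') {j : J} (x : Q.Pm.El (j, c)) :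
    Q.Pm.proj (push γ x) = (𝟙 j, γ) :=
  Q.Pm.proj_push ..

/-- A section, with values in the family `X`, over the parameters of the operation `c`: an element
of the dependent product, over the colours `j` and the parameters `x` of `c` of colour `j`,
of the groupoids `X j`. -/
structure Sec (Q : Poly J K) (X : GFam J) (c : Q.Op.Tot) where
  obj : ∀ {j : J}, Q.Pm.El (j, c) → X.El j
  map : ∀ {j j' : J} {x : Q.Pm.El (j, c)} {x' : Q.Pm.El (j', c)} (m : Q.Pm.Hom x x'),
    (Q.Pm.proj m).2 = 𝟙 c → X.Hom (obj x) (obj x')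
  proj_map : ∀ {j j' : J} {x : Q.Pm.El (j, c)} {x' : Q.Pm.El (j', c)} (m : Q.Pm.Hom x x')
    (h : (Q.Pm.proj m).2 = 𝟙 c), X.proj (map m h) = (Q.Pm.proj m).1
  map_id : ∀ {j : J} (x : Q.Pm.El (j, c)) (h : (Q.Pm.proj (𝟙 (⟨(j, c), x⟩ : Q.Pm.Tot))).2 = 𝟙 c),
    map (𝟙 (⟨(j, c), x⟩ : Q.Pm.Tot)) h = 𝟙 (⟨j, obj x⟩ : X.Tot)
  map_comp : ∀ {j j' j'' : J} {x : Q.Pm.El (j, c)} {x' : Q.Pm.El (j', c)} {x'' : Q.Pm.El (j'', c)}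
    (m : Q.Pm.Hom x x') (n : Q.Pm.Hom x' x'') (hm : (Q.Pm.proj m).2 = 𝟙 c)
    (hn : (Q.Pm.proj n).2 = 𝟙 c) (h : (Q.Pm.proj (m ≫ n)).2 = 𝟙 c),
    map (m ≫ n) h = map m hm ≫ map n hn

namespace Sec

variable {Q : Poly J K} {X : GFam J} {c : Q.Op.Tot} (a : Sec Q X c)

theorem map_comp' {j j' j'' : J} {x : Q.Pm.El (j, c)} {x' : Q.Pm.El (j', c)}
    {x'' : Q.Pm.El (j'', c)} {k : Q.Pm.Hom x x''} (h : (Q.Pm.proj k).2 = 𝟙 c)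
    (m : Q.Pm.Hom x x') (n : Q.Pm.Hom x' x'') (hk : k = m ≫ n) (hm : (Q.Pm.proj m).2 = 𝟙 c)
    (hn : (Q.Pm.proj n).2 = 𝟙 c) : a.map k h = a.map m hm ≫ a.map n hn := by
  subst hk; exact a.map_comp ..

theorem map_congr {j j' : J} {x : Q.Pm.El (j, c)} {x' : Q.Pm.El (j', c)} {m n : Q.Pm.Hom x x'}
    (hm : (Q.Pm.proj m).2 = 𝟙 c) (hn : (Q.Pm.proj n).2 = 𝟙 c) (h : m = n) :
    a.map m hm = a.map n hn := by
  subst h; rfl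

theorem map_inv {j j' : J} {x : Q.Pm.El (j, c)} {x' : Q.Pm.El (j', c)} (m : Q.Pm.Hom x x')
    (hm : (Q.Pm.proj m).2 = 𝟙 c) (h : (Q.Pm.proj (inv m)).2 = 𝟙 c) :
    a.map (inv m) h = inv (a.map m hm) := by
  refine IsIso.eq_inv_of_hom_inv_id ?_
  rw [← a.map_id x (by simp), ← a.map_comp' (k := 𝟙 _) (by simp) m (inv m) (by simp) hm h]

end Sec

/-- An operation of colour `k`, with a section over its parameters. -/
structure ExtEl (Q : Poly J K) (X : GFam J) (k : K) where
  fst : Q.Op.El k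
  snd : Sec Q X ⟨k, fst⟩

abbrev opOf {Q : Poly J K} {X : GFam J} (w : Total (ExtEl Q X)) : Q.Op.Tot :=
  ⟨w.base, w.el.fst⟩

abbrev secOf {Q : Poly J K} {X : GFam J} (w : Total (ExtEl Q X)) : Sec Q X (opOf w) :=
  w.el.snd

/-- Morphisms between pairs of an operation and a section: a morphism of operations `base`, and
a natural family of morphisms of `X` indexed by the morphisms of parameters over `base`. -/
structure ExtHom {Q : Poly J K} {X : GFam J} (w w' : Total (ExtEl Q X)) where
  base : opOf w ⟶ opOf w'
  map : ∀ {j j' : J} {x : Q.Pm.El (j, opOf w)} {x' : Q.Pm.El (j', opOf w')} (m : Q.Pm.Hom x x'),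
    (Q.Pm.proj m).2 = base → X.Hom ((secOf w).obj x) ((secOf w').obj x')
  proj_map : ∀ {j j' : J} {x : Q.Pm.El (j, opOf w)} {x' : Q.Pm.El (j', opOf w')} (m : Q.Pm.Hom x x')
    (h : (Q.Pm.proj m).2 = base), X.proj (map m h) = (Q.Pm.proj m).1
  map_left : ∀ {j j' j'' : J} {x : Q.Pm.El (j, opOf w)} {x' : Q.Pm.El (j', opOf w)}
    {x'' : Q.Pm.El (j'', opOf w')} (m : Q.Pm.Hom x x') (n : Q.Pm.Hom x' x'')
    (hm : (Q.Pm.proj m).2 = 𝟙 _) (hn : (Q.Pm.proj n).2 = base)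
    (h : (Q.Pm.proj (m ≫ n)).2 = base), map (m ≫ n) h = (secOf w).map m hm ≫ map n hn
  map_right : ∀ {j j' j'' : J} {x : Q.Pm.El (j, opOf w)} {x' : Q.Pm.El (j', opOf w')}
    {x'' : Q.Pm.El (j'', opOf w')} (m : Q.Pm.Hom x x') (n : Q.Pm.Hom x' x'')
    (hm : (Q.Pm.proj m).2 = base) (hn : (Q.Pm.proj n).2 = 𝟙 _)
    (h : (Q.Pm.proj (m ≫ n)).2 = base), map (m ≫ n) h = map m hm ≫ (secOf w').map n hn

namespace ExtHom

variable {Q : Poly J K} {X : GFam J}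

theorem ext' {w w' : Total (ExtEl Q X)} {f g : ExtHom w w'} (hb : f.base = g.base)
    (hm : ∀ {j j' : J} {x : Q.Pm.El (j, opOf w)} {x' : Q.Pm.El (j', opOf w')} (m : Q.Pm.Hom x x')
      (h : (Q.Pm.proj m).2 = f.base) (h' : (Q.Pm.proj m).2 = g.base), f.map m h = g.map m h') :
    f = g := by
  obtain ⟨fb, fm, _, _, _⟩ := f
  obtain ⟨gb, gm, _, _, _⟩ := g
  obtain rfl : fb = gb := hb
  have : @fm = @gm := by
    funext j j' x x' m h
    exact hm m h h
  subst this
  rfl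

def id (w : Total (ExtEl Q X)) : ExtHom w w where
  base := 𝟙 _
  map := (secOf w).map
  proj_map := (secOf w).proj_map
  map_left := (secOf w).map_comp
  map_right := (secOf w).map_comp

theorem map_left' {w w' : Total (ExtEl Q X)} (f : ExtHom w w')
    {j j' j'' : J} {x : Q.Pm.El (j, opOf w)} {x' : Q.Pm.El (j', opOf w)}
    {x'' : Q.Pm.El (j'', opOf w')} {k : Q.Pm.Hom x x''} (h : (Q.Pm.proj k).2 = f.base)
    (m : Q.Pm.Hom x x') (n : Q.Pm.Hom x' x'') (hk : k = m ≫ n)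
    (hm : (Q.Pm.proj m).2 = 𝟙 _) (hn : (Q.Pm.proj n).2 = f.base) :
    f.map k h = (secOf w).map m hm ≫ f.map n hn := by
  subst hk; exact f.map_left ..

theorem map_right' {w w' : Total (ExtEl Q X)} (f : ExtHom w w')
    {j j' j'' : J} {x : Q.Pm.El (j, opOf w)} {x' : Q.Pm.El (j', opOf w')}
    {x'' : Q.Pm.El (j'', opOf w')} {k : Q.Pm.Hom x x''} (h : (Q.Pm.proj k).2 = f.base)
    (m : Q.Pm.Hom x x') (n : Q.Pm.Hom x' x'') (hk : k = m ≫ n)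
    (hm : (Q.Pm.proj m).2 = f.base) (hn : (Q.Pm.proj n).2 = 𝟙 _) :
    f.map k h = f.map m hm ≫ (secOf w').map n hn := by
  subst hk; exact f.map_right ..

/-- The value of a composite does not depend on the factorization. -/
theorem comp_indep {w w' w'' : Total (ExtEl Q X)} (f : ExtHom w w') (g : ExtHom w' w'')
    {j j₁ j₂ j' : J} {x : Q.Pm.El (j, opOf w)} {y₁ : Q.Pm.El (j₁, opOf w')}
    {y₂ : Q.Pm.El (j₂, opOf w')} {x' : Q.Pm.El (j', opOf w'')}
    (m₁ : Q.Pm.Hom x y₁) (n₁ : Q.Pm.Hom y₁ x') (m₂ : Q.Pm.Hom x y₂) (n₂ : Q.Pm.Hom y₂ x')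
    (hm₁ : (Q.Pm.proj m₁).2 = f.base) (hn₁ : (Q.Pm.proj n₁).2 = g.base)
    (hm₂ : (Q.Pm.proj m₂).2 = f.base) (hn₂ : (Q.Pm.proj n₂).2 = g.base)
    (h : m₁ ≫ n₁ = m₂ ≫ n₂) :
    f.map m₁ hm₁ ≫ g.map n₁ hn₁ = f.map m₂ hm₂ ≫ g.map n₂ hn₂ := by
  have hv : (Q.Pm.proj (inv m₁ ≫ m₂)).2 = 𝟙 _ := by
    simp [hm₁, hm₂]
  have b₂ := f.map_right' hm₂ m₁ (inv m₁ ≫ m₂) (by simp) hm₁ hv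
  have b₁ := g.map_left' hn₁ (inv m₁ ≫ m₂) n₂ (by simp [← h]) hv hn₂
  rw [b₁, b₂, Category.assoc]


noncomputable def comp {w w' w'' : Total (ExtEl Q X)} (f : ExtHom w w') (g : ExtHom w' w'') :
    ExtHom w w'' where
  base := f.base ≫ g.base
  map {_ _ x _} m h := f.map (push f.base x) (by simp) ≫
    g.map (inv (push f.base x) ≫ m) (by simp [h])
  proj_map m h := by simp [f.proj_map, g.proj_map]
  map_left {_ _ _ x x' x''} m n hm hn h := by
    refine Eq.trans ?_ (Category.assoc _ _ _)
    rw [← f.map_left' (k := m ≫ push f.base x') (by simp [hm])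
      m _ rfl hm (by simp)]
    exact comp_indep _ _ _ _ _ _ _ _ _ _ (by simp)
  map_right {_ _ _ x x' x''} m n hm hn h := by
    rw [Category.assoc, ← g.map_right' (k := inv (push f.base x) ≫ m ≫ n)
      (by simp [hm, hn]) _ _ (by simp) (by simp [hm]) hn]

theorem comp_map {w w' w'' : Total (ExtEl Q X)} (f : ExtHom w w') (g : ExtHom w' w'')
    {j j₁ j' : J} {x : Q.Pm.El (j, opOf w)} {y : Q.Pm.El (j₁, opOf w')} {x' : Q.Pm.El (j', opOf w'')}
    {k : Q.Pm.Hom x x'} (h : (Q.Pm.proj k).2 = f.base ≫ g.base)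
    (m : Q.Pm.Hom x y) (n : Q.Pm.Hom y x') (hk : k = m ≫ n) (hm : (Q.Pm.proj m).2 = f.base)
    (hn : (Q.Pm.proj n).2 = g.base) :
    (comp f g).map k h = f.map m hm ≫ g.map n hn :=
  comp_indep _ _ _ _ _ _ _ _ _ _ (by simp [hk])

noncomputable def symm {w w' : Total (ExtEl Q X)} (f : ExtHom w w') : ExtHom w' w where
  base := inv f.base
  map m h := inv (f.map (inv m) (by simp [h]))
  proj_map m h := by simp [f.proj_map]
  map_left m n hm hn h := by
    have := f.map_right' (k := inv (m ≫ n)) (by simp [hn, hm]) (inv n) (inv m)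
      (by simp) (by simp [hn]) (by simp [hm])
    rw [this, Sec.map_inv _ _ hm]
    simp
  map_right m n hm hn h := by
    have := f.map_left' (k := inv (m ≫ n)) (by simp [hn, hm]) (inv n) (inv m)
      (by simp) (by simp [hn]) (by simp [hm])
    rw [this, Sec.map_inv _ _ hn]
    simp

noncomputable instance : Category (Total (ExtEl Q X)) where
  Hom := ExtHom
  id := id
  comp := comp
  id_comp f := ext' (Category.id_comp _) fun {_ _ x _} m h h' => by
    rw [comp_map (id _) f h (𝟙 _) m (by simp) (by simp [id]) h']
    dsimp only [id]
    rw [Sec.map_id, Category.id_comp]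
  comp_id f := ext' (Category.comp_id _) fun {_ _ x _} m h h' => by
    rw [comp_map f (id _) h m (𝟙 _) (by simp) h' (by simp [id])]
    dsimp only [id]
    rw [Sec.map_id, Category.comp_id]
  assoc f g k := ext' (Category.assoc _ _ _) fun {_ _ x _} m h h' => by
    have h₁ := proj_push f.base x
    have h₂ := proj_push g.base (pushEl f.base x)
    have h'' : (Q.Pm.proj m).2 = f.base ≫ g.base ≫ k.base := h'
    rw [comp_map (comp f g) k h (push f.base x ≫ push g.base _)
      (inv (push g.base _) ≫ inv (push f.base x) ≫ m) (by simp) (by simp [h₁, h₂, comp])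
      (by simp [h₁, h₂, h'']),
      comp_map f (comp g k) h' (push f.base x) (inv (push f.base x) ≫ m) (by simp) (by simp [h₁])
      (by simp [h₁, h'', comp]),
      comp_map f g _ _ _ rfl (by simp [h₁]) (by simp [h₂]),
      comp_map g k _ (push g.base _) (inv (push g.base _) ≫ inv (push f.base x) ≫ m) (by simp)
        (by simp [h₂]) (by simp [h₁, h₂, h'']), Category.assoc]

noncomputable instance : Groupoid (Total (ExtEl Q X)) where
  inv := symm
  inv_comp {w w'} f := ext' (IsIso.inv_hom_id _) fun {_ _ x _} m h h' => by
    have h₁ := proj_push (inv f.base) x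
    have h'' : (Q.Pm.proj m).2 = 𝟙 _ := h'
    change (comp (symm f) f).map m h = (secOf w').map m h'
    rw [comp_map (symm f) f h (push (inv f.base) x) (inv (push (inv f.base) x) ≫ m) (by simp)
      (by simp [h₁, symm]) (by simp [h₁, h''])]
    dsimp only [symm]
    rw [IsIso.inv_comp_eq]
    exact f.map_right' _ _ _ rfl _ _
  comp_inv {w w'} f := ext' (IsIso.hom_inv_id _) fun {_ _ x _} m h h' => by
    have h₁ := proj_push f.base x
    have h'' : (Q.Pm.proj m).2 = 𝟙 _ := h'
    change (comp f (symm f)).map m h = (secOf w).map m h'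
    rw [comp_map f (symm f) h (push f.base x) (inv (push f.base x) ≫ m) (by simp)
      (by simp [h₁]) (by simp [h₁, h'', symm])]
    dsimp only [symm]
    rw [IsIso.comp_inv_eq]
    exact f.map_left' _ _ _ (by simp) _ _

theorem inv_base {w w' : Total (ExtEl Q X)} (f : w ⟶ w') :
    ExtHom.base (inv f) = inv (ExtHom.base f) := by
  rw [← Groupoid.inv_eq_inv]; rfl

theorem inv_map {w w' : Total (ExtEl Q X)} (f : w ⟶ w')
    {j j' : J} {x : Q.Pm.El (j, opOf w')} {x' : Q.Pm.El (j', opOf w)} (m : Q.Pm.Hom x x')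
    (h : (Q.Pm.proj m).2 = ExtHom.base (inv f)) (h' : (Q.Pm.proj (inv m)).2 = ExtHom.base f) :
    ExtHom.map (inv f) m h = inv (ExtHom.map f (inv m) h') := by
  have e : inv f = ExtHom.symm f := by rw [← Groupoid.inv_eq_inv]; rfl
  have : ∀ (g : w' ⟶ w) (hg : g = ExtHom.symm f) (h : (Q.Pm.proj m).2 = ExtHom.base g),
    ExtHom.map g m h = inv (ExtHom.map f (inv m) h') := by
    rintro g rfl h; rfl
  exact this _ e h

end ExtHom
end Ext


section Comp

open ExtHom

variable {I J K : Type u} [Groupoid.{u} I] [Groupoid.{u} J] [Groupoid.{u} K]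

/-- The transport of a section along an isomorphism of operations. -/
noncomputable def Sec.transport {Q : Poly J K} {X : GFam J} {c c' : Q.Op.Tot} (γ : c ⟶ c')
    (a : Sec Q X c) : Sec Q X c' where
  obj y := a.obj (pushEl (inv γ) y)
  map {_ _ y y'} m h := a.map (inv (push (inv γ) y) ≫ m ≫ push (inv γ) y')
    (by simp [h])
  proj_map m h := by simp [a.proj_map]
  map_id y h := by
    exact (a.map_congr _ (by simp) (by simp)).trans (a.map_id _ (by simp))
  map_comp {_ _ _ y y' y''} m n hm hn h := by
    exact a.map_comp' _ _ _ (by simp) _ _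

/-- The polynomial functor associated with `Q`, applied to the family `X`: over `k`,
the groupoid of pairs of an operation `c` of colour `k` and a section
`(j : J) → Pm j c → X j`. -/
noncomputable abbrev Poly.ext (Q : Poly J K) (X : GFam J) : GFam K where
  El := ExtEl Q X
  proj f := Q.Op.proj (ExtHom.base f)
  proj_id _ := Q.Op.proj_id _
  proj_comp _ _ := Q.Op.proj_comp _ _
  exists_lift {k k'} f w := by
    obtain ⟨c, γ, hγ⟩ := Q.Op.exists_lift f w.fst
    let g : ExtHom (⟨k, w⟩ : Total (ExtEl Q X)) ⟨k', ⟨c, w.snd.transport γ⟩⟩ :=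
      { base := γ
        map := fun {_ _ x x'} m h => w.snd.map (m ≫ push (inv γ) x') (by simp [h])
        proj_map := fun m h => by exact (w.snd.proj_map _ _).trans (by simp)
        map_left := fun m n hm hn h => w.snd.map_comp' _ _ _ (by simp) _ _
        map_right := fun m n hm hn h => by
          dsimp only [Sec.transport]
          exact w.snd.map_comp' _ _ _ (by simp) _ _ }
    exact ⟨_, g, hγ⟩

/-- The value of a composite of morphisms of operations on a composite of parameters. -/
theorem ExtHom.comp_map' {Q : Poly J K} {X : GFam J} {w w' w'' : (Q.ext X).Tot}
    (f : w ⟶ w') (g : w' ⟶ w'') {j j₁ j' : J} {x : Q.Pm.El (j, opOf w)} {y : Q.Pm.El (j₁, opOf w')}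
    {x' : Q.Pm.El (j', opOf w'')} {k : Q.Pm.Hom x x'}
    (h : (Q.Pm.proj k).2 = ExtHom.base (w := w) (w' := w'') (f ≫ g))
    (m : Q.Pm.Hom x y) (n : Q.Pm.Hom y x') (hk : k = m ≫ n)
    (hm : (Q.Pm.proj m).2 = ExtHom.base (w := w) (w' := w') f) (hn : (Q.Pm.proj n).2 = ExtHom.base (w := w') (w' := w'') g) :
    ExtHom.map (w := w) (w' := w'') (f ≫ g) k h =
      ExtHom.map (w := w) (w' := w') f m hm ≫ ExtHom.map (w := w') (w' := w'') g n hn :=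
  ExtHom.comp_map (w := w) (w' := w') (w'' := w'') f g h m n hk hm hn

theorem ExtHom.map_comp_eq {Q : Poly J K} {X : GFam J} {w w' w'' : (Q.ext X).Tot}
    {F : w ⟶ w''} {f : w ⟶ w'} {g : w' ⟶ w''} (hF : F = f ≫ g)
    {j j₁ j' : J} {x : Q.Pm.El (j, opOf w)} {y : Q.Pm.El (j₁, opOf w')}
    {x' : Q.Pm.El (j', opOf w'')} {k : Q.Pm.Hom x x'}
    {h : (Q.Pm.proj k).2 = ExtHom.base (w := w) (w' := w'') F}
    {m : Q.Pm.Hom x y} {n : Q.Pm.Hom y x'} (hk : k = m ≫ n)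
    (hm : (Q.Pm.proj m).2 = ExtHom.base (w := w) (w' := w') f)
    (hn : (Q.Pm.proj n).2 = ExtHom.base (w := w') (w' := w'') g) :
    ExtHom.map (w := w) (w' := w'') F k h =
      ExtHom.map (w := w) (w' := w') f m hm ≫ ExtHom.map (w := w') (w' := w'') g n hn := by
  subst hF; exact ExtHom.comp_map' f g h m n hk hm hn

theorem proj_push_snd {Q : Poly J K} {c c' : Q.Op.Tot} {γ : c ⟶ c'} {j : J}
    {x : Q.Pm.El (j, c)} : (Q.Pm.proj (push γ x)).2 = γ := by
  simp

theorem push_comp_inv {Q : Poly J K} {c c' c'' : Q.Op.Tot} {γ : c ⟶ c'} {j j' : J}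
    {x : Q.Pm.El (j, c)} {x' : Q.Pm.El (j', c'')} {m : Q.Pm.Hom x x'} :
    m = push γ x ≫ inv (push γ x) ≫ m := by
  simp

theorem proj_push_inv_comp {Q : Poly J K} {c c' c'' : Q.Op.Tot} {γ : c ⟶ c'} {δ : c' ⟶ c''}
    {j j' : J} {x : Q.Pm.El (j, c)} {x' : Q.Pm.El (j', c'')} {m : Q.Pm.Hom x x'}
    (h : (Q.Pm.proj m).2 = γ ≫ δ) : (Q.Pm.proj (inv (push γ x) ≫ m)).2 = δ := by
  simp [h]

theorem ExtHom.map_congr {Q : Poly J K} {X : GFam J} {w w' : Total (ExtEl Q X)}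
    {f g : ExtHom w w'} (e : f = g) {j j' : J} {x : Q.Pm.El (j, opOf w)} {y : Q.Pm.El (j', opOf w')}
    {m n : Q.Pm.Hom x y} (e' : m = n) (hm : (Q.Pm.proj m).2 = f.base)
    (hn : (Q.Pm.proj n).2 = g.base) : f.map m hm = g.map n hn := by
  subst e e'; rfl

variable {P : Poly I J} {Q : Poly J K}

/-- The parameters of colour `i` of the operation `(c, a)` of the composite of `P` and `Q`:
a colour `j`, a parameter of `c` of colour `j` in `Q`, and a parameter of colour `i` in `P` of the
operation of `P` that `a` provides. -/
structure CompEl (P : Poly I J) (Q : Poly J K) (b : I × (Q.ext P.Op).Tot) where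
  idx : J
  arg : Q.Pm.El (idx, opOf b.2)
  el : P.Pm.El (b.1, ⟨idx, (secOf b.2).obj arg⟩)

@[ext]
structure CompHom (x y : Total (CompEl P Q)) where
  base : x.base ⟶ y.base
  arg : Q.Pm.Hom x.el.arg y.el.arg
  arg_proj : (Q.Pm.proj arg).2 = ExtHom.base base.2
  el : P.Pm.Hom x.el.el y.el.el
  el_proj : P.Pm.proj el = (base.1, ExtHom.map base.2 arg arg_proj)

noncomputable instance : Category (Total (CompEl P Q)) where
  Hom := CompHom
  id x :=
    { base := 𝟙 _
      arg := 𝟙 _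
      arg_proj := by simp; rfl
      el := 𝟙 _
      el_proj := (P.Pm.proj_id _).trans
        (Prod.ext rfl ((secOf x.base.2).map_id _ (by simp)).symm) }
  comp f g :=
    { base := f.base ≫ g.base
      arg := f.arg ≫ g.arg
      arg_proj := by
        rw [Q.Pm.proj_comp, prod_comp_snd, f.arg_proj, g.arg_proj]; rfl
      el := f.el ≫ g.el
      el_proj := by
        rw [P.Pm.proj_comp, f.el_proj, g.el_proj]
        exact Prod.ext rfl (ExtHom.comp_map f.base.2 g.base.2 (by
          rw [Q.Pm.proj_comp, prod_comp_snd, f.arg_proj, g.arg_proj]) f.arg g.arg rfl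
          f.arg_proj g.arg_proj).symm }
  id_comp f := CompHom.ext (Category.id_comp _) (Category.id_comp _) (Category.id_comp _)
  comp_id f := CompHom.ext (Category.comp_id _) (Category.comp_id _) (Category.comp_id _)
  assoc f g h := CompHom.ext (Category.assoc _ _ _) (Category.assoc _ _ _) (Category.assoc _ _ _)

noncomputable instance : Groupoid (Total (CompEl P Q)) where
  inv {X Y} f :=
    { base := inv (CompHom.base f)
      arg := inv (CompHom.arg f)
      arg_proj := by
        rw [GFam.proj_inv, prod_inv_snd, CompHom.arg_proj f, prod_inv_snd, ExtHom.inv_base]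
      el := inv (CompHom.el f)
      el_proj := by
        rw [GFam.proj_inv, CompHom.el_proj f]
        refine Prod.ext ?_ ?_
        · simp
        · rw [prod_inv_snd]
          have key : ∀ (g : Y.base.2 ⟶ X.base.2) (_ : g = inv (CompHom.base f).2)
              (h : (Q.Pm.proj (inv (CompHom.arg f))).2 = ExtHom.base g),
              inv (ExtHom.map (CompHom.base f).2 (CompHom.arg f) (CompHom.arg_proj f)) =
                ExtHom.map g (inv (CompHom.arg f)) h := by
            rintro g rfl h
            rw [ExtHom.inv_map (CompHom.base f).2 _ h (by simpa using CompHom.arg_proj f)]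
            simp only [IsIso.inv_inv]
          exact key _ (prod_inv_snd _) _ }
  inv_comp f := CompHom.ext (IsIso.inv_hom_id _) (IsIso.inv_hom_id _) (IsIso.inv_hom_id _)
  comp_inv f := CompHom.ext (IsIso.hom_inv_id _) (IsIso.hom_inv_id _) (IsIso.hom_inv_id _)

/-- The composite of two polynomials: its operations are those of `Q` together with a family of
operations of `P` indexed by their parameters. -/
noncomputable abbrev Poly.comp (P : Poly I J) (Q : Poly J K) : Poly I K where
  Op := Q.ext P.Op
  Pm :=
    { El := CompEl P Q
      proj := fun f => CompHom.base f
      proj_id := fun _ => rfl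
      proj_comp := fun _ _ => rfl
      exists_lift := fun {b b'} f x => by
        obtain ⟨y, m, hm⟩ := Q.Pm.exists_lift (j := (x.idx, opOf b.2)) (j' := (x.idx, opOf b'.2))
          (𝟙 x.idx, ExtHom.base f.2) x.arg
        have h : (Q.Pm.proj m).2 = ExtHom.base f.2 := by rw [hm]
        obtain ⟨z, n, hn⟩ := P.Pm.exists_lift (j := (b.1, ⟨x.idx, (secOf b.2).obj x.arg⟩)) (j' := (b'.1, ⟨x.idx, (secOf b'.2).obj y⟩)) (f.1, ExtHom.map f.2 m h) x.el
        exact ⟨⟨_, y, z⟩, ⟨f, m, h, n, hn⟩, rfl⟩ }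

end Comp


section LensSection

variable {I J : Type u} [Groupoid.{u} I] [Groupoid.{u} J]

/-- A morphism of polynomials: a map on operations, over the identity of `J`, and a map on
parameters, over the identity of `I`, from those of the image of an operation to those of this
operation. The two maps are functorial. The equivalences of polynomials are the morphisms that are
invertible up to identification: their maps on operations and on parameters are equivalences. -/
structure Lens (P Q : Poly I J) where
  op : ∀ {j : J}, P.Op.El j → Q.Op.El j
  opMap : ∀ {b b' : P.Op.Tot}, (b ⟶ b') → Q.Op.Hom (op b.el) (op b'.el)
  proj_opMap : ∀ {b b' : P.Op.Tot} (f : b ⟶ b'), Q.Op.proj (opMap f) = P.Op.proj f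
  opMap_id : ∀ b : P.Op.Tot, opMap (𝟙 b) = 𝟙 (⟨b.base, op b.el⟩ : Q.Op.Tot)
  opMap_comp : ∀ {b b' b'' : P.Op.Tot} (f : b ⟶ b') (g : b' ⟶ b''),
    opMap (f ≫ g) = opMap f ≫ opMap g
  pm : ∀ {i : I} {b : P.Op.Tot}, Q.Pm.El (i, ⟨b.base, op b.el⟩) → P.Pm.El (i, b)
  pmMap : ∀ {i i' : I} {b b' : P.Op.Tot} (f : b ⟶ b') {y : Q.Pm.El (i, ⟨b.base, op b.el⟩)}
    {y' : Q.Pm.El (i', ⟨b'.base, op b'.el⟩)} (m : Q.Pm.Hom y y'),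
    (Q.Pm.proj m).2 = opMap f → P.Pm.Hom (pm y) (pm y')
  proj_pmMap : ∀ {i i' : I} {b b' : P.Op.Tot} (f : b ⟶ b')
    {y : Q.Pm.El (i, ⟨b.base, op b.el⟩)} {y' : Q.Pm.El (i', ⟨b'.base, op b'.el⟩)}
    (m : Q.Pm.Hom y y') (h : (Q.Pm.proj m).2 = opMap f),
    P.Pm.proj (pmMap f m h) = ((Q.Pm.proj m).1, f)
  pmMap_id : ∀ {i : I} {b : P.Op.Tot} (y : Q.Pm.El (i, ⟨b.base, op b.el⟩))
    (h : (Q.Pm.proj (𝟙 (⟨_, y⟩ : Q.Pm.Tot))).2 = opMap (𝟙 b)),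
    pmMap (𝟙 b) (𝟙 (⟨_, y⟩ : Q.Pm.Tot)) h = 𝟙 (⟨(i, b), pm y⟩ : P.Pm.Tot)
  pmMap_comp : ∀ {i i' i'' : I} {b b' b'' : P.Op.Tot} (f : b ⟶ b') (g : b' ⟶ b'')
    {y : Q.Pm.El (i, ⟨b.base, op b.el⟩)} {y' : Q.Pm.El (i', ⟨b'.base, op b'.el⟩)}
    {y'' : Q.Pm.El (i'', ⟨b''.base, op b''.el⟩)} (m : Q.Pm.Hom y y') (n : Q.Pm.Hom y' y'')
    (hm : (Q.Pm.proj m).2 = opMap f) (hn : (Q.Pm.proj n).2 = opMap g)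
    (h : (Q.Pm.proj (m ≫ n)).2 = opMap (f ≫ g)),
    pmMap (f ≫ g) (m ≫ n) h = pmMap f m hm ≫ pmMap g n hn

namespace Lens

variable {P Q R S : Poly I J}

attribute [simp] proj_opMap opMap_id opMap_comp proj_pmMap

abbrev ob (φ : Lens P Q) (b : P.Op.Tot) : Q.Op.Tot := ⟨b.base, φ.op b.el⟩

theorem pmMap_fst (φ : Lens P Q) {i i' : I} {b b' : P.Op.Tot} {f : b ⟶ b'}
    {y : Q.Pm.El (i, φ.ob b)} {y' : Q.Pm.El (i', φ.ob b')} {m : Q.Pm.Hom y y'}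
    {h : (Q.Pm.proj m).2 = φ.opMap f} : (P.Pm.proj (φ.pmMap f m h)).1 = (Q.Pm.proj m).1 := by
  rw [φ.proj_pmMap]

theorem pmMap_snd (φ : Lens P Q) {i i' : I} {b b' : P.Op.Tot} {f : b ⟶ b'}
    {y : Q.Pm.El (i, φ.ob b)} {y' : Q.Pm.El (i', φ.ob b')} {m : Q.Pm.Hom y y'}
    {h : (Q.Pm.proj m).2 = φ.opMap f} : (P.Pm.proj (φ.pmMap f m h)).2 = f := by
  rw [φ.proj_pmMap]

theorem pmMap_comp' (φ : Lens P Q) {i i' i'' : I} {b b' b'' : P.Op.Tot} {k : b ⟶ b''}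
    {y : Q.Pm.El (i, φ.ob b)} {y' : Q.Pm.El (i', φ.ob b')} {y'' : Q.Pm.El (i'', φ.ob b'')}
    {l : Q.Pm.Hom y y''} (h : (Q.Pm.proj l).2 = φ.opMap k)
    (f : b ⟶ b') (g : b' ⟶ b'') (m : Q.Pm.Hom y y') (n : Q.Pm.Hom y' y'')
    (hk : k = f ≫ g) (hl : l = m ≫ n)
    (hm : (Q.Pm.proj m).2 = φ.opMap f) (hn : (Q.Pm.proj n).2 = φ.opMap g) :
    φ.pmMap k l h = φ.pmMap f m hm ≫ φ.pmMap g n hn := by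
  subst hk hl; exact φ.pmMap_comp ..

theorem pmMap_id' (φ : Lens P Q) {i : I} {b : P.Op.Tot} {f : b ⟶ b} (hf : f = 𝟙 b)
    {y : Q.Pm.El (i, φ.ob b)} {m : Q.Pm.Hom y y} (hm : m = 𝟙 _)
    (h : (Q.Pm.proj m).2 = φ.opMap f) : φ.pmMap f m h = 𝟙 _ := by
  subst hf hm; exact φ.pmMap_id ..

theorem opMap_inv (φ : Lens P Q) {b b' : P.Op.Tot} (f : b ⟶ b') :
    φ.opMap (inv f) = inv (φ.opMap f) :=
  IsIso.eq_inv_of_hom_inv_id (by rw [← φ.opMap_comp]; simp)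

theorem pmMap_inv (φ : Lens P Q) {i i' : I} {b b' : P.Op.Tot} (f : b ⟶ b')
    {y : Q.Pm.El (i, φ.ob b)} {y' : Q.Pm.El (i', φ.ob b')} (m : Q.Pm.Hom y y')
    (hm : (Q.Pm.proj m).2 = φ.opMap f) (h : (Q.Pm.proj (inv m)).2 = φ.opMap (inv f)) :
    φ.pmMap (inv f) (inv m) h = inv (φ.pmMap f m hm) := by
  refine IsIso.eq_inv_of_hom_inv_id ?_
  rw [← φ.pmMap_id y (by simp),
    ← φ.pmMap_comp' (k := 𝟙 b) (l := 𝟙 _) (by simp) f (inv f) m (inv m) (by simp) (by simp) hm h]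

abbrev id (P : Poly I J) : Lens P P where
  op b := b
  opMap f := f
  proj_opMap _ := rfl
  opMap_id _ := rfl
  opMap_comp _ _ := rfl
  pm y := y
  pmMap _ _ _ m _ := m
  proj_pmMap _ _ _ _ h := Prod.ext rfl h
  pmMap_id _ _ := rfl
  pmMap_comp _ _ _ _ _ _ _ _ _ _ := rfl

abbrev comp (φ : Lens P Q) (ψ : Lens Q R) : Lens P R where
  op b := ψ.op (φ.op b)
  opMap f := ψ.opMap (φ.opMap f)
  proj_opMap f := by rw [proj_opMap, proj_opMap]
  opMap_id b := by rw [opMap_id, opMap_id]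
  opMap_comp f g := by rw [opMap_comp, opMap_comp]
  pm {_ b} y := φ.pm (ψ.pm (b := φ.ob b) y)
  pmMap f _ _ m h := φ.pmMap f (ψ.pmMap (φ.opMap f) m h) (by rw [proj_pmMap])
  proj_pmMap f _ _ m h := by rw [proj_pmMap, proj_pmMap]
  pmMap_id {_ b} y h := φ.pmMap_id' rfl (ψ.pmMap_id' (φ.opMap_id b) rfl _) _
  pmMap_comp f g _ _ _ m n hm hn h :=
    φ.pmMap_comp' _ _ _ _ _ rfl (ψ.pmMap_comp' _ _ _ _ _ (φ.opMap_comp f g) rfl _ _) _ _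

end Lens

/-- An identification between two morphisms of polynomials: a natural family of vertical morphisms
between the images of operations, compatible with a natural family of vertical morphisms between
the images of parameters. It is presented by its components `app f` at all morphisms `f`,
so that the component at an operation `b` is `app (𝟙 b)`. -/
structure Cell {P Q : Poly I J} (φ ψ : Lens P Q) where
  app : ∀ {b b' : P.Op.Tot}, (b ⟶ b') → (φ.ob b ⟶ ψ.ob b')
  proj_app : ∀ {b b' : P.Op.Tot} (f : b ⟶ b'), Q.Op.proj (app f) = P.Op.proj f
  app_left : ∀ {b b' b'' : P.Op.Tot} (f : b ⟶ b') (g : b' ⟶ b''),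
    app (f ≫ g) = φ.opMap f ≫ app g
  app_right : ∀ {b b' b'' : P.Op.Tot} (f : b ⟶ b') (g : b' ⟶ b''),
    app (f ≫ g) = app f ≫ ψ.opMap g
  pm : ∀ {i i' : I} {b b' : P.Op.Tot} (f : b ⟶ b') {y : Q.Pm.El (i, φ.ob b)}
    {y' : Q.Pm.El (i', ψ.ob b')} (m : Q.Pm.Hom y y'),
    (Q.Pm.proj m).2 = app f → P.Pm.Hom (φ.pm y) (ψ.pm y')
  proj_pm : ∀ {i i' : I} {b b' : P.Op.Tot} (f : b ⟶ b') {y : Q.Pm.El (i, φ.ob b)}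
    {y' : Q.Pm.El (i', ψ.ob b')} (m : Q.Pm.Hom y y') (h : (Q.Pm.proj m).2 = app f),
    P.Pm.proj (pm f m h) = ((Q.Pm.proj m).1, f)
  pm_left : ∀ {i i' i'' : I} {b b' b'' : P.Op.Tot} (f : b ⟶ b') (g : b' ⟶ b'')
    {y : Q.Pm.El (i, φ.ob b)} {y' : Q.Pm.El (i', φ.ob b')} {y'' : Q.Pm.El (i'', ψ.ob b'')}
    (m : Q.Pm.Hom y y') (n : Q.Pm.Hom y' y'') (hm : (Q.Pm.proj m).2 = φ.opMap f)
    (hn : (Q.Pm.proj n).2 = app g) (h : (Q.Pm.proj (m ≫ n)).2 = app (f ≫ g)),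
    pm (f ≫ g) (m ≫ n) h = φ.pmMap f m hm ≫ pm g n hn
  pm_right : ∀ {i i' i'' : I} {b b' b'' : P.Op.Tot} (f : b ⟶ b') (g : b' ⟶ b'')
    {y : Q.Pm.El (i, φ.ob b)} {y' : Q.Pm.El (i', ψ.ob b')} {y'' : Q.Pm.El (i'', ψ.ob b'')}
    (m : Q.Pm.Hom y y') (n : Q.Pm.Hom y' y'') (hm : (Q.Pm.proj m).2 = app f)
    (hn : (Q.Pm.proj n).2 = ψ.opMap g) (h : (Q.Pm.proj (m ≫ n)).2 = app (f ≫ g)),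
    pm (f ≫ g) (m ≫ n) h = pm f m hm ≫ ψ.pmMap g n hn

namespace Cell

variable {P Q R S : Poly I J}

theorem ext' {φ ψ : Lens P Q} {T T' : Cell φ ψ}
    (happ : ∀ {b b' : P.Op.Tot} (f : b ⟶ b'), T.app f = T'.app f)
    (hpm : ∀ {i i' : I} {b b' : P.Op.Tot} (f : b ⟶ b') {y : Q.Pm.El (i, φ.ob b)}
      {y' : Q.Pm.El (i', ψ.ob b')} (m : Q.Pm.Hom y y') (h : (Q.Pm.proj m).2 = T.app f)
      (h' : (Q.Pm.proj m).2 = T'.app f), T.pm f m h = T'.pm f m h') : T = T' := by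
  obtain ⟨a, _, _, _, p, _, _, _⟩ := T
  obtain ⟨a', _, _, _, p', _, _, _⟩ := T'
  obtain rfl : @a = @a' := by funext b b' f; exact happ f
  have : @p = @p' := by
    funext i i' b b' f y y' m h
    exact hpm f m h h
  subst this
  rfl

section

variable {φ ψ : Lens P Q} (T : Cell φ ψ) {i i' i'' : I} {b b' b'' : P.Op.Tot}

theorem pm_fst {f : b ⟶ b'} {y : Q.Pm.El (i, φ.ob b)} {y' : Q.Pm.El (i', ψ.ob b')}
    {m : Q.Pm.Hom y y'} {h : (Q.Pm.proj m).2 = T.app f} :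
    (P.Pm.proj (T.pm f m h)).1 = (Q.Pm.proj m).1 := by
  rw [T.proj_pm]

theorem pm_snd {f : b ⟶ b'} {y : Q.Pm.El (i, φ.ob b)} {y' : Q.Pm.El (i', ψ.ob b')}
    {m : Q.Pm.Hom y y'} {h : (Q.Pm.proj m).2 = T.app f} : (P.Pm.proj (T.pm f m h)).2 = f := by
  rw [T.proj_pm]

theorem app_left' {k : b ⟶ b''} (f : b ⟶ b') (g : b' ⟶ b'') (h : k = f ≫ g) :
    T.app k = φ.opMap f ≫ T.app g := by
  subst h; exact T.app_left ..

theorem app_right' {k : b ⟶ b''} (f : b ⟶ b') (g : b' ⟶ b'') (h : k = f ≫ g) :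
    T.app k = T.app f ≫ ψ.opMap g := by
  subst h; exact T.app_right ..

theorem pm_left' {k : b ⟶ b''} {y : Q.Pm.El (i, φ.ob b)} {y' : Q.Pm.El (i', φ.ob b')}
    {y'' : Q.Pm.El (i'', ψ.ob b'')} {l : Q.Pm.Hom y y''} (h : (Q.Pm.proj l).2 = T.app k)
    (f : b ⟶ b') (g : b' ⟶ b'') (m : Q.Pm.Hom y y') (n : Q.Pm.Hom y' y'')
    (hk : k = f ≫ g) (hl : l = m ≫ n) (hm : (Q.Pm.proj m).2 = φ.opMap f)
    (hn : (Q.Pm.proj n).2 = T.app g) : T.pm k l h = φ.pmMap f m hm ≫ T.pm g n hn := by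
  subst hk hl; exact T.pm_left ..

theorem pm_right' {k : b ⟶ b''} {y : Q.Pm.El (i, φ.ob b)} {y' : Q.Pm.El (i', ψ.ob b')}
    {y'' : Q.Pm.El (i'', ψ.ob b'')} {l : Q.Pm.Hom y y''} (h : (Q.Pm.proj l).2 = T.app k)
    (f : b ⟶ b') (g : b' ⟶ b'') (m : Q.Pm.Hom y y') (n : Q.Pm.Hom y' y'')
    (hk : k = f ≫ g) (hl : l = m ≫ n) (hm : (Q.Pm.proj m).2 = T.app f)
    (hn : (Q.Pm.proj n).2 = ψ.opMap g) : T.pm k l h = T.pm f m hm ≫ ψ.pmMap g n hn := by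
  subst hk hl; exact T.pm_right ..

end

def id (φ : Lens P Q) : Cell φ φ where
  app := φ.opMap
  proj_app := φ.proj_opMap
  app_left := φ.opMap_comp
  app_right := φ.opMap_comp
  pm := φ.pmMap
  proj_pm := φ.proj_pmMap
  pm_left := φ.pmMap_comp
  pm_right := φ.pmMap_comp

/-- The value of a composite does not depend on the factorization. -/
theorem comp_indep {φ ψ χ : Lens P Q} (T : Cell φ ψ) (U : Cell ψ χ) {i i₁ i₂ i' : I}
    {b b₁ b₂ b' : P.Op.Tot} {y : Q.Pm.El (i, φ.ob b)} {z₁ : Q.Pm.El (i₁, ψ.ob b₁)}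
    {z₂ : Q.Pm.El (i₂, ψ.ob b₂)} {y' : Q.Pm.El (i', χ.ob b')}
    (f₁ : b ⟶ b₁) (g₁ : b₁ ⟶ b') (f₂ : b ⟶ b₂) (g₂ : b₂ ⟶ b')
    (m₁ : Q.Pm.Hom y z₁) (n₁ : Q.Pm.Hom z₁ y') (m₂ : Q.Pm.Hom y z₂) (n₂ : Q.Pm.Hom z₂ y')
    (hm₁ : (Q.Pm.proj m₁).2 = T.app f₁) (hn₁ : (Q.Pm.proj n₁).2 = U.app g₁)
    (hm₂ : (Q.Pm.proj m₂).2 = T.app f₂) (hn₂ : (Q.Pm.proj n₂).2 = U.app g₂)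
    (hf : f₁ ≫ g₁ = f₂ ≫ g₂) (h : m₁ ≫ n₁ = m₂ ≫ n₂) :
    T.pm f₁ m₁ hm₁ ≫ U.pm g₁ n₁ hn₁ = T.pm f₂ m₂ hm₂ ≫ U.pm g₂ n₂ hn₂ := by
  have hv : (Q.Pm.proj (inv m₁ ≫ m₂)).2 = ψ.opMap (inv f₁ ≫ f₂) := by
    have := T.app_right' f₁ (inv f₁ ≫ f₂) (k := f₂) (by simp)
    rw [Q.Pm.proj_comp, prod_comp_snd, hm₂, this, Q.Pm.proj_inv, prod_inv_snd, hm₁]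
    simp
  rw [T.pm_right' hm₂ f₁ (inv f₁ ≫ f₂) m₁ (inv m₁ ≫ m₂) (by simp) (by simp) hm₁ hv,
    U.pm_left' hn₁ (inv f₁ ≫ f₂) g₂ (inv m₁ ≫ m₂) n₂ (by simp [← hf]) (by simp [← h]) hv hn₂,
    Category.assoc]

noncomputable def comp {φ ψ χ : Lens P Q} (T : Cell φ ψ) (U : Cell ψ χ) : Cell φ χ where
  app {b _} f := T.app (𝟙 b) ≫ U.app f
  proj_app f := by rw [Q.Op.proj_comp, T.proj_app, U.proj_app]; simp
  app_left f g := by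
    rw [U.app_left, ← Category.assoc, ← Category.assoc, ← T.app_left' (k := f) f (𝟙 _) (by simp),
      ← T.app_right' (k := f) (𝟙 _) f (by simp)]
  app_right f g := by rw [U.app_right, Category.assoc]
  pm {_ _ b _} f {y _} m h := T.pm (𝟙 b) (push (T.app (𝟙 b)) y) (by simp) ≫
    U.pm f (inv (push (T.app (𝟙 b)) y) ≫ m) (proj_push_inv_comp h)
  proj_pm f y y' m h := by simp [T.proj_pm, U.proj_pm]
  pm_left {_ _ _ b b' _} f g y y' y'' m n hm hn h := by
    refine Eq.trans ?_ (Category.assoc _ _ _)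
    rw [← T.pm_left' (k := f) (l := m ≫ push (T.app (𝟙 b')) y')
      (by simp [hm, T.app_left' f (𝟙 b') (k := f)]) f (𝟙 b') _ _ (by simp) rfl]
    exact comp_indep _ _ _ _ _ _ _ _ _ _ _ _ _ _ (by simp) (by simp)
  pm_right {_ _ _ b _ _} f g y y' y'' m n hm hn h := by
    rw [Category.assoc, ← U.pm_right' (l := inv (push (T.app (𝟙 b)) y) ≫ m ≫ n) _ _ _ _ _ rfl
      (by simp)]

theorem comp_pm {φ ψ χ : Lens P Q} (T : Cell φ ψ) (U : Cell ψ χ) {i i₁ i' : I}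
    {b b₁ b' : P.Op.Tot} {y : Q.Pm.El (i, φ.ob b)} {z : Q.Pm.El (i₁, ψ.ob b₁)}
    {y' : Q.Pm.El (i', χ.ob b')} {k : b ⟶ b'} {l : Q.Pm.Hom y y'}
    (h : (Q.Pm.proj l).2 = (comp T U).app k) (f : b ⟶ b₁) (g : b₁ ⟶ b')
    (m : Q.Pm.Hom y z) (n : Q.Pm.Hom z y') (hk : k = f ≫ g) (hl : l = m ≫ n)
    (hm : (Q.Pm.proj m).2 = T.app f) (hn : (Q.Pm.proj n).2 = U.app g) :
    (comp T U).pm k l h = T.pm f m hm ≫ U.pm g n hn :=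
  comp_indep _ _ _ _ _ _ _ _ _ _ _ _ _ _ (by simp [hk]) (by simp [hl])

theorem comp_app {φ ψ χ : Lens P Q} (T : Cell φ ψ) (U : Cell ψ χ)
    {b b₁ b' : P.Op.Tot} {k : b ⟶ b'} (f : b ⟶ b₁) (g : b₁ ⟶ b') (hk : k = f ≫ g) :
    (comp T U).app k = T.app f ≫ U.app g := by
  dsimp only [comp]
  rw [U.app_left' _ _ hk, ← Category.assoc, ← T.app_right' (k := f) (𝟙 _) f (by simp)]

noncomputable def symm {φ ψ : Lens P Q} (T : Cell φ ψ) : Cell ψ φ where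
  app f := inv (T.app (inv f))
  proj_app f := by simp [T.proj_app]
  app_left f g := by
    rw [T.app_right' (inv g) (inv f) (by simp)]
    simp [ψ.opMap_inv]
  app_right f g := by
    rw [T.app_left' (inv g) (inv f) (by simp)]
    simp [φ.opMap_inv]
  pm f _ _ m h := inv (T.pm (inv f) (inv m) (by simp [h]))
  proj_pm f y y' m h := by
    rw [GFam.proj_inv, T.proj_pm]
    exact Prod.ext ((prod_inv_fst _).trans (by simp)) ((prod_inv_snd _).trans (by simp))
  pm_left f g y y' y'' m n hm hn h := by
    rw [T.pm_right' (k := inv (f ≫ g)) (l := inv (m ≫ n)) (by simp only [h, GFam.proj_inv, prod_inv_snd, IsIso.inv_inv]) (inv g) (inv f) (inv n) (inv m)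
      (by simp) (by simp) (by simp [hn]) (by simp [hm, ψ.opMap_inv]), ψ.pmMap_inv f m hm]
    simp
  pm_right f g y y' y'' m n hm hn h := by
    rw [T.pm_left' (k := inv (f ≫ g)) (l := inv (m ≫ n)) (by simp only [h, GFam.proj_inv, prod_inv_snd, IsIso.inv_inv]) (inv g) (inv f) (inv n) (inv m)
      (by simp) (by simp) (by simp [hn, φ.opMap_inv]) (by simp [hm]), φ.pmMap_inv g n hn]
    simp

noncomputable instance : Category (Lens P Q) where
  Hom := Cell
  id := id
  comp := comp
  id_comp {φ ψ} T := ext' (fun f => (comp_app (id φ) T (𝟙 _) f (by simp)).trans (by simp [id]))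
    fun {_ _ b b'} f {y _} m h h' => by
      rw [comp_pm (id _) T h (𝟙 _) f (𝟙 _) m (by simp) (by simp) (by simp [id]) h']
      exact (congrArg (· ≫ T.pm f m h') (φ.pmMap_id y _)).trans (Category.id_comp _)
  comp_id {φ ψ} T := ext'
    (fun f => (comp_app T (id ψ) f (𝟙 _) (by simp)).trans (by simp [id]))
    fun {_ _ b b'} f {y _} m h h' => by
      rw [comp_pm T (id _) h f (𝟙 _) m (𝟙 _) (by simp) (by simp) h' (by simp [id])]
      exact (congrArg (T.pm f m h' ≫ ·) (ψ.pmMap_id _ _)).trans (Category.comp_id _)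
  assoc {φ₀ φ₁ φ₂ φ₃} T U V := by
    refine ext' (fun {b b'} f => ?_) fun {_ _ b b'} f {y y'} m h h' => ?_
    · change (T.app (𝟙 b) ≫ U.app (𝟙 b)) ≫ V.app f = T.app (𝟙 b) ≫ U.app (𝟙 b) ≫ V.app f
      simp
    · have h'' : (Q.Pm.proj m).2 = T.app (𝟙 b) ≫ U.app (𝟙 b) ≫ V.app f := h'
      let m₁ := push (T.app (𝟙 b)) y
      let m₂ := push (U.app (𝟙 b)) (pushEl (T.app (𝟙 b)) y)
      have e₂ : (Q.Pm.proj (inv m₁ ≫ m)).2 = (comp U V).app f := proj_push_inv_comp h''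
      have e₃ : (Q.Pm.proj (inv m₂ ≫ inv m₁ ≫ m)).2 = V.app f := proj_push_inv_comp e₂
      have e₄ : (Q.Pm.proj (m₁ ≫ m₂)).2 = (comp T U).app (𝟙 b) := by simp [m₁, m₂, comp]
      refine (comp_pm (comp T U) V h (𝟙 _) f (m₁ ≫ m₂) (inv m₂ ≫ inv m₁ ≫ m) (by simp) (by simp)
        e₄ e₃).trans ?_
      rw [comp_pm T U e₄ (𝟙 _) (𝟙 _) m₁ m₂ (by simp) rfl (by simp [m₁]) (by simp [m₂])]
      refine Eq.trans ?_ (comp_pm T (comp U V) h' (𝟙 _) f m₁ (inv m₁ ≫ m) (by simp) (by simp)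
        (by simp [m₁]) e₂).symm
      rw [comp_pm U V e₂ (𝟙 _) f m₂ (inv m₂ ≫ inv m₁ ≫ m) (by simp) (by simp) (by simp [m₂]) e₃,
        Category.assoc]

noncomputable instance : Groupoid (Lens P Q) where
  inv := symm
  inv_comp {φ ψ} T := by
    refine ext' (fun {b b'} f => ?_) fun {_ _ b b'} f {y y'} m h h' => ?_
    · change inv (T.app (inv (𝟙 b))) ≫ T.app f = ψ.opMap f
      rw [IsIso.inv_comp_eq]
      exact T.app_right' _ _ (by simp)
    · have e : (Q.Pm.proj m).2 = ψ.opMap f := h'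
      have h'' : (Q.Pm.proj m).2 = (symm T).app (𝟙 b) ≫ T.app f := h
      change (comp (symm T) T).pm f m h = ψ.pmMap f m e
      rw [comp_pm (symm T) T h (𝟙 b) f (push _ y) (inv (push _ y) ≫ m) (by simp) (by simp)
        (by simp) (proj_push_inv_comp h'')]
      dsimp only [symm]
      rw [IsIso.inv_comp_eq]
      exact T.pm_right' _ _ _ _ _ (by simp) rfl _ e
  comp_inv {φ ψ} T := by
    refine ext' (fun {b b'} f => ?_) fun {_ _ b b'} f {y y'} m h h' => ?_
    · change T.app (𝟙 b) ≫ inv (T.app (inv f)) = φ.opMap f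
      rw [IsIso.comp_inv_eq]
      exact T.app_left' _ _ (by simp)
    · have e : (Q.Pm.proj m).2 = φ.opMap f := h'
      have h'' : (Q.Pm.proj m).2 = T.app (𝟙 b) ≫ (symm T).app f := h
      change (comp T (symm T)).pm f m h = φ.pmMap f m e
      rw [comp_pm T (symm T) h (𝟙 b) f (push _ y) (inv (push _ y) ≫ m) (by simp) (by simp)
        (by simp) (proj_push_inv_comp h'')]
      dsimp only [symm]
      rw [IsIso.comp_inv_eq]
      exact T.pm_left' _ _ _ _ _ (by simp) (by simp) e _

end Cell

end LensSection


section Whisker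

variable {I J K L : Type u} [Groupoid.{u} I] [Groupoid.{u} J] [Groupoid.{u} K] [Groupoid.{u} L]

namespace Lens

noncomputable abbrev whiskerLeft (P : Poly I J) {Q Q' : Poly J K} (φ : Lens Q Q') :
    Lens (P.comp Q) (P.comp Q') where
  op c :=
    ⟨φ.op c.fst,
      { obj := fun y => c.snd.obj (φ.pm y)
        map := fun m h => c.snd.map (φ.pmMap (𝟙 _) m (by rw [h, φ.opMap_id])) (by simp)
        proj_map := fun m h => (c.snd.proj_map ..).trans (by simp)
        map_id := fun y h => (c.snd.map_congr _ (by simp) (φ.pmMap_id ..)).trans (c.snd.map_id ..)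
        map_comp := fun m n hm hn h => c.snd.map_comp' _ _ _
          (φ.pmMap_comp' _ _ _ _ _ (by simp) rfl _ _) _ _ }⟩
  opMap {w w'} f :=
    { base := φ.opMap (ExtHom.base (w := w) (w' := w') f)
      map := fun m h => ExtHom.map (w := w) (w' := w') f (φ.pmMap (ExtHom.base (w := w) (w' := w') f) m h) (by simp)
      proj_map := fun m h => (ExtHom.proj_map (w := w) (w' := w') f ..).trans (by simp)
      map_left := fun m n hm hn h => ExtHom.map_left' (w := w) (w' := w') f _ _ _
        (φ.pmMap_comp' _ _ _ _ _ (by simp) rfl _ _) _ _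
      map_right := fun m n hm hn h => ExtHom.map_right' (w := w) (w' := w') f _ _ _
        (φ.pmMap_comp' _ _ _ _ _ (by simp) rfl _ _) _ _ }
  proj_opMap f := φ.proj_opMap _
  opMap_id w := ExtHom.ext' (φ.opMap_id _) fun m h h' => rfl
  opMap_comp f g := ExtHom.ext' (φ.opMap_comp _ _) fun {_ _ x _} m h h' =>
    ExtHom.comp_map' f g (congrArg Prod.snd (φ.proj_pmMap ..)) (φ.pmMap _ (push _ x) (by simp))
      (φ.pmMap _ (inv (push (φ.opMap (ExtHom.base f)) x) ≫ m)
        (proj_push_inv_comp (h.trans (φ.opMap_comp _ _)))) (φ.pmMap_comp' _ _ _ _ _ rfl (by simp) _ _)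
        (by simp) (by simp)
  pm x := ⟨x.idx, φ.pm x.arg, x.el⟩
  pmMap {_ _ w w'} f x x' m h :=
    { base := ((CompHom.base (x := ⟨_, x⟩) (y := ⟨_, x'⟩) m).1, f)
      arg := φ.pmMap (ExtHom.base (w := w) (w' := w') f) (CompHom.arg (x := ⟨_, x⟩) (y := ⟨_, x'⟩) m) ((CompHom.arg_proj (x := ⟨_, x⟩) (y := ⟨_, x'⟩) m).trans
        (congrArg ExtHom.base h))
      arg_proj := by simp
      el := CompHom.el (x := ⟨_, x⟩) (y := ⟨_, x'⟩) m
      el_proj := (CompHom.el_proj (x := ⟨_, x⟩) (y := ⟨_, x'⟩) m).trans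
        (Prod.ext rfl (ExtHom.map_congr h rfl _ _)) }
  proj_pmMap {_ _ w w'} f x x' m h := rfl
  pmMap_id y h := CompHom.ext rfl (φ.pmMap_id ..) rfl
  pmMap_comp f g _ _ _ m n hm hn h := CompHom.ext rfl (φ.pmMap_comp ..) rfl

noncomputable abbrev whiskerRight {P P' : Poly I J} (φ : Lens P P') (Q : Poly J K) :
    Lens (P.comp Q) (P'.comp Q) where
  op c :=
    ⟨c.fst,
      { obj := fun y => φ.op (c.snd.obj y)
        map := fun m h => φ.opMap (c.snd.map m h)
        proj_map := fun m h => (φ.proj_opMap _).trans (c.snd.proj_map ..)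
        map_id := fun y h => (congrArg φ.opMap (c.snd.map_id ..)).trans (φ.opMap_id _)
        map_comp := fun m n hm hn h => (congrArg φ.opMap (c.snd.map_comp ..)).trans
          (φ.opMap_comp _ _) }⟩
  opMap {w w'} f :=
    { base := ExtHom.base (w := w) (w' := w') f
      map := fun m h => φ.opMap (ExtHom.map (w := w) (w' := w') f m h)
      proj_map := fun m h => (φ.proj_opMap _).trans (ExtHom.proj_map (w := w) (w' := w') f ..)
      map_left := fun m n hm hn h => (congrArg φ.opMap (ExtHom.map_left (w := w) (w' := w') f ..)).trans
        (φ.opMap_comp _ _)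
      map_right := fun m n hm hn h => (congrArg φ.opMap (ExtHom.map_right (w := w) (w' := w') f ..)).trans
        (φ.opMap_comp _ _) }
  proj_opMap f := rfl
  opMap_id w := rfl
  opMap_comp f g := ExtHom.ext' rfl fun {_ _ x _} m h h' => φ.opMap_comp _ _
  pm x := ⟨x.idx, x.arg, φ.pm x.el⟩
  pmMap {_ _ w w'} f x x' m h :=
    { base := ((CompHom.base (x := ⟨_, x⟩) (y := ⟨_, x'⟩) m).1, f)
      arg := CompHom.arg (x := ⟨_, x⟩) (y := ⟨_, x'⟩) m
      arg_proj := (CompHom.arg_proj (x := ⟨_, x⟩) (y := ⟨_, x'⟩) m).trans (congrArg ExtHom.base h)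
      el := φ.pmMap (ExtHom.map (w := w) (w' := w') f (CompHom.arg (x := ⟨_, x⟩) (y := ⟨_, x'⟩) m) ((CompHom.arg_proj (x := ⟨_, x⟩) (y := ⟨_, x'⟩) m).trans
        (congrArg ExtHom.base h))) (CompHom.el (x := ⟨_, x⟩) (y := ⟨_, x'⟩) m) 
          ((congrArg Prod.snd (CompHom.el_proj (x := ⟨_, x⟩) (y := ⟨_, x'⟩) m)).trans
            (ExtHom.map_congr h rfl _ _))
      el_proj := by
        have e : (P'.Pm.proj (CompHom.el (x := ⟨_, x⟩) (y := ⟨_, x'⟩) m)).1 =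
            (CompHom.base (x := ⟨_, x⟩) (y := ⟨_, x'⟩) m).1 := by rw [CompHom.el_proj]
        exact (φ.proj_pmMap ..).trans (Prod.ext e rfl) }
  proj_pmMap {_ _ w w'} f x x' m h := rfl
  pmMap_id y h := CompHom.ext rfl rfl (φ.pmMap_id' (Sec.map_id _ _ (by simp)) rfl _)
  pmMap_comp f g _ _ _ m n hm hn h := CompHom.ext rfl rfl
    (φ.pmMap_comp' _ _ _ (CompHom.el m) (CompHom.el n) (ExtHom.comp_map' f g _ _ _ rfl _ _) rfl _ _)

section

variable {P P' P'' : Poly I J} {Q Q' Q'' : Poly J K}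

theorem whiskerLeft_id : whiskerLeft P (Lens.id Q) = Lens.id (P.comp Q) := by
  unfold whiskerLeft Lens.id
  congr 1
  funext i i' b b' f y y' m h
  exact CompHom.ext (Prod.ext rfl h.symm) rfl rfl
theorem whiskerRight_id : whiskerRight (Lens.id P) Q = Lens.id (P.comp Q) := by
  unfold whiskerRight Lens.id
  congr 1
  funext i i' b b' f y y' m h
  exact CompHom.ext (Prod.ext rfl h.symm) rfl rfl
theorem whiskerRight_comp (φ : Lens P P') (ψ : Lens P' P'') :
    whiskerRight (φ.comp ψ) Q = (whiskerRight φ Q).comp (whiskerRight ψ Q) := rfl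
theorem whisker_exchange (φ : Lens P P') (ψ : Lens Q Q') :
    (whiskerLeft P ψ).comp (whiskerRight φ Q') = (whiskerRight φ Q).comp (whiskerLeft P' ψ) := rfl


end

end Lens

namespace Cell

variable {P P' P'' : Poly I J} {Q Q' Q'' : Poly J K}

noncomputable def postcomp {φ φ' : Lens P P'} (T : Cell φ φ') (ψ : Lens P' P'') :
    Cell (φ.comp ψ) (φ'.comp ψ) where
  app f := ψ.opMap (T.app f)
  proj_app f := (ψ.proj_opMap _).trans (T.proj_app f)
  app_left f g := (congrArg ψ.opMap (T.app_left f g)).trans (ψ.opMap_comp _ _)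
  app_right f g := (congrArg ψ.opMap (T.app_right f g)).trans (ψ.opMap_comp _ _)
  pm f _ _ m h := T.pm f (ψ.pmMap (T.app f) m h) ψ.pmMap_snd
  proj_pm f _ _ m h := (T.proj_pm ..).trans (Prod.ext ψ.pmMap_fst rfl)
  pm_left f g _ _ _ m n hm hn h :=
    T.pm_left' _ _ _ _ _ rfl (ψ.pmMap_comp' _ _ _ _ _ (T.app_left f g) rfl _ _) _ _
  pm_right f g _ _ _ m n hm hn h :=
    T.pm_right' _ _ _ _ _ rfl (ψ.pmMap_comp' _ _ _ _ _ (T.app_right f g) rfl _ _) _ _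

noncomputable def precomp (φ : Lens P P') {ψ ψ' : Lens P' P''} (T : Cell ψ ψ') :
    Cell (φ.comp ψ) (φ.comp ψ') where
  app f := T.app (φ.opMap f)
  proj_app f := (T.proj_app _).trans (φ.proj_opMap f)
  app_left f g := T.app_left' _ _ (φ.opMap_comp _ _)
  app_right f g := T.app_right' _ _ (φ.opMap_comp _ _)
  pm f _ _ m h := φ.pmMap f (T.pm (φ.opMap f) m h) T.pm_snd
  proj_pm f _ _ m h := (φ.proj_pmMap ..).trans (Prod.ext T.pm_fst rfl)
  pm_left f g _ _ _ m n hm hn h :=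
    φ.pmMap_comp' _ _ _ _ _ rfl (T.pm_left' _ _ _ _ _ (φ.opMap_comp f g) rfl _ _) _ _
  pm_right f g _ _ _ m n hm hn h :=
    φ.pmMap_comp' _ _ _ _ _ rfl (T.pm_right' _ _ _ _ _ (φ.opMap_comp f g) rfl _ _) _ _

noncomputable def whiskerLeft (P : Poly I J) {φ ψ : Lens Q Q'} (T : Cell φ ψ) :
    Cell (Lens.whiskerLeft P φ) (Lens.whiskerLeft P ψ) where
  app {w w'} f :=
    { base := T.app (ExtHom.base (w := w) (w' := w') f)
      map := fun m h => ExtHom.map (w := w) (w' := w') f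
        (T.pm (ExtHom.base (w := w) (w' := w') f) m h) T.pm_snd
      proj_map := fun m h => (ExtHom.proj_map (w := w) (w' := w') f ..).trans T.pm_fst
      map_left := fun m n hm hn h => ExtHom.map_left' (w := w) (w' := w') f _ _ _
        (T.pm_left' _ _ _ _ _ (by simp) rfl _ _) _ _
      map_right := fun m n hm hn h => ExtHom.map_right' (w := w) (w' := w') f _ _ _
        (T.pm_right' _ _ _ _ _ (by simp) rfl _ _) _ _ }
  proj_app f := T.proj_app _
  app_left f g := ExtHom.ext' (T.app_left _ _) fun {_ _ x _} m h h' =>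
    ExtHom.comp_map' f g (congrArg Prod.snd (T.proj_pm ..)) (φ.pmMap _ (push _ x) proj_push_snd)
      (T.pm _ _ (proj_push_inv_comp (h.trans (T.app_left _ _))))
      (T.pm_left' _ _ _ _ _ rfl push_comp_inv _ _) φ.pmMap_snd T.pm_snd
  app_right f g := ExtHom.ext' (T.app_right _ _) fun {_ _ x _} m h h' =>
    ExtHom.comp_map' f g (congrArg Prod.snd (T.proj_pm ..)) (T.pm _ (push _ x) proj_push_snd)
      (ψ.pmMap _ _ (proj_push_inv_comp (h.trans (T.app_right _ _))))
      (T.pm_right' _ _ _ _ _ rfl push_comp_inv _ _) T.pm_snd ψ.pmMap_snd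
  pm {_ _ w w'} f x x' m h :=
    { base := ((CompHom.base (x := ⟨_, x⟩) (y := ⟨_, x'⟩) m).1, f)
      arg := T.pm (ExtHom.base (w := w) (w' := w') f) (CompHom.arg (x := ⟨_, x⟩) (y := ⟨_, x'⟩) m)
        ((CompHom.arg_proj (x := ⟨_, x⟩) (y := ⟨_, x'⟩) m).trans (congrArg ExtHom.base h))
      arg_proj := T.pm_snd
      el := CompHom.el (x := ⟨_, x⟩) (y := ⟨_, x'⟩) m
      el_proj := (CompHom.el_proj (x := ⟨_, x⟩) (y := ⟨_, x'⟩) m).trans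
        (Prod.ext rfl (ExtHom.map_congr h rfl _ _)) }
  proj_pm f x x' m h := rfl
  pm_left f g _ _ _ m n hm hn h := CompHom.ext rfl (T.pm_left ..) rfl
  pm_right f g _ _ _ m n hm hn h := CompHom.ext rfl (T.pm_right ..) rfl

noncomputable def whiskerRight {φ ψ : Lens P P'} (T : Cell φ ψ) (Q : Poly J K) :
    Cell (φ.whiskerRight Q) (ψ.whiskerRight Q) where
  app {w w'} f :=
    { base := ExtHom.base (w := w) (w' := w') f
      map := fun m h => T.app (ExtHom.map (w := w) (w' := w') f m h)
      proj_map := fun m h => (T.proj_app _).trans (ExtHom.proj_map (w := w) (w' := w') f ..)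
      map_left := fun m n hm hn h =>
        (congrArg T.app (ExtHom.map_left (w := w) (w' := w') f ..)).trans (T.app_left _ _)
      map_right := fun m n hm hn h =>
        (congrArg T.app (ExtHom.map_right (w := w) (w' := w') f ..)).trans (T.app_right _ _) }
  proj_app f := rfl
  app_left f g := ExtHom.ext' rfl fun {_ _ x _} m h h' => T.app_left _ _
  app_right f g := ExtHom.ext' rfl fun {_ _ x _} m h h' => T.app_right _ _
  pm {_ _ w w'} f x x' m h :=
    { base := ((CompHom.base (x := ⟨_, x⟩) (y := ⟨_, x'⟩) m).1, f)
      arg := CompHom.arg (x := ⟨_, x⟩) (y := ⟨_, x'⟩) m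
      arg_proj := (CompHom.arg_proj (x := ⟨_, x⟩) (y := ⟨_, x'⟩) m).trans (congrArg ExtHom.base h)
      el := T.pm (ExtHom.map (w := w) (w' := w') f (CompHom.arg (x := ⟨_, x⟩) (y := ⟨_, x'⟩) m)
          ((CompHom.arg_proj (x := ⟨_, x⟩) (y := ⟨_, x'⟩) m).trans (congrArg ExtHom.base h)))
        (CompHom.el (x := ⟨_, x⟩) (y := ⟨_, x'⟩) m)
          ((congrArg Prod.snd (CompHom.el_proj (x := ⟨_, x⟩) (y := ⟨_, x'⟩) m)).trans
            (ExtHom.map_congr h rfl _ _))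
      el_proj := by
        have e : (P'.Pm.proj (CompHom.el (x := ⟨_, x⟩) (y := ⟨_, x'⟩) m)).1 =
            (CompHom.base (x := ⟨_, x⟩) (y := ⟨_, x'⟩) m).1 := by rw [CompHom.el_proj]
        exact (T.proj_pm ..).trans (Prod.ext e rfl) }
  proj_pm f x x' m h := rfl
  pm_left f g _ _ _ m n hm hn h := CompHom.ext rfl rfl
    (T.pm_left' _ _ _ (CompHom.el m) (CompHom.el n) (ExtHom.comp_map' f g _ _ _ rfl _ _) rfl _ _)
  pm_right f g _ _ _ m n hm hn h := CompHom.ext rfl rfl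
    (T.pm_right' _ _ _ (CompHom.el m) (CompHom.el n) (ExtHom.comp_map' f g _ _ _ rfl _ _) rfl _ _)

noncomputable def whiskerLeftComp (P : Poly I J) (φ : Lens Q Q') (ψ : Lens Q' Q'') :
    Cell (Lens.whiskerLeft P (φ.comp ψ))
      ((Lens.whiskerLeft P φ).comp (Lens.whiskerLeft P ψ)) where
  app {w w'} f :=
    { base := (φ.comp ψ).opMap (ExtHom.base (w := w) (w' := w') f)
      map := fun m h => ExtHom.map (w := w) (w' := w') f
        ((φ.comp ψ).pmMap (ExtHom.base (w := w) (w' := w') f) m h) (φ.comp ψ).pmMap_snd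
      proj_map := fun m h => (ExtHom.proj_map (w := w) (w' := w') f ..).trans (φ.comp ψ).pmMap_fst
      map_left := fun m n hm hn h => ExtHom.map_left' (w := w) (w' := w') f _ _ _
        ((φ.comp ψ).pmMap_comp' _ _ _ _ _ (by simp) rfl _ _) _ _
      map_right := fun m n hm hn h => ExtHom.map_right' (w := w) (w' := w') f _ _ _
        (φ.pmMap_comp' _ _ _ _ _ (Category.comp_id _).symm
          (ψ.pmMap_comp' _ (φ.opMap (ExtHom.base (w := w) (w' := w') f)) (𝟙 _) _ _
            (Category.comp_id _).symm rfl _ _) _ _) _ _ }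
  proj_app f := ((φ.comp ψ).proj_opMap _)
  app_left f g := ExtHom.ext' ((φ.comp ψ).opMap_comp _ _) fun {_ _ x _} m h h' =>
    ExtHom.comp_map' f g (congrArg Prod.snd ((φ.comp ψ).proj_pmMap ..))
      ((φ.comp ψ).pmMap _ (push _ x) proj_push_snd)
      ((φ.comp ψ).pmMap _ _ (proj_push_inv_comp (h.trans ((φ.comp ψ).opMap_comp _ _))))
      ((φ.comp ψ).pmMap_comp' _ _ _ _ _ rfl push_comp_inv _ _)
      (φ.comp ψ).pmMap_snd (φ.comp ψ).pmMap_snd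
  app_right f g := ExtHom.ext' ((φ.comp ψ).opMap_comp _ _) fun {_ _ x _} m h h' =>
    ExtHom.comp_map' f g (congrArg Prod.snd ((φ.comp ψ).proj_pmMap ..))
      ((φ.comp ψ).pmMap _ (push _ x) proj_push_snd)
      ((φ.comp ψ).pmMap _ _ (proj_push_inv_comp (h.trans ((φ.comp ψ).opMap_comp _ _))))
      ((φ.comp ψ).pmMap_comp' _ _ _ _ _ rfl push_comp_inv _ _)
      (φ.comp ψ).pmMap_snd (φ.comp ψ).pmMap_snd
  pm {_ _ w w'} f x x' m h :=
    { base := ((CompHom.base (x := ⟨_, x⟩) (y := ⟨_, x'⟩) m).1, f)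
      arg := (φ.comp ψ).pmMap (ExtHom.base (w := w) (w' := w') f)
        (CompHom.arg (x := ⟨_, x⟩) (y := ⟨_, x'⟩) m)
        ((CompHom.arg_proj (x := ⟨_, x⟩) (y := ⟨_, x'⟩) m).trans (congrArg ExtHom.base h))
      arg_proj := (φ.comp ψ).pmMap_snd
      el := CompHom.el (x := ⟨_, x⟩) (y := ⟨_, x'⟩) m
      el_proj := (CompHom.el_proj (x := ⟨_, x⟩) (y := ⟨_, x'⟩) m).trans
        (Prod.ext rfl (ExtHom.map_congr h rfl _ _)) }
  proj_pm f x x' m h := rfl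
  pm_left f g _ _ _ m n hm hn h := CompHom.ext rfl ((φ.comp ψ).pmMap_comp ..) rfl
  pm_right f g _ _ _ m n hm hn h := CompHom.ext rfl ((φ.comp ψ).pmMap_comp ..) rfl

end Cell

end Whisker


section Associator

variable {I J K L : Type u} [Groupoid.{u} I] [Groupoid.{u} J] [Groupoid.{u} K] [Groupoid.{u} L]

theorem ExtHom.map_eq {Q : Poly J K} {X : GFam J} {w w' : Total (ExtEl Q X)} (f : ExtHom w w')
    {j j' : J} {x : Q.Pm.El (j, opOf w)} {y : Q.Pm.El (j', opOf w')} {m n : Q.Pm.Hom x y}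
    (e : m = n) (hm : (Q.Pm.proj m).2 = f.base) (hn : (Q.Pm.proj n).2 = f.base) :
    f.map m hm = f.map n hn := by
  subst e; rfl

/-- Maps between composites, with explicit source and target. -/
theorem CompHom.arg_snd {P : Poly I J} {Q : Poly J K} {x y : (P.comp Q).Pm.Tot} (m : x ⟶ y)
    {f : opOf x.base.2 ⟶ opOf y.base.2}
    (h : ExtHom.base (w := x.base.2) (w' := y.base.2) (CompHom.base m).2 = f) :
    (Q.Pm.proj (CompHom.arg (x := x) (y := y) m)).2 = f :=
  (CompHom.arg_proj m).trans h

theorem CompHom.el_snd {P : Poly I J} {Q : Poly J K} {x y : (P.comp Q).Pm.Tot} (m : x ⟶ y)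
    {f : x.base.2 ⟶ y.base.2} (h : (CompHom.base (x := x) (y := y) m).2 = f) :
    (P.Pm.proj (CompHom.el (x := x) (y := y) m)).2 =
      ExtHom.map (w := x.base.2) (w' := y.base.2) f (CompHom.arg m)
        (CompHom.arg_snd m (congrArg ExtHom.base h)) :=
  (congrArg Prod.snd (CompHom.el_proj m)).trans (ExtHom.map_congr h rfl _ _)

theorem CompHom.el_fst {P : Poly I J} {Q : Poly J K} {x y : (P.comp Q).Pm.Tot} (m : x ⟶ y) :
    (P.Pm.proj (CompHom.el (x := x) (y := y) m)).1 = (CompHom.base (x := x) (y := y) m).1 :=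
  congrArg Prod.fst (CompHom.el_proj m)

namespace Lens

noncomputable abbrev assocHomOp (P : Poly I J) (Q : Poly J K) (R : Poly K L)
    {l : L} (c : ((P.comp Q).comp R).Op.El l) : (P.comp (Q.comp R)).Op.El l :=
    ⟨⟨c.fst,
      { obj := fun y => (c.snd.obj y).fst
        map := fun m h => ExtHom.base (c.snd.map m h)
        proj_map := fun m h => c.snd.proj_map m h
        map_id := fun y h => congrArg ExtHom.base (c.snd.map_id y h)
        map_comp := fun m n hm hn h => congrArg ExtHom.base (c.snd.map_comp m n hm hn h) }⟩,
      { obj := fun z => (c.snd.obj z.arg).snd.obj z.el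
        map := fun {_ _ x x'} n h => ExtHom.map
          (c.snd.map (CompHom.arg (x := ⟨_, x⟩) (y := ⟨_, x'⟩) n)
            (CompHom.arg_snd n (congrArg ExtHom.base h)))
          (CompHom.el (x := ⟨_, x⟩) (y := ⟨_, x'⟩) n) (CompHom.el_snd n h)
        proj_map := fun n h => (ExtHom.proj_map ..).trans (CompHom.el_fst n)
        map_id := fun y h => (ExtHom.map_congr (c.snd.map_id ..) rfl _
          (congrArg Prod.snd (Q.Pm.proj_id _))).trans
          (Sec.map_id _ _ _)
        map_comp := fun m n hm hn h =>
          ExtHom.map_comp_eq (c.snd.map_comp' _ _ _ rfl _ _) rfl _ _ }⟩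
noncomputable abbrev assocHomOpMap (P : Poly I J) (Q : Poly J K) (R : Poly K L)
    {w w' : ((P.comp Q).comp R).Op.Tot} (f : w ⟶ w') :
    (P.comp (Q.comp R)).Op.Hom (assocHomOp P Q R w.el) (assocHomOp P Q R w'.el) :=
    { base :=
        { base := ExtHom.base (w := w) (w' := w') f
          map := fun m h => ExtHom.base (ExtHom.map (w := w) (w' := w') f m h)
          proj_map := fun m h => ExtHom.proj_map (w := w) (w' := w') f m h
          map_left := fun m n hm hn h =>
            congrArg ExtHom.base (ExtHom.map_left (w := w) (w' := w') f m n hm hn h)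
          map_right := fun m n hm hn h =>
            congrArg ExtHom.base (ExtHom.map_right (w := w) (w' := w') f m n hm hn h) }
      map := fun {_ _ x x'} n h => ExtHom.map
          (ExtHom.map (w := w) (w' := w') f (CompHom.arg (x := ⟨_, x⟩) (y := ⟨_, x'⟩) n)
            (CompHom.arg_snd n (congrArg ExtHom.base h)))
          (CompHom.el (x := ⟨_, x⟩) (y := ⟨_, x'⟩) n) (CompHom.el_snd n h)
      proj_map := fun n h => (ExtHom.proj_map ..).trans (CompHom.el_fst n)
      map_left := fun m n hm hn h =>
        ExtHom.map_comp_eq (ExtHom.map_left' (w := w) (w' := w') f _ _ _ rfl _ _) rfl _ _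
      map_right := fun m n hm hn h =>
        ExtHom.map_comp_eq (ExtHom.map_right' (w := w) (w' := w') f _ _ _ rfl _ _) rfl _ _ }

end Lens
end Associator

section Associator

variable {I J K L : Type u} [Groupoid.{u} I] [Groupoid.{u} J] [Groupoid.{u} K] [Groupoid.{u} L]
namespace Lens

noncomputable abbrev assocHomPm (P : Poly I J) (Q : Poly J K) (R : Poly K L)
    {i : I} {b : ((P.comp Q).comp R).Op.Tot}
    (x : (P.comp (Q.comp R)).Pm.El (i, ⟨b.base, assocHomOp P Q R b.el⟩)) :
    ((P.comp Q).comp R).Pm.El (i, b) :=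
  ⟨x.arg.idx, x.arg.arg, ⟨x.idx, x.arg.el, x.el⟩⟩

theorem assocHom_el (P : Poly I J) (Q : Poly J K) (R : Poly K L)
    {i i' : I} {b b' : ((P.comp Q).comp R).Op.Tot} (f : b ⟶ b')
    {x : (P.comp (Q.comp R)).Pm.El (i, ⟨b.base, assocHomOp P Q R b.el⟩)}
    {x' : (P.comp (Q.comp R)).Pm.El (i', ⟨b'.base, assocHomOp P Q R b'.el⟩)}
    (m : (P.comp (Q.comp R)).Pm.Hom x x')
    (h : ((P.comp (Q.comp R)).Pm.proj m).2 = assocHomOpMap P Q R f) :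
    (R.Pm.proj (CompHom.arg (P := Q) (CompHom.arg (x := ⟨_, x⟩) (y := ⟨_, x'⟩) m))).2 = ExtHom.base (w := b) (w' := b') f :=
  CompHom.arg_snd _ (congrArg ExtHom.base (CompHom.arg_snd (x := ⟨_, x⟩) (y := ⟨_, x'⟩) m (congrArg ExtHom.base h)))

end Lens
end Associator

section Associator

variable {I J K L : Type u} [Groupoid.{u} I] [Groupoid.{u} J] [Groupoid.{u} K] [Groupoid.{u} L]
namespace Lens

noncomputable abbrev assocHomPmMapEl (P : Poly I J) (Q : Poly J K) (R : Poly K L)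
    {i i' : I} {b b' : ((P.comp Q).comp R).Op.Tot} (f : b ⟶ b')
    {x : (P.comp (Q.comp R)).Pm.El (i, ⟨b.base, assocHomOp P Q R b.el⟩)}
    {x' : (P.comp (Q.comp R)).Pm.El (i', ⟨b'.base, assocHomOp P Q R b'.el⟩)}
    (m : (P.comp (Q.comp R)).Pm.Hom x x')
    (h : ((P.comp (Q.comp R)).Pm.proj m).2 = assocHomOpMap P Q R f) :
    (P.comp Q).Pm.Hom (assocHomPm P Q R x).el (assocHomPm P Q R x').el :=
  CompHom.mk (x := ⟨_, (assocHomPm P Q R x).el⟩) (y := ⟨_, (assocHomPm P Q R x').el⟩)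
    ((CompHom.base (x := ⟨_, x⟩) (y := ⟨_, x'⟩) m).1,
      ExtHom.map (w := b) (w' := b') f
        (CompHom.arg (P := Q) (CompHom.arg (x := ⟨_, x⟩) (y := ⟨_, x'⟩) m)) (assocHom_el P Q R f m h))
    (CompHom.el (P := Q) (CompHom.arg (x := ⟨_, x⟩) (y := ⟨_, x'⟩) m))
    (CompHom.el_snd (P := Q) _ (CompHom.arg_snd (x := ⟨_, x⟩) (y := ⟨_, x'⟩) m (congrArg ExtHom.base h)))
    (CompHom.el (x := ⟨_, x⟩) (y := ⟨_, x'⟩) m)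
    (Prod.ext (CompHom.el_fst (x := ⟨_, x⟩) (y := ⟨_, x'⟩) m)
      (CompHom.el_snd (x := ⟨_, x⟩) (y := ⟨_, x'⟩) m h))

noncomputable abbrev assocHomPmMap (P : Poly I J) (Q : Poly J K) (R : Poly K L)
    {i i' : I} {b b' : ((P.comp Q).comp R).Op.Tot} (f : b ⟶ b')
    {x : (P.comp (Q.comp R)).Pm.El (i, ⟨b.base, assocHomOp P Q R b.el⟩)}
    {x' : (P.comp (Q.comp R)).Pm.El (i', ⟨b'.base, assocHomOp P Q R b'.el⟩)}
    (m : (P.comp (Q.comp R)).Pm.Hom x x')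
    (h : ((P.comp (Q.comp R)).Pm.proj m).2 = assocHomOpMap P Q R f) :
    ((P.comp Q).comp R).Pm.Hom (assocHomPm P Q R x) (assocHomPm P Q R x') :=
  CompHom.mk (x := ⟨_, assocHomPm P Q R x⟩) (y := ⟨_, assocHomPm P Q R x'⟩)
    ((CompHom.base (x := ⟨_, x⟩) (y := ⟨_, x'⟩) m).1, f)
    (CompHom.arg (P := Q) (CompHom.arg (x := ⟨_, x⟩) (y := ⟨_, x'⟩) m))
    (assocHom_el P Q R f m h)
    (assocHomPmMapEl P Q R f m h)
    rfl

end Lens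
end Associator

section Associator

variable {I J K L : Type u} [Groupoid.{u} I] [Groupoid.{u} J] [Groupoid.{u} K] [Groupoid.{u} L]
namespace Lens

theorem assocHomOpMap_comp (P : Poly I J) (Q : Poly J K) (R : Poly K L)
    {w w' w'' : ((P.comp Q).comp R).Op.Tot} (f : w ⟶ w') (g : w' ⟶ w'') :
    assocHomOpMap P Q R (f ≫ g) = assocHomOpMap P Q R f ≫ assocHomOpMap P Q R g :=
  ExtHom.ext' (Q := Q.comp R) rfl fun {_ _ x x'} m h h' =>
    have e : (((Q.comp R).Pm.proj (inv (push (assocHomOpMap P Q R f).base x) ≫ m))).2 = (assocHomOpMap P Q R g).base := proj_push_inv_comp h'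
    have e' : ((Q.comp R).Pm.proj (push (assocHomOpMap P Q R f).base x)).2 = (assocHomOpMap P Q R f).base := proj_push_snd
    have a : (R.Pm.proj (CompHom.arg m)).2 = ExtHom.base (w := w) (w' := w'') (f ≫ g) :=
      CompHom.arg_snd m (congrArg ExtHom.base h)
    ExtHom.map_comp_eq (h := CompHom.el_snd (P := Q) m h)
      (ExtHom.comp_map' f g a _ _ (congrArg CompHom.arg (push_comp_inv (m := m)))
        (CompHom.arg_snd (push (assocHomOpMap P Q R f).base x) (congrArg ExtHom.base e'))
        (CompHom.arg_snd (inv (push (assocHomOpMap P Q R f).base x) ≫ m) (congrArg ExtHom.base e)))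
      (congrArg CompHom.el (push_comp_inv (m := m))) 
        (CompHom.el_snd (P := Q) (push (assocHomOpMap P Q R f).base x) e')
        (CompHom.el_snd (P := Q) (inv (push (assocHomOpMap P Q R f).base x) ≫ m) e)

noncomputable abbrev assocHom (P : Poly I J) (Q : Poly J K) (R : Poly K L) :
    Lens ((P.comp Q).comp R) (P.comp (Q.comp R)) where
  op := assocHomOp P Q R
  opMap f := assocHomOpMap P Q R f
  proj_opMap _ := rfl
  opMap_id _ := rfl
  opMap_comp f g := assocHomOpMap_comp P Q R f g
  pm x := assocHomPm P Q R x
  pmMap f _ _ m h := assocHomPmMap P Q R f m h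
  proj_pmMap f _ _ m h := rfl
  pmMap_id _ h := CompHom.ext rfl rfl (CompHom.ext (Prod.ext rfl (Sec.map_id _ _ _)) rfl rfl)
  pmMap_comp f g _ _ _ m n hm hn h := CompHom.ext rfl rfl (CompHom.ext (Prod.ext rfl (ExtHom.comp_map' f g (assocHom_el P Q R (f ≫ g) (m ≫ n) h) _ _ rfl
    (assocHom_el P Q R f m hm) (assocHom_el P Q R g n hn))) rfl rfl)
end Lens
end Associator

section Associator

variable {I J K L : Type u} [Groupoid.{u} I] [Groupoid.{u} J] [Groupoid.{u} K] [Groupoid.{u} L]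

/-- The morphism of parameters of a composite with prescribed components. -/
abbrev CompHom.pair {Q : Poly J K} {R : Poly K L} {w w' : (R.ext Q.Op).Tot} (g : w ⟶ w')
    {j j' : J} {x : CompEl Q R (j, w)} {x' : CompEl Q R (j', w')}
    (m : R.Pm.Hom x.arg x'.arg) (hm : (R.Pm.proj m).2 = ExtHom.base (w := w) (w' := w') g)
    (n : Q.Pm.Hom x.el x'.el) (hn : (Q.Pm.proj n).2 = ExtHom.map (w := w) (w' := w') g m hm) :
    (Q.comp R).Pm.Hom x x' :=
  CompHom.mk (x := ⟨_, x⟩) (y := ⟨_, x'⟩) ((Q.Pm.proj n).1, g) m hm n (Prod.ext rfl hn)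

theorem CompHom.pair_comp {Q : Poly J K} {R : Poly K L} {w w' w'' : (R.ext Q.Op).Tot}
    {f : w ⟶ w'} {g : w' ⟶ w''} {k : w ⟶ w''}
    {j j' j'' : J} {x : CompEl Q R (j, w)} {x' : CompEl Q R (j', w')} {x'' : CompEl Q R (j'', w'')}
    {m : R.Pm.Hom x.arg x'.arg} {m' : R.Pm.Hom x'.arg x''.arg} {m'' : R.Pm.Hom x.arg x''.arg}
    {n : Q.Pm.Hom x.el x'.el} {n' : Q.Pm.Hom x'.el x''.el} {n'' : Q.Pm.Hom x.el x''.el}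
    (hk : k = f ≫ g) (em : m'' = m ≫ m') (en : n'' = n ≫ n')
    (hm : (R.Pm.proj m).2 = ExtHom.base (w := w) (w' := w') f)
    (hn : (Q.Pm.proj n).2 = ExtHom.map (w := w) (w' := w') f m hm)
    (hm' : (R.Pm.proj m').2 = ExtHom.base (w := w') (w' := w'') g)
    (hn' : (Q.Pm.proj n').2 = ExtHom.map (w := w') (w' := w'') g m' hm')
    (hm'' : (R.Pm.proj m'').2 = ExtHom.base (w := w) (w' := w'') k)
    (hn'' : (Q.Pm.proj n'').2 = ExtHom.map (w := w) (w' := w'') k m'' hm'') :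
    CompHom.pair k m'' hm'' n'' hn'' = CompHom.pair f m hm n hn ≫ CompHom.pair g m' hm' n' hn' := by
  subst hk em en
  exact CompHom.ext (Prod.ext (show (Q.Pm.proj (n ≫ n')).1 = (Q.Pm.proj n).1 ≫ (Q.Pm.proj n').1 by
    rw [Q.Pm.proj_comp]; rfl) rfl) rfl rfl

theorem CompHom.pair_id {Q : Poly J K} {R : Poly K L} {w : (R.ext Q.Op).Tot}
    {j : J} {x : CompEl Q R (j, w)}
    (hm : (R.Pm.proj (𝟙 (⟨_, x.arg⟩ : R.Pm.Tot))).2 = ExtHom.base (w := w) (w' := w) (𝟙 w))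
    (hn : (Q.Pm.proj (𝟙 (⟨_, x.el⟩ : Q.Pm.Tot))).2 = ExtHom.map (w := w) (w' := w) (𝟙 w) _ hm) :
    CompHom.pair (𝟙 w) _ hm _ hn = 𝟙 (⟨_, x⟩ : Total (CompEl Q R)) :=
  CompHom.ext (Prod.ext
    (congrArg Prod.fst (Q.Pm.proj_id ⟨(j, ⟨x.idx, (secOf w).obj x.arg⟩), x.el⟩) :) rfl) rfl rfl

namespace Lens

noncomputable abbrev assocInvVal {P : Poly I J} {Q : Poly J K} {R : Poly K L}
    {l : L} (c : (P.comp (Q.comp R)).Op.El l) {k k' : K} {y : R.Pm.El (k, ⟨l, c.fst.fst⟩)}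
    {y' : R.Pm.El (k', ⟨l, c.fst.fst⟩)} (m : R.Pm.Hom y y') (h : (R.Pm.proj m).2 = 𝟙 _)
    {j j' : J} {x : Q.Pm.El (j, ⟨k, c.fst.snd.obj y⟩)} {x' : Q.Pm.El (j', ⟨k', c.fst.snd.obj y'⟩)}
    (n : Q.Pm.Hom x x') (hn : (Q.Pm.proj n).2 = c.fst.snd.map m h) :
    P.Op.Hom (c.snd.obj ⟨k, y, x⟩) (c.snd.obj ⟨k', y', x'⟩) :=
  c.snd.map (CompHom.pair (w := ⟨l, c.fst⟩) (w' := ⟨l, c.fst⟩) (x := ⟨k, y, x⟩) (x' := ⟨k', y', x'⟩) (𝟙 _) m h n hn) rfl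

theorem assocInvVal_comp {P : Poly I J} {Q : Poly J K} {R : Poly K L}
    {l : L} (c : (P.comp (Q.comp R)).Op.El l) {k k' k'' : K} {y : R.Pm.El (k, ⟨l, c.fst.fst⟩)}
    {y' : R.Pm.El (k', ⟨l, c.fst.fst⟩)} {y'' : R.Pm.El (k'', ⟨l, c.fst.fst⟩)}
    {m : R.Pm.Hom y y'} {m' : R.Pm.Hom y' y''} {m'' : R.Pm.Hom y y''} (em : m'' = m ≫ m')
    {h : (R.Pm.proj m).2 = 𝟙 _} {h' : (R.Pm.proj m').2 = 𝟙 _} {h'' : (R.Pm.proj m'').2 = 𝟙 _}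
    {j j' j'' : J} {x : Q.Pm.El (j, ⟨k, c.fst.snd.obj y⟩)} {x' : Q.Pm.El (j', ⟨k', c.fst.snd.obj y'⟩)}
    {x'' : Q.Pm.El (j'', ⟨k'', c.fst.snd.obj y''⟩)}
    {n : Q.Pm.Hom x x'} {n' : Q.Pm.Hom x' x''} {n'' : Q.Pm.Hom x x''} (en : n'' = n ≫ n')
    {hn : (Q.Pm.proj n).2 = c.fst.snd.map m h} {hn' : (Q.Pm.proj n').2 = c.fst.snd.map m' h'}
    {hn'' : (Q.Pm.proj n'').2 = c.fst.snd.map m'' h''} :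
    assocInvVal c m'' h'' n'' hn'' = assocInvVal c m h n hn ≫ assocInvVal c m' h' n' hn' :=
  c.snd.map_comp' _ _ _ (CompHom.pair_comp (w := ⟨l, c.fst⟩) (w' := ⟨l, c.fst⟩) (w'' := ⟨l, c.fst⟩)
    (x := ⟨k, y, x⟩) (x' := ⟨k', y', x'⟩) (x'' := ⟨k'', y'', x''⟩)
    (f := 𝟙 _) (g := 𝟙 _) (Category.comp_id _).symm em en _ _ _ _ _ _) rfl rfl

noncomputable abbrev assocInvObj {P : Poly I J} {Q : Poly J K} {R : Poly K L}
    {l : L} (c : (P.comp (Q.comp R)).Op.El l) {k : K} (y : R.Pm.El (k, ⟨l, c.fst.fst⟩)) :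
    ExtEl Q P.Op k where
  fst := c.fst.snd.obj y
  snd :=
    { obj := fun x => c.snd.obj ⟨k, y, x⟩
      map := fun n h => assocInvVal c (𝟙 (⟨_, y⟩ : R.Pm.Tot)) (congrArg Prod.snd (R.Pm.proj_id _)) n
        (h.trans (c.fst.snd.map_id _ _).symm)
      proj_map := fun n h => c.snd.proj_map _ _
      map_id := fun x h => (c.snd.map_congr _ (congrArg Prod.snd ((Q.comp R).Pm.proj_id _))
        (CompHom.pair_id (w := ⟨l, c.fst⟩) (x := ⟨k, y, x⟩) _ _)).trans (c.snd.map_id _ _)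
      map_comp := fun m n hm hn h => assocInvVal_comp c (Category.comp_id _).symm rfl }

noncomputable abbrev assocInvMap {P : Poly I J} {Q : Poly J K} {R : Poly K L}
    {l : L} (c : (P.comp (Q.comp R)).Op.El l) {k k' : K} {y : R.Pm.El (k, ⟨l, c.fst.fst⟩)}
    {y' : R.Pm.El (k', ⟨l, c.fst.fst⟩)} (m : R.Pm.Hom y y')
    (h : (R.Pm.proj m).2 = 𝟙 _) :
    ExtHom (⟨k, assocInvObj c y⟩ : Total (ExtEl Q P.Op)) ⟨k', assocInvObj c y'⟩ where
  base := c.fst.snd.map m h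
  map := fun n hn => assocInvVal c m h n hn
  proj_map := fun n h => c.snd.proj_map _ _
  map_left := fun n n' hn hn' h => assocInvVal_comp c (Category.id_comp _).symm rfl
  map_right := fun n n' hn hn' h => assocInvVal_comp c (Category.comp_id _).symm rfl

noncomputable abbrev assocInvOp (P : Poly I J) (Q : Poly J K) (R : Poly K L)
    {l : L} (c : (P.comp (Q.comp R)).Op.El l) : ((P.comp Q).comp R).Op.El l where
  fst := c.fst.fst
  snd :=
    { obj := fun y => assocInvObj c y
      map := fun m h => assocInvMap c m h
      proj_map := fun m h => c.fst.snd.proj_map m h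
      map_id := fun y h => ExtHom.ext' (c.fst.snd.map_id y _) fun n h h' => rfl
      map_comp := fun {_ _ _ y y' y''} m m' hm hm' h =>
        ExtHom.ext' (f := assocInvMap c (m ≫ m') h)
          (g := ExtHom.comp (assocInvMap c m hm) (assocInvMap c m' hm'))
          (c.fst.snd.map_comp m m' hm hm' h) fun {_ _ x x'} n h h' =>
        assocInvVal_comp c rfl push_comp_inv }

end Lens
end Associator

section Associator

variable {I J K L : Type u} [Groupoid.{u} I] [Groupoid.{u} J] [Groupoid.{u} K] [Groupoid.{u} L]
namespace Lens

section
variable {P : Poly I J} {Q : Poly J K} {R : Poly K L}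

noncomputable abbrev assocInvMapVal {w w' : (P.comp (Q.comp R)).Op.Tot} (f : w ⟶ w')
    {k k' : K} {y : R.Pm.El (k, ⟨w.base, w.el.fst.fst⟩)}
    {y' : R.Pm.El (k', ⟨w'.base, w'.el.fst.fst⟩)} (m : R.Pm.Hom y y')
    (h : (R.Pm.proj m).2 = ExtHom.base (w := opOf w) (w' := opOf w') (ExtHom.base (w := w) (w' := w') f))
    {j j' : J} {x : Q.Pm.El (j, ⟨k, w.el.fst.snd.obj y⟩)} {x' : Q.Pm.El (j', ⟨k', w'.el.fst.snd.obj y'⟩)}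
    (n : Q.Pm.Hom x x') (hn : (Q.Pm.proj n).2 = ExtHom.map (w := opOf w) (w' := opOf w') (ExtHom.base (w := w) (w' := w') f) m h) :
    P.Op.Hom (w.el.snd.obj ⟨k, y, x⟩) (w'.el.snd.obj ⟨k', y', x'⟩) :=
  ExtHom.map (w := w) (w' := w') f (CompHom.pair (w := opOf w) (w' := opOf w')
    (x := ⟨k, y, x⟩) (x' := ⟨k', y', x'⟩) _ m h n hn) rfl

theorem assocInvMapVal_left {w w' : (P.comp (Q.comp R)).Op.Tot} (f : w ⟶ w')
    {k k' k'' : K} {y : R.Pm.El (k, ⟨w.base, w.el.fst.fst⟩)}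
    {y' : R.Pm.El (k', ⟨w.base, w.el.fst.fst⟩)}
    {y'' : R.Pm.El (k'', ⟨w'.base, w'.el.fst.fst⟩)}
    {m : R.Pm.Hom y y'} {m' : R.Pm.Hom y' y''} {m'' : R.Pm.Hom y y''} (em : m'' = m ≫ m')
    {h : (R.Pm.proj m).2 = 𝟙 _}
    {h' : (R.Pm.proj m').2 = ExtHom.base (w := opOf w) (w' := opOf w') (ExtHom.base (w := w) (w' := w') f)}
    {h'' : (R.Pm.proj m'').2 = ExtHom.base (w := opOf w) (w' := opOf w') (ExtHom.base (w := w) (w' := w') f)}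
    {j j' j'' : J} {x : Q.Pm.El (j, ⟨k, w.el.fst.snd.obj y⟩)} {x' : Q.Pm.El (j', ⟨k', w.el.fst.snd.obj y'⟩)}
    {x'' : Q.Pm.El (j'', ⟨k'', w'.el.fst.snd.obj y''⟩)}
    {n : Q.Pm.Hom x x'} {n' : Q.Pm.Hom x' x''} {n'' : Q.Pm.Hom x x''} (en : n'' = n ≫ n')
    {hn : (Q.Pm.proj n).2 = w.el.fst.snd.map m h}
    {hn' : (Q.Pm.proj n').2 = ExtHom.map (w := opOf w) (w' := opOf w') (ExtHom.base (w := w) (w' := w') f) m' h'}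
    {hn'' : (Q.Pm.proj n'').2 = ExtHom.map (w := opOf w) (w' := opOf w') (ExtHom.base (w := w) (w' := w') f) m'' h''} :
    assocInvMapVal f m'' h'' n'' hn'' = assocInvVal w.el m h n hn ≫ assocInvMapVal f m' h' n' hn' :=
  ExtHom.map_left' (w := w) (w' := w') f _ _ _ (CompHom.pair_comp (w := opOf w) (w' := opOf w) (w'' := opOf w')
    (x := ⟨k, y, x⟩) (x' := ⟨k', y', x'⟩) (x'' := ⟨k'', y'', x''⟩)
    (f := 𝟙 _) (g := ExtHom.base (w := w) (w' := w') f) (Category.id_comp _).symm em en _ _ _ _ _ _) rfl rfl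

theorem assocInvMapVal_right {w w' : (P.comp (Q.comp R)).Op.Tot} (f : w ⟶ w')
    {k k' k'' : K} {y : R.Pm.El (k, ⟨w.base, w.el.fst.fst⟩)}
    {y' : R.Pm.El (k', ⟨w'.base, w'.el.fst.fst⟩)}
    {y'' : R.Pm.El (k'', ⟨w'.base, w'.el.fst.fst⟩)}
    {m : R.Pm.Hom y y'} {m' : R.Pm.Hom y' y''} {m'' : R.Pm.Hom y y''} (em : m'' = m ≫ m')
    {h : (R.Pm.proj m).2 = ExtHom.base (w := opOf w) (w' := opOf w') (ExtHom.base (w := w) (w' := w') f)}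
    {h' : (R.Pm.proj m').2 = 𝟙 _}
    {h'' : (R.Pm.proj m'').2 = ExtHom.base (w := opOf w) (w' := opOf w') (ExtHom.base (w := w) (w' := w') f)}
    {j j' j'' : J} {x : Q.Pm.El (j, ⟨k, w.el.fst.snd.obj y⟩)} {x' : Q.Pm.El (j', ⟨k', w'.el.fst.snd.obj y'⟩)}
    {x'' : Q.Pm.El (j'', ⟨k'', w'.el.fst.snd.obj y''⟩)}
    {n : Q.Pm.Hom x x'} {n' : Q.Pm.Hom x' x''} {n'' : Q.Pm.Hom x x''} (en : n'' = n ≫ n')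
    {hn : (Q.Pm.proj n).2 = ExtHom.map (w := opOf w) (w' := opOf w') (ExtHom.base (w := w) (w' := w') f) m h}
    {hn' : (Q.Pm.proj n').2 = w'.el.fst.snd.map m' h'}
    {hn'' : (Q.Pm.proj n'').2 = ExtHom.map (w := opOf w) (w' := opOf w') (ExtHom.base (w := w) (w' := w') f) m'' h''} :
    assocInvMapVal f m'' h'' n'' hn'' = assocInvMapVal f m h n hn ≫ assocInvVal w'.el m' h' n' hn' :=
  ExtHom.map_right' (w := w) (w' := w') f _ _ _ (CompHom.pair_comp (w := opOf w) (w' := opOf w') (w'' := opOf w')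
    (x := ⟨k, y, x⟩) (x' := ⟨k', y', x'⟩) (x'' := ⟨k'', y'', x''⟩)
    (f := ExtHom.base (w := w) (w' := w') f) (g := 𝟙 _) (Category.comp_id _).symm em en _ _ _ _ _ _) rfl rfl

theorem assocInvMapVal_comp {w w' w'' : (P.comp (Q.comp R)).Op.Tot} (f : w ⟶ w') (g : w' ⟶ w'')
    {k k' k'' : K} {y : R.Pm.El (k, ⟨w.base, w.el.fst.fst⟩)}
    {y' : R.Pm.El (k', ⟨w'.base, w'.el.fst.fst⟩)}
    {y'' : R.Pm.El (k'', ⟨w''.base, w''.el.fst.fst⟩)}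
    {m : R.Pm.Hom y y'} {m' : R.Pm.Hom y' y''} {m'' : R.Pm.Hom y y''} (em : m'' = m ≫ m')
    {h : (R.Pm.proj m).2 = ExtHom.base (w := opOf w) (w' := opOf w') (ExtHom.base (w := w) (w' := w') f)}
    {h' : (R.Pm.proj m').2 = ExtHom.base (w := opOf w') (w' := opOf w'') (ExtHom.base (w := w') (w' := w'') g)}
    {h'' : (R.Pm.proj m'').2 = ExtHom.base (w := opOf w) (w' := opOf w'') (ExtHom.base (w := w) (w' := w'') (f ≫ g))}
    {j j' j'' : J} {x : Q.Pm.El (j, ⟨k, w.el.fst.snd.obj y⟩)} {x' : Q.Pm.El (j', ⟨k', w'.el.fst.snd.obj y'⟩)}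
    {x'' : Q.Pm.El (j'', ⟨k'', w''.el.fst.snd.obj y''⟩)}
    {n : Q.Pm.Hom x x'} {n' : Q.Pm.Hom x' x''} {n'' : Q.Pm.Hom x x''} (en : n'' = n ≫ n')
    {hn : (Q.Pm.proj n).2 = ExtHom.map (w := opOf w) (w' := opOf w') (ExtHom.base (w := w) (w' := w') f) m h}
    {hn' : (Q.Pm.proj n').2 = ExtHom.map (w := opOf w') (w' := opOf w'') (ExtHom.base (w := w') (w' := w'') g) m' h'}
    {hn'' : (Q.Pm.proj n'').2 = ExtHom.map (w := opOf w) (w' := opOf w'') (ExtHom.base (w := w) (w' := w'') (f ≫ g)) m'' h''} :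
    assocInvMapVal (f ≫ g) m'' h'' n'' hn'' = assocInvMapVal f m h n hn ≫ assocInvMapVal g m' h' n' hn' :=
  ExtHom.comp_map' (w := w) (w' := w') (w'' := w'') f g _ _ _ (CompHom.pair_comp (w := opOf w) (w' := opOf w') (w'' := opOf w'')
    (x := ⟨k, y, x⟩) (x' := ⟨k', y', x'⟩) (x'' := ⟨k'', y'', x''⟩)
    (f := ExtHom.base (w := w) (w' := w') f) (g := ExtHom.base (w := w') (w' := w'') g) rfl em en _ _ _ _ _ _) rfl rfl

noncomputable abbrev assocInvOpMapMap {w w' : (P.comp (Q.comp R)).Op.Tot} (f : w ⟶ w')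
    {k k' : K} {y : R.Pm.El (k, ⟨w.base, w.el.fst.fst⟩)}
    {y' : R.Pm.El (k', ⟨w'.base, w'.el.fst.fst⟩)} (m : R.Pm.Hom y y')
    (h : (R.Pm.proj m).2 = ExtHom.base (w := opOf w) (w' := opOf w') (ExtHom.base (w := w) (w' := w') f)) :
    ExtHom (⟨k, assocInvObj w.el y⟩ : Total (ExtEl Q P.Op)) ⟨k', assocInvObj w'.el y'⟩ where
  base := ExtHom.map (w := opOf w) (w' := opOf w') (ExtHom.base (w := w) (w' := w') f) m h
  map := fun n hn => assocInvMapVal f m h n hn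
  proj_map := fun n h => ExtHom.proj_map (w := w) (w' := w') f _ _
  map_left := fun n n' hn hn' h => assocInvMapVal_left f (Category.id_comp _).symm rfl
  map_right := fun n n' hn hn' h => assocInvMapVal_right f (Category.comp_id _).symm rfl

end

noncomputable abbrev assocInvOpMap (P : Poly I J) (Q : Poly J K) (R : Poly K L)
    {w w' : (P.comp (Q.comp R)).Op.Tot} (f : w ⟶ w') :
    ((P.comp Q).comp R).Op.Hom (assocInvOp P Q R w.el) (assocInvOp P Q R w'.el) :=
  ExtHom.mk (w := (⟨w.base, assocInvOp P Q R w.el⟩ : ((P.comp Q).comp R).Op.Tot))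
    (w' := (⟨w'.base, assocInvOp P Q R w'.el⟩ : ((P.comp Q).comp R).Op.Tot))
    (ExtHom.base (w := opOf w) (w' := opOf w') (ExtHom.base (w := w) (w' := w') f))
    (fun m h => assocInvOpMapMap f m h)
    (fun m h => ExtHom.proj_map (w := opOf w) (w' := opOf w') (ExtHom.base (w := w) (w' := w') f) m h)
    (fun {_ _ _ y y' y''} m m' hm hm' h =>
      ExtHom.ext' (f := assocInvOpMapMap f (m ≫ m') h)
        (g := ExtHom.comp (assocInvMap w.el m hm) (assocInvOpMapMap f m' hm'))
        (ExtHom.map_left (w := opOf w) (w' := opOf w') (ExtHom.base (w := w) (w' := w') f) m m' hm hm' h)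
        fun n h h' => assocInvMapVal_left f rfl push_comp_inv)
    (fun {_ _ _ y y' y''} m m' hm hm' h =>
      ExtHom.ext' (f := assocInvOpMapMap f (m ≫ m') h)
        (g := ExtHom.comp (assocInvOpMapMap f m hm) (assocInvMap w'.el m' hm'))
        (ExtHom.map_right (w := opOf w) (w' := opOf w') (ExtHom.base (w := w) (w' := w') f) m m' hm hm' h)
        fun n h h' => assocInvMapVal_right f rfl push_comp_inv)

end Lens
end Associator

section Associator

variable {I J K L : Type u} [Groupoid.{u} I] [Groupoid.{u} J] [Groupoid.{u} K] [Groupoid.{u} L]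
namespace Lens

theorem assocInvOpMap_comp (P : Poly I J) (Q : Poly J K) (R : Poly K L)
    {w w' w'' : (P.comp (Q.comp R)).Op.Tot} (f : w ⟶ w') (g : w' ⟶ w'') :
    assocInvOpMap P Q R (f ≫ g) = assocInvOpMap P Q R f ≫ assocInvOpMap P Q R g :=
  ExtHom.ext' rfl fun {_ _ y y'} m h h' =>
    ExtHom.ext' (f := assocInvOpMapMap (f ≫ g) m h)
      (g := ExtHom.comp (assocInvOpMapMap f (push _ y) proj_push_snd)
        (assocInvOpMapMap g (inv (push _ y) ≫ m) (proj_push_inv_comp h)))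
      (ExtHom.comp_map' (w := opOf w) (w' := opOf w') (w'' := opOf w'')
        (ExtHom.base (w := w) (w' := w') f) (ExtHom.base (w := w') (w' := w'') g) h _ _ push_comp_inv _ _)
      fun n h h' => assocInvMapVal_comp f g push_comp_inv push_comp_inv

noncomputable abbrev assocInvPm (P : Poly I J) (Q : Poly J K) (R : Poly K L)
    {i : I} {b : (P.comp (Q.comp R)).Op.Tot}
    (x : ((P.comp Q).comp R).Pm.El (i, ⟨b.base, assocInvOp P Q R b.el⟩)) :
    (P.comp (Q.comp R)).Pm.El (i, b) :=
  ⟨x.el.idx, ⟨x.idx, x.arg, x.el.arg⟩, x.el.el⟩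

theorem assocInv_arg (P : Poly I J) (Q : Poly J K) (R : Poly K L)
    {i i' : I} {b b' : (P.comp (Q.comp R)).Op.Tot} (f : b ⟶ b')
    {x : ((P.comp Q).comp R).Pm.El (i, ⟨b.base, assocInvOp P Q R b.el⟩)}
    {x' : ((P.comp Q).comp R).Pm.El (i', ⟨b'.base, assocInvOp P Q R b'.el⟩)}
    (m : ((P.comp Q).comp R).Pm.Hom x x')
    (h : (((P.comp Q).comp R).Pm.proj m).2 = assocInvOpMap P Q R f) :
    (R.Pm.proj (CompHom.arg (x := ⟨_, x⟩) (y := ⟨_, x'⟩) m)).2 =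
      ExtHom.base (w := opOf b) (w' := opOf b') (ExtHom.base (w := b) (w' := b') f) :=
  CompHom.arg_snd (x := ⟨_, x⟩) (y := ⟨_, x'⟩) m (congrArg ExtHom.base h)

theorem assocInv_el (P : Poly I J) (Q : Poly J K) (R : Poly K L)
    {i i' : I} {b b' : (P.comp (Q.comp R)).Op.Tot} (f : b ⟶ b')
    {x : ((P.comp Q).comp R).Pm.El (i, ⟨b.base, assocInvOp P Q R b.el⟩)}
    {x' : ((P.comp Q).comp R).Pm.El (i', ⟨b'.base, assocInvOp P Q R b'.el⟩)}
    (m : ((P.comp Q).comp R).Pm.Hom x x')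
    (h : (((P.comp Q).comp R).Pm.proj m).2 = assocInvOpMap P Q R f) :
    ((P.comp Q).Pm.proj (CompHom.el (x := ⟨_, x⟩) (y := ⟨_, x'⟩) m)).2 =
      assocInvOpMapMap f (CompHom.arg (x := ⟨_, x⟩) (y := ⟨_, x'⟩) m) (assocInv_arg P Q R f m h) :=
  CompHom.el_snd (x := ⟨_, x⟩) (y := ⟨_, x'⟩) m h

theorem assocInv_el_arg (P : Poly I J) (Q : Poly J K) (R : Poly K L)
    {i i' : I} {b b' : (P.comp (Q.comp R)).Op.Tot} (f : b ⟶ b')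
    {x : ((P.comp Q).comp R).Pm.El (i, ⟨b.base, assocInvOp P Q R b.el⟩)}
    {x' : ((P.comp Q).comp R).Pm.El (i', ⟨b'.base, assocInvOp P Q R b'.el⟩)}
    (m : ((P.comp Q).comp R).Pm.Hom x x')
    (h : (((P.comp Q).comp R).Pm.proj m).2 = assocInvOpMap P Q R f) :
    (Q.Pm.proj (CompHom.arg (x := ⟨_, x.el⟩) (y := ⟨_, x'.el⟩)
      (CompHom.el (x := ⟨_, x⟩) (y := ⟨_, x'⟩) m))).2 =
      ExtHom.map (w := opOf b) (w' := opOf b') (ExtHom.base (w := b) (w' := b') f)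
        (CompHom.arg (x := ⟨_, x⟩) (y := ⟨_, x'⟩) m) (assocInv_arg P Q R f m h) :=
  CompHom.arg_snd (x := ⟨_, x.el⟩) (y := ⟨_, x'.el⟩)
    (CompHom.el (x := ⟨_, x⟩) (y := ⟨_, x'⟩) m) (congrArg ExtHom.base (assocInv_el P Q R f m h))

noncomputable abbrev assocInvPmMap (P : Poly I J) (Q : Poly J K) (R : Poly K L)
    {i i' : I} {b b' : (P.comp (Q.comp R)).Op.Tot} (f : b ⟶ b')
    {x : ((P.comp Q).comp R).Pm.El (i, ⟨b.base, assocInvOp P Q R b.el⟩)}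
    {x' : ((P.comp Q).comp R).Pm.El (i', ⟨b'.base, assocInvOp P Q R b'.el⟩)}
    (m : ((P.comp Q).comp R).Pm.Hom x x')
    (h : (((P.comp Q).comp R).Pm.proj m).2 = assocInvOpMap P Q R f) :
    (P.comp (Q.comp R)).Pm.Hom (assocInvPm P Q R x) (assocInvPm P Q R x') :=
  CompHom.mk (x := ⟨_, assocInvPm P Q R x⟩) (y := ⟨_, assocInvPm P Q R x'⟩)
    ((CompHom.base (x := ⟨_, x⟩) (y := ⟨_, x'⟩) m).1, f)
    (CompHom.pair (w := opOf b) (w' := opOf b') (ExtHom.base (w := b) (w' := b') f)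
      (x := ⟨x.idx, x.arg, x.el.arg⟩) (x' := ⟨x'.idx, x'.arg, x'.el.arg⟩)
      (CompHom.arg (x := ⟨_, x⟩) (y := ⟨_, x'⟩) m) (assocInv_arg P Q R f m h)
      (CompHom.arg (x := ⟨_, x.el⟩) (y := ⟨_, x'.el⟩) (CompHom.el (x := ⟨_, x⟩) (y := ⟨_, x'⟩) m))
      (assocInv_el_arg P Q R f m h))
    rfl
    (CompHom.el (x := ⟨_, x.el⟩) (y := ⟨_, x'.el⟩) (CompHom.el (x := ⟨_, x⟩) (y := ⟨_, x'⟩) m))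
    (Prod.ext ((CompHom.el_fst (x := ⟨_, x.el⟩) (y := ⟨_, x'.el⟩)
        (CompHom.el (x := ⟨_, x⟩) (y := ⟨_, x'⟩) m)).trans
        (CompHom.el_fst (x := ⟨_, x⟩) (y := ⟨_, x'⟩) m))
      (CompHom.el_snd (x := ⟨_, x.el⟩) (y := ⟨_, x'.el⟩)
        (CompHom.el (x := ⟨_, x⟩) (y := ⟨_, x'⟩) m) (assocInv_el P Q R f m h)))

noncomputable abbrev assocInv (P : Poly I J) (Q : Poly J K) (R : Poly K L) :
    Lens (P.comp (Q.comp R)) ((P.comp Q).comp R) where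
  op := assocInvOp P Q R
  opMap f := assocInvOpMap P Q R f
  proj_opMap _ := rfl
  opMap_id _ := rfl
  opMap_comp f g := assocInvOpMap_comp P Q R f g
  pm x := assocInvPm P Q R x
  pmMap f _ _ m h := assocInvPmMap P Q R f m h
  proj_pmMap f _ _ m h := rfl
  pmMap_id {i b} y h := CompHom.ext rfl (CompHom.pair_id (w := opOf b)
      (x := ⟨y.idx, y.arg, y.el.arg⟩) (assocInv_arg P Q R (𝟙 b) _ h)
      (assocInv_el_arg P Q R (𝟙 b) _ h)) rfl
  pmMap_comp {_ _ _ b b' b''} f g y y' y'' m n hm hn h := CompHom.ext rfl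
    (CompHom.pair_comp (w := opOf b) (w' := opOf b') (w'' := opOf b'')
      (f := ExtHom.base (w := b) (w' := b') f) (g := ExtHom.base (w := b') (w' := b'') g)
      (x := ⟨y.idx, y.arg, y.el.arg⟩) (x' := ⟨y'.idx, y'.arg, y'.el.arg⟩)
      (x'' := ⟨y''.idx, y''.arg, y''.el.arg⟩)
      (m := CompHom.arg (x := ⟨_, y⟩) (y := ⟨_, y'⟩) m)
      (m' := CompHom.arg (x := ⟨_, y'⟩) (y := ⟨_, y''⟩) n)
      (n := CompHom.arg (x := ⟨_, y.el⟩) (y := ⟨_, y'.el⟩)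
        (CompHom.el (x := ⟨_, y⟩) (y := ⟨_, y'⟩) m))
      (n' := CompHom.arg (x := ⟨_, y'.el⟩) (y := ⟨_, y''.el⟩)
        (CompHom.el (x := ⟨_, y'⟩) (y := ⟨_, y''⟩) n))
      rfl rfl rfl (assocInv_arg P Q R f m hm) (assocInv_el_arg P Q R f m hm)
      (assocInv_arg P Q R g n hn) (assocInv_el_arg P Q R g n hn)
      (assocInv_arg P Q R (f ≫ g) _ h) (assocInv_el_arg P Q R (f ≫ g) _ h)) rfl
end Lens
end Associator

section Associator

variable {I J K L : Type u} [Groupoid.{u} I] [Groupoid.{u} J] [Groupoid.{u} K] [Groupoid.{u} L]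
namespace Lens

section
variable (P : Poly I J) (Q : Poly J K) (R : Poly K L)

noncomputable abbrev assocHomInvObj {w : ((P.comp Q).comp R).Op.Tot} : ((P.comp Q).comp R).Op.Tot :=
  ⟨w.base, assocInvOp P Q R (assocHomOp P Q R w.el)⟩

noncomputable abbrev assocHomInvVal {w w' : ((P.comp Q).comp R).Op.Tot} (f : w ⟶ w') {k k' : K}
    {y : R.Pm.El (k, opOf w)} {y' : R.Pm.El (k', opOf w')} (m : R.Pm.Hom y y')
    (h : (R.Pm.proj m).2 = ExtHom.base (w := w) (w' := w') f) :
    ExtHom (⟨k, assocInvObj (assocHomOp P Q R w.el) y⟩ : Total (ExtEl Q P.Op))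
      ⟨k', (secOf w').obj y'⟩ where
  base := ExtHom.base (w := ⟨k, (secOf w).obj y⟩) (w' := ⟨k', (secOf w').obj y'⟩)
    (ExtHom.map (w := w) (w' := w') f m h)
  map := fun n hn => ExtHom.map (w := ⟨k, (secOf w).obj y⟩) (w' := ⟨k', (secOf w').obj y'⟩)
    (ExtHom.map (w := w) (w' := w') f m h) n hn
  proj_map := fun n hn => ExtHom.proj_map (w := ⟨k, (secOf w).obj y⟩)
    (w' := ⟨k', (secOf w').obj y'⟩) (ExtHom.map (w := w) (w' := w') f m h) n hn
  map_left := fun n n' hn hn' h' => ExtHom.map_comp_eq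
    (ExtHom.map_left' (w := w) (w' := w') f h _ _ (Category.id_comp _).symm
      (congrArg Prod.snd (R.Pm.proj_id _)) _) rfl _ _
  map_right := fun n n' hn hn' h' =>
    ExtHom.map_right (w := ⟨k, (secOf w).obj y⟩) (w' := ⟨k', (secOf w').obj y'⟩)
      (ExtHom.map (w := w) (w' := w') f m h) n n' hn hn' h'

noncomputable abbrev assocHomInvApp {w w' : ((P.comp Q).comp R).Op.Tot} (f : w ⟶ w') :
    ExtHom (⟨w.base, assocInvOp P Q R (assocHomOp P Q R w.el)⟩ : ((P.comp Q).comp R).Op.Tot) w' where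
  base := ExtHom.base (w := w) (w' := w') f
  map := fun m h => assocHomInvVal P Q R f m h
  proj_map := fun m h => ExtHom.proj_map (w := w) (w' := w') f m h
  map_left := fun m n hm hn h =>
    have e := ExtHom.map_left (w := w) (w' := w') f m n hm hn h
    ExtHom.ext' (f := assocHomInvVal P Q R f (m ≫ n) h)
      (g := ExtHom.comp (assocInvMap (assocHomOp P Q R w.el) m hm) (assocHomInvVal P Q R f n hn))
      (congrArg ExtHom.base e :) fun m' h h' => ExtHom.map_comp_eq e push_comp_inv _ _
  map_right := fun m n hm hn h =>
    have e := ExtHom.map_right (w := w) (w' := w') f m n hm hn h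
    ExtHom.ext' (f := assocHomInvVal P Q R f (m ≫ n) h)
      (g := ExtHom.comp (assocHomInvVal P Q R f m hm) ((secOf w').map n hn))
      (congrArg ExtHom.base e :) fun m' h h' => ExtHom.map_comp_eq e push_comp_inv _ _

end
end Lens
end Associator

section Associator

variable {I J K L : Type u} [Groupoid.{u} I] [Groupoid.{u} J] [Groupoid.{u} K] [Groupoid.{u} L]
namespace Lens

section
variable (P : Poly I J) (Q : Poly J K) (R : Poly K L)

theorem assocHomInv_app_left {w w' w'' : ((P.comp Q).comp R).Op.Tot} (f : w ⟶ w') (g : w' ⟶ w'') :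
    assocHomInvApp P Q R (f ≫ g) =
      ExtHom.comp (((assocHom P Q R).comp (assocInv P Q R)).opMap f) (assocHomInvApp P Q R g) :=
  ExtHom.ext' rfl fun {_ _ y y'} m h h' =>
    have e := ExtHom.comp_map' f g h _ _ (push_comp_inv (m := m)) proj_push_snd
      (proj_push_inv_comp h)
    ExtHom.ext' (f := assocHomInvVal P Q R (f ≫ g) m h)
      (g := ExtHom.comp (assocInvOpMapMap (assocHomOpMap P Q R f) (push _ y) proj_push_snd)
        (assocHomInvVal P Q R g (inv (push _ y) ≫ m) (proj_push_inv_comp h)))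
      (congrArg ExtHom.base e :) fun m' h h' => ExtHom.map_comp_eq (h := h) e push_comp_inv _ _

theorem assocHomInv_app_right {w w' w'' : ((P.comp Q).comp R).Op.Tot} (f : w ⟶ w') (g : w' ⟶ w'') :
    assocHomInvApp P Q R (f ≫ g) =
      ExtHom.comp (assocHomInvApp P Q R f) g :=
  ExtHom.ext' rfl fun {_ _ y y'} m h h' =>
    have e := ExtHom.comp_map' f g h _ _ (push_comp_inv (m := m)) proj_push_snd
      (proj_push_inv_comp h)
    ExtHom.ext' (f := assocHomInvVal P Q R (f ≫ g) m h)
      (g := ExtHom.comp (assocHomInvVal P Q R f (push _ y) proj_push_snd)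
        (ExtHom.map (w := w') (w' := w'') g (inv (push _ y) ≫ m) (proj_push_inv_comp h)))
      (congrArg ExtHom.base e :) fun m' h h' => ExtHom.map_comp_eq (h := h) e push_comp_inv _ _

theorem assocHomInv_arg
    {i i' : I} {b b' : ((P.comp Q).comp R).Op.Tot} (f : b ⟶ b')
    {x : ((P.comp Q).comp R).Pm.El (i, ((assocHom P Q R).comp (assocInv P Q R)).ob b)}
    {x' : ((P.comp Q).comp R).Pm.El (i', b')}
    (m : ((P.comp Q).comp R).Pm.Hom x x')
    (h : (((P.comp Q).comp R).Pm.proj m).2 = assocHomInvApp P Q R f) : (R.Pm.proj (CompHom.arg (x := ⟨_, x⟩) (y := ⟨_, x'⟩) m)).2 =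
    ExtHom.base (w := b) (w' := b') f :=
  CompHom.arg_snd (x := ⟨_, x⟩) (y := ⟨_, x'⟩) m (congrArg ExtHom.base h)

theorem assocHomInv_el
    {i i' : I} {b b' : ((P.comp Q).comp R).Op.Tot} (f : b ⟶ b')
    {x : ((P.comp Q).comp R).Pm.El (i, ((assocHom P Q R).comp (assocInv P Q R)).ob b)}
    {x' : ((P.comp Q).comp R).Pm.El (i', b')}
    (m : ((P.comp Q).comp R).Pm.Hom x x')
    (h : (((P.comp Q).comp R).Pm.proj m).2 = assocHomInvApp P Q R f) : ((P.comp Q).Pm.proj (CompHom.el (x := ⟨_, x⟩) (y := ⟨_, x'⟩) m)).2 =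
    assocHomInvVal P Q R f (CompHom.arg (x := ⟨_, x⟩) (y := ⟨_, x'⟩) m) (assocHomInv_arg P Q R f m h) :=
  CompHom.el_snd (x := ⟨_, x⟩) (y := ⟨_, x'⟩) m h

theorem assocHomInv_el_arg
    {i i' : I} {b b' : ((P.comp Q).comp R).Op.Tot} (f : b ⟶ b')
    {x : ((P.comp Q).comp R).Pm.El (i, ((assocHom P Q R).comp (assocInv P Q R)).ob b)}
    {x' : ((P.comp Q).comp R).Pm.El (i', b')}
    (m : ((P.comp Q).comp R).Pm.Hom x x')
    (h : (((P.comp Q).comp R).Pm.proj m).2 = assocHomInvApp P Q R f) :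
    (Q.Pm.proj (CompHom.arg (x := ⟨_, x.el⟩) (y := ⟨_, x'.el⟩)
      (CompHom.el (x := ⟨_, x⟩) (y := ⟨_, x'⟩) m))).2 =
      ExtHom.base (w := ⟨x.idx, (secOf b).obj x.arg⟩) (w' := ⟨x'.idx, (secOf b').obj x'.arg⟩)
        (ExtHom.map (w := b) (w' := b') f (CompHom.arg (x := ⟨_, x⟩) (y := ⟨_, x'⟩) m)
          (assocHomInv_arg P Q R f m h)) :=
  CompHom.arg_snd (x := ⟨_, x.el⟩) (y := ⟨_, x'.el⟩)
    (CompHom.el (x := ⟨_, x⟩) (y := ⟨_, x'⟩) m) (congrArg ExtHom.base (assocHomInv_el P Q R f m h))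

noncomputable abbrev assocHomInvPmEl
    {i i' : I} {b b' : ((P.comp Q).comp R).Op.Tot} (f : b ⟶ b')
    {x : ((P.comp Q).comp R).Pm.El (i, ((assocHom P Q R).comp (assocInv P Q R)).ob b)}
    {x' : ((P.comp Q).comp R).Pm.El (i', b')}
    (m : ((P.comp Q).comp R).Pm.Hom x x')
    (h : (((P.comp Q).comp R).Pm.proj m).2 = assocHomInvApp P Q R f) :
    (P.comp Q).Pm.Hom (assocHomPm P Q R (assocInvPm P Q R (b := (assocHom P Q R).ob b) x)).el x'.el :=
  CompHom.mk (x := ⟨_, (assocHomPm P Q R (assocInvPm P Q R (b := (assocHom P Q R).ob b) x)).el⟩) (y := ⟨_, x'.el⟩)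
    ((CompHom.base (x := ⟨_, x⟩) (y := ⟨_, x'⟩) m).1,
      ExtHom.map (w := b) (w' := b') f (CompHom.arg (x := ⟨_, x⟩) (y := ⟨_, x'⟩) m)
          (assocHomInv_arg P Q R f m h))
    (CompHom.arg (x := ⟨_, x.el⟩) (y := ⟨_, x'.el⟩) (CompHom.el (x := ⟨_, x⟩) (y := ⟨_, x'⟩) m))
    (assocHomInv_el_arg P Q R f m h)
    (CompHom.el (x := ⟨_, x.el⟩) (y := ⟨_, x'.el⟩) (CompHom.el (x := ⟨_, x⟩) (y := ⟨_, x'⟩) m))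
    (Prod.ext ((CompHom.el_fst (x := ⟨_, x.el⟩) (y := ⟨_, x'.el⟩)
        (CompHom.el (x := ⟨_, x⟩) (y := ⟨_, x'⟩) m)).trans
        (CompHom.el_fst (x := ⟨_, x⟩) (y := ⟨_, x'⟩) m))
      (CompHom.el_snd (x := ⟨_, x.el⟩) (y := ⟨_, x'.el⟩)
        (CompHom.el (x := ⟨_, x⟩) (y := ⟨_, x'⟩) m) (assocHomInv_el P Q R f m h)))

noncomputable abbrev assocHomInvPm
    {i i' : I} {b b' : ((P.comp Q).comp R).Op.Tot} (f : b ⟶ b')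
    {x : ((P.comp Q).comp R).Pm.El (i, ((assocHom P Q R).comp (assocInv P Q R)).ob b)}
    {x' : ((P.comp Q).comp R).Pm.El (i', b')}
    (m : ((P.comp Q).comp R).Pm.Hom x x')
    (h : (((P.comp Q).comp R).Pm.proj m).2 = assocHomInvApp P Q R f) :
    ((P.comp Q).comp R).Pm.Hom (assocHomPm P Q R (assocInvPm P Q R (b := (assocHom P Q R).ob b) x)) x' :=
  CompHom.mk (x := ⟨_, assocHomPm P Q R (assocInvPm P Q R (b := (assocHom P Q R).ob b) x)⟩) (y := ⟨_, x'⟩)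
    ((CompHom.base (x := ⟨_, x⟩) (y := ⟨_, x'⟩) m).1, f)
    (CompHom.arg (x := ⟨_, x⟩) (y := ⟨_, x'⟩) m)
    (assocHomInv_arg P Q R f m h)
    (assocHomInvPmEl P Q R f m h) rfl

noncomputable def assocHomInv :
    Cell ((assocHom P Q R).comp (assocInv P Q R)) (Lens.id _) where
  app f := assocHomInvApp P Q R f
  proj_app f := rfl
  app_left f g := assocHomInv_app_left P Q R f g
  app_right f g := assocHomInv_app_right P Q R f g
  pm f _ _ m h := assocHomInvPm P Q R f m h
  proj_pm f _ _ m h := rfl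
  pm_left f g y y' y'' m n hm hn h := CompHom.ext rfl rfl (CompHom.ext (Prod.ext rfl
    (ExtHom.comp_map' f g (assocHomInv_arg P Q R (f ≫ g) _ h) _ _ rfl
      (CompHom.arg_snd (x := ⟨_, y⟩) (y := ⟨_, y'⟩) m (congrArg ExtHom.base hm)) (assocHomInv_arg P Q R g _ hn))) rfl rfl)
  pm_right {_ _ _ b b' b''} f g y y' y'' m n hm hn h := CompHom.ext
    (Prod.ext rfl (congrArg (CategoryStruct.comp f) (show g = (CompHom.base n).2 from hn.symm))) rfl
    (CompHom.ext (Prod.ext (congrArg (CategoryStruct.comp (CompHom.base m).1)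
        (CompHom.el_fst (x := ⟨_, y'⟩) (y := ⟨_, y''⟩) n).symm)
      ((ExtHom.comp_map' f g (assocHomInv_arg P Q R (f ≫ g) _ h) _ _ rfl
        (assocHomInv_arg P Q R f m hm) (CompHom.arg_snd (x := ⟨_, y'⟩) (y := ⟨_, y''⟩) n (congrArg ExtHom.base hn))).trans
        (congrArg (CategoryStruct.comp (ExtHom.map (w := b) (w' := b') f (CompHom.arg (x := ⟨_, y⟩) (y := ⟨_, y'⟩) m)
          (assocHomInv_arg P Q R f m hm)))
          (CompHom.el_snd (x := ⟨_, y'⟩) (y := ⟨_, y''⟩) n hn).symm))) rfl rfl)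
end
end Lens
end Associator

section Associator

variable {I J K L : Type u} [Groupoid.{u} I] [Groupoid.{u} J] [Groupoid.{u} K] [Groupoid.{u} L]

theorem CompHom.pair_eta {Q : Poly J K} {R : Poly K L} {w w' : (R.ext Q.Op).Tot} {g : w ⟶ w'}
    {j j' : J} {x : CompEl Q R (j, w)} {x' : CompEl Q R (j', w')}
    (m : (Q.comp R).Pm.Hom x x') (h : (CompHom.base (x := ⟨_, x⟩) (y := ⟨_, x'⟩) m).2 = g) :
    CompHom.pair (w := w) (w' := w') g (CompHom.arg (x := ⟨_, x⟩) (y := ⟨_, x'⟩) m)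
      (CompHom.arg_snd (x := ⟨_, x⟩) (y := ⟨_, x'⟩) m (congrArg ExtHom.base h))
      (CompHom.el (x := ⟨_, x⟩) (y := ⟨_, x'⟩) m)
      (CompHom.el_snd (x := ⟨_, x⟩) (y := ⟨_, x'⟩) m h) = m :=
  CompHom.ext (Prod.ext (CompHom.el_fst (x := ⟨_, x⟩) (y := ⟨_, x'⟩) m) h.symm) rfl rfl

namespace Lens

section
variable (P : Poly I J) (Q : Poly J K) (R : Poly K L)

noncomputable abbrev assocInvHomApp {w w' : (P.comp (Q.comp R)).Op.Tot} (f : w ⟶ w') :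
    ExtHom (⟨w.base, assocHomOp P Q R (assocInvOp P Q R w.el)⟩ : (P.comp (Q.comp R)).Op.Tot) w' where
  base := ExtHom.base (w := w) (w' := w') f
  map := fun m h => ExtHom.map (w := w) (w' := w') f m h
  proj_map := fun m h => ExtHom.proj_map (w := w) (w' := w') f m h
  map_left := fun m n hm hn h => (ExtHom.map_left (w := w) (w' := w') f m n hm hn h).trans
    (congrArg (· ≫ ExtHom.map (w := w) (w' := w') f n hn)
      ((secOf w).map_congr hm rfl (CompHom.pair_eta m hm).symm))
  map_right := fun m n hm hn h => ExtHom.map_right (w := w) (w' := w') f m n hm hn h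

theorem assocInvHom_app_left {w w' w'' : (P.comp (Q.comp R)).Op.Tot} (f : w ⟶ w') (g : w' ⟶ w'') :
    assocInvHomApp P Q R (f ≫ g) =
      ExtHom.comp (((assocInv P Q R).comp (assocHom P Q R)).opMap f) (assocInvHomApp P Q R g) :=
  ExtHom.ext' rfl fun {_ _ y y'} m h h' =>
    have e : ((Q.comp R).Pm.proj (push (ExtHom.base (w := w) (w' := w') f) y)).2 =
      ExtHom.base (w := w) (w' := w') f := proj_push_snd
    (ExtHom.comp_map' f g h _ _ (push_comp_inv (m := m)) e (proj_push_inv_comp h)).trans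
      (congrArg (· ≫ ExtHom.map (w := w') (w' := w'') g _ (proj_push_inv_comp h))
        (ExtHom.map_eq (w := w) (w' := w') f (CompHom.pair_eta (push _ y) e).symm e rfl))

theorem assocInvHom_app_right {w w' w'' : (P.comp (Q.comp R)).Op.Tot} (f : w ⟶ w') (g : w' ⟶ w'') :
    assocInvHomApp P Q R (f ≫ g) =
      ExtHom.comp (assocInvHomApp P Q R f) g :=
  ExtHom.ext' rfl fun {_ _ y y'} m h h' =>
    ExtHom.comp_map' f g h _ _ (push_comp_inv (m := m)) proj_push_snd
      (proj_push_inv_comp h)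

noncomputable abbrev assocInvHomPm {i i' : I} {b b' : (P.comp (Q.comp R)).Op.Tot} (f : b ⟶ b')
    {x : (P.comp (Q.comp R)).Pm.El (i, ((assocInv P Q R).comp (assocHom P Q R)).ob b)}
    {x' : (P.comp (Q.comp R)).Pm.El (i', b')}
    (m : (P.comp (Q.comp R)).Pm.Hom x x')
    (h : ((P.comp (Q.comp R)).Pm.proj m).2 = assocInvHomApp P Q R f) :
    (P.comp (Q.comp R)).Pm.Hom (assocInvPm P Q R (assocHomPm P Q R (b := (assocInv P Q R).ob b) x)) x' :=
  CompHom.mk (x := ⟨_, assocInvPm P Q R (assocHomPm P Q R (b := (assocInv P Q R).ob b) x)⟩) (y := ⟨_, x'⟩)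
    ((CompHom.base (x := ⟨_, x⟩) (y := ⟨_, x'⟩) m).1, f)
    (CompHom.arg (x := ⟨_, x⟩) (y := ⟨_, x'⟩) m)
    (CompHom.arg_snd (x := ⟨_, x⟩) (y := ⟨_, x'⟩) m (congrArg ExtHom.base h))
    (CompHom.el (x := ⟨_, x⟩) (y := ⟨_, x'⟩) m)
    (Prod.ext (CompHom.el_fst (x := ⟨_, x⟩) (y := ⟨_, x'⟩) m)
      (CompHom.el_snd (x := ⟨_, x⟩) (y := ⟨_, x'⟩) m h))

noncomputable def assocInvHom :
    Cell ((assocInv P Q R).comp (assocHom P Q R)) (Lens.id _) where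
  app f := assocInvHomApp P Q R f
  proj_app f := rfl
  app_left f g := assocInvHom_app_left P Q R f g
  app_right f g := assocInvHom_app_right P Q R f g
  pm f _ _ m h := assocInvHomPm P Q R f m h
  proj_pm f _ _ m h := rfl
  pm_left {_ _ _ b b' _} f g y y' y'' m n hm hn h := CompHom.ext rfl
    (congrArg (· ≫ CompHom.arg (x := ⟨_, y'⟩) (y := ⟨_, y''⟩) n)
      (CompHom.pair_eta (w := opOf b) (w' := opOf b') (x := y.arg) (x' := y'.arg) (CompHom.arg (x := ⟨_, y⟩) (y := ⟨_, y'⟩) m)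
        (CompHom.arg_snd (x := ⟨_, y⟩) (y := ⟨_, y'⟩) m (congrArg ExtHom.base hm))).symm) rfl
  pm_right f g y y' y'' m n hm hn h := CompHom.ext
    (Prod.ext rfl (congrArg (CategoryStruct.comp f) (show g = (CompHom.base n).2 from hn.symm))) rfl rfl
end
end Lens
end Associator

section Unit

variable {I J K : Type u} [Groupoid.{u} I] [Groupoid.{u} J] [Groupoid.{u} K]

/-- A family of sets indexed by a groupoid `J`. -/
structure SetFam (J : Type u) [Groupoid.{u} J] where
  El : J → Type u
  act : ∀ {j j' : J}, (j ⟶ j') → El j → El j'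
  act_id : ∀ {j : J} (x : El j), act (𝟙 j) x = x
  act_comp : ∀ {j j' j'' : J} (f : j ⟶ j') (g : j' ⟶ j'') (x : El j),
    act (f ≫ g) x = act g (act f x)

@[ext]
structure SetHom {A : SetFam J} (x y : Total A.El) where
  base : x.base ⟶ y.base
  act_eq : A.act base x.el = y.el

noncomputable instance (A : SetFam J) : Groupoid (Total A.El) where
  Hom x y := SetHom x y
  id x := ⟨𝟙 _, A.act_id _⟩
  comp f g := ⟨f.base ≫ g.base, by rw [A.act_comp, f.act_eq, g.act_eq]⟩
  id_comp f := SetHom.ext (Category.id_comp _)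
  comp_id f := SetHom.ext (Category.comp_id _)
  assoc f g h := SetHom.ext (Category.assoc _ _ _)
  inv f := ⟨inv f.base, by rw [← f.act_eq, ← A.act_comp, IsIso.hom_inv_id, A.act_id]⟩
  inv_comp f := SetHom.ext (IsIso.inv_hom_id _)
  comp_inv f := SetHom.ext (IsIso.hom_inv_id _)

/-- A family of sets, as a family of groupoids. -/
noncomputable abbrev SetFam.toGFam (A : SetFam J) : GFam J where
  El := A.El
  proj f := SetHom.base f
  proj_id _ := rfl
  proj_comp _ _ := rfl
  exists_lift f x := ⟨A.act f x, SetHom.mk (x := ⟨_, x⟩) (y := ⟨_, A.act f x⟩) f rfl, rfl⟩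

/-- The family of one-point sets. -/
def SetFam.point (J : Type u) [Groupoid.{u} J] : SetFam J where
  El _ := PUnit
  act _ x := x
  act_id _ := rfl
  act_comp _ _ _ := rfl

/-- The family of the sets of isomorphisms `i ⟶ j`. -/
noncomputable def SetFam.path (J : Type u) [Groupoid.{u} J] : SetFam (J × (point J).toGFam.Tot) where
  El b := b.1 ⟶ b.2.base
  act f u := inv f.1 ≫ u ≫ (point J).toGFam.proj f.2
  act_id {b} u := by
    rw [prod_id_snd, GFam.proj_id]
    simp
  act_comp f g u := by
    rw [prod_comp_snd, GFam.proj_comp]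
    simp

/-- The identity polynomial: one operation of each colour `j`, whose parameters of colour `i`
are the identifications of `i` with `j`. -/
noncomputable def Poly.unit (J : Type u) [Groupoid.{u} J] : Poly J J where
  Op := (SetFam.point J).toGFam
  Pm := (SetFam.path J).toGFam

/-- The morphism of parameters of the identity polynomial given by a commutative square. -/
abbrev Poly.unitHom {b b' : J × (Poly.unit J).Op.Tot} (f : b ⟶ b') {u : b.1 ⟶ b.2.base}
    {v : b'.1 ⟶ b'.2.base} (h : u ≫ (Poly.unit J).Op.proj f.2 = f.1 ≫ v) :
    (Poly.unit J).Pm.Hom (j := b) (j' := b') u v :=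
  SetHom.mk (A := SetFam.path J) (x := ⟨b, u⟩) (y := ⟨b', v⟩) f
    ((congrArg (fun t => inv f.1 ≫ t) h).trans (by simp))

theorem Poly.unitHom_w {b b' : J × (Poly.unit J).Op.Tot} {u : b.1 ⟶ b.2.base}
    {v : b'.1 ⟶ b'.2.base} (m : (Poly.unit J).Pm.Hom (j := b) (j' := b') u v) :
    u ≫ (Poly.unit J).Op.proj ((Poly.unit J).Pm.proj m).2 = ((Poly.unit J).Pm.proj m).1 ≫ v := by
  have h : inv ((Poly.unit J).Pm.proj m).1 ≫ u ≫
      (Poly.unit J).Op.proj ((Poly.unit J).Pm.proj m).2 = v :=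
    SetHom.act_eq (A := SetFam.path J) (x := ⟨b, u⟩) (y := ⟨b', v⟩) m
  exact (IsIso.inv_comp_eq _).1 h

theorem Poly.id_fst (Q : Poly J K) {x : Q.Pm.Tot} : (Q.Pm.proj (𝟙 x)).1 = 𝟙 x.base.1 := by
  rw [GFam.proj_id]; rfl

theorem Poly.comp_fst (Q : Poly J K) {x y z : Q.Pm.Tot} {m : x ⟶ y} {n : y ⟶ z} :
    (Q.Pm.proj (m ≫ n)).1 = (Q.Pm.proj m).1 ≫ (Q.Pm.proj n).1 := by
  rw [GFam.proj_comp]; rfl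

namespace Lens

noncomputable abbrev leftHomPmMap (Q : Poly J K) {i i' : J} {b b' : ((Poly.unit J).comp Q).Op.Tot}
    (f : b ⟶ b') {y : Q.Pm.El (i, opOf b)} {y' : Q.Pm.El (i', opOf b')} (m : Q.Pm.Hom y y')
    (h : (Q.Pm.proj m).2 = ExtHom.base (w := b) (w' := b') f) :
    ((Poly.unit J).comp Q).Pm.Hom (j := (i, b)) (j' := (i', b'))
      ⟨i, y, (𝟙 i : i ⟶ i)⟩ ⟨i', y', (𝟙 i' : i' ⟶ i')⟩ :=
  CompHom.mk (x := ⟨(i, b), ⟨i, y, (𝟙 i : i ⟶ i)⟩⟩)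
    (y := ⟨(i', b'), ⟨i', y', (𝟙 i' : i' ⟶ i')⟩⟩)
    ((Q.Pm.proj m).1, f) m h
    (Poly.unitHom (b := (i, ⟨i, b.el.snd.obj y⟩)) (b' := (i', ⟨i', b'.el.snd.obj y'⟩))
      ((Q.Pm.proj m).1, ExtHom.map (w := b) (w' := b') f m h) (u := 𝟙 i) (v := 𝟙 i')
      ((Category.id_comp _).trans ((ExtHom.proj_map (w := b) (w' := b') f m h).trans
        (Category.comp_id _).symm))) rfl

noncomputable abbrev leftHom (Q : Poly J K) : Lens ((Poly.unit J).comp Q) Q where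
  op b := b.fst
  opMap {b b'} f := ExtHom.base (w := b) (w' := b') f
  proj_opMap _ := rfl
  opMap_id _ := rfl
  opMap_comp _ _ := rfl
  pm {i _} y := ⟨i, y, (𝟙 i : i ⟶ i)⟩
  pmMap f _ _ m h := leftHomPmMap Q f m h
  proj_pmMap f _ _ m h := Prod.ext rfl rfl
  pmMap_id {i b} y h := 
    CompHom.ext (Prod.ext (Poly.id_fst Q) rfl) rfl (SetHom.ext (Prod.ext 
      (Poly.id_fst Q) (b.el.snd.map_id _ _)))
  pmMap_comp {_ _ _ b b' b''} f g _ _ _ m n hm hn h := 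
    CompHom.ext (Prod.ext (Poly.comp_fst Q) rfl) rfl (SetHom.ext (Prod.ext 
      (Poly.comp_fst Q) (ExtHom.comp_map' f g h m n rfl hm hn)))

end Lens
end Unit

section Unit

variable {I J K : Type u} [Groupoid.{u} I] [Groupoid.{u} J] [Groupoid.{u} K]

abbrev Poly.pointHom {x y : (Poly.unit J).Op.Tot} (f : x.base ⟶ y.base) : x ⟶ y :=
  SetHom.mk (A := SetFam.point J) f rfl

theorem Poly.pointHom_ext {x y : (Poly.unit J).Op.Tot} {f g : x ⟶ y}
    (h : (Poly.unit J).Op.proj f = (Poly.unit J).Op.proj g) : f = g :=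
  SetHom.ext (A := SetFam.point J) h

namespace Lens

section
variable {Q : Poly J K}

abbrev leftEl (x : ((Poly.unit J).comp Q).Pm.Tot) : x.base.1 ⟶ x.el.idx := x.el.el

theorem left_w {x y : ((Poly.unit J).comp Q).Pm.Tot} (m : x ⟶ y) :
    leftEl x ≫ (Q.Pm.proj (CompHom.arg (x := x) (y := y) m)).1 =
      (CompHom.base (x := x) (y := y) m).1 ≫ leftEl y := by
  have h := Poly.unitHom_w (CompHom.el (x := x) (y := y) m)
  have e := ExtHom.proj_map (w := x.base.2) (w' := y.base.2) (CompHom.base (x := x) (y := y) m).2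
    (CompHom.arg (x := x) (y := y) m) (CompHom.arg_snd m rfl)
  have e' := CompHom.el_snd m rfl
  have e'' := CompHom.el_fst m
  refine Eq.trans ?_ (h.trans ?_)
  · refine congrArg (CategoryStruct.comp _) ?_
    exact e.symm.trans (congrArg (Poly.unit J).Op.proj e').symm
  · exact congrArg (· ≫ _) e''

/-- The parameter of `Q` given by a parameter of the composite with the identity. -/
noncomputable abbrev leftPush (x : ((Poly.unit J).comp Q).Pm.Tot) :
    Q.Pm.Hom (j := (x.el.idx, opOf x.base.2)) (j' := (x.base.1, opOf x.base.2)) x.el.arg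
      (Q.Pm.pushEl (j := (x.el.idx, opOf x.base.2)) (j' := (x.base.1, opOf x.base.2))
        (inv (leftEl x), 𝟙 _) x.el.arg) :=
  Q.Pm.push _ _

noncomputable abbrev leftMap {x y : ((Poly.unit J).comp Q).Pm.Tot} (m : x ⟶ y) :=
  inv (leftPush x) ≫ CompHom.arg (x := x) (y := y) m ≫ leftPush y

theorem leftMap_snd {x y : ((Poly.unit J).comp Q).Pm.Tot} (m : x ⟶ y) {f : opOf x.base.2 ⟶ opOf y.base.2}
    (h : ExtHom.base (w := x.base.2) (w' := y.base.2) (CompHom.base (x := x) (y := y) m).2 = f) :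
    (Q.Pm.proj (leftMap m)).2 = f := by
  have := CompHom.arg_snd m h
  simp [leftMap, this]

theorem leftMap_fst {x y : ((Poly.unit J).comp Q).Pm.Tot} (m : x ⟶ y) :
    (Q.Pm.proj (leftMap m)).1 = (CompHom.base (x := x) (y := y) m).1 := by
  rw [leftMap, Poly.comp_fst, Poly.comp_fst, GFam.proj_inv, GFam.proj_push, GFam.proj_push, prod_inv_fst]
  change inv (inv (leftEl x)) ≫ _ ≫ inv (leftEl y) = _
  rw [IsIso.inv_inv, ← Category.assoc]
  exact (IsIso.comp_inv_eq _).2 (left_w m)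

theorem leftMap_comp {x y z : ((Poly.unit J).comp Q).Pm.Tot} (m : x ⟶ y) (n : y ⟶ z) :
    leftMap (m ≫ n) = leftMap m ≫ leftMap n := by
  have : CompHom.arg (x := x) (y := z) (m ≫ n) = CompHom.arg (x := x) (y := y) m ≫
    CompHom.arg (x := y) (y := z) n := rfl
  simp [leftMap, this]

theorem leftMap_id (x : ((Poly.unit J).comp Q).Pm.Tot) : leftMap (𝟙 x) = 𝟙 _ := by
  have : CompHom.arg (x := x) (y := x) (𝟙 x) = 𝟙 _ := rfl
  simp [leftMap, this]

end

noncomputable abbrev trivSec (Q : Poly J K) (c : Q.Op.Tot) : Sec Q (Poly.unit J).Op c where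
  obj _ := PUnit.unit
  map m _ := Poly.pointHom (Q.Pm.proj m).1
  proj_map _ _ := rfl
  map_id _ _ := Poly.pointHom_ext (Poly.id_fst Q)
  map_comp _ _ _ _ _ := Poly.pointHom_ext (Poly.comp_fst Q)

noncomputable abbrev leftInvOpMap (Q : Poly J K) {b b' : Q.Op.Tot} (f : b ⟶ b') :
    ((Poly.unit J).comp Q).Op.Hom (j := b.base) (j' := b'.base) ⟨b.el, trivSec Q b⟩ ⟨b'.el, trivSec Q b'⟩ :=
  ExtHom.mk (w := ⟨b.base, ⟨b.el, trivSec Q b⟩⟩) (w' := ⟨b'.base, ⟨b'.el, trivSec Q b'⟩⟩) f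
    (fun m _ => Poly.pointHom (Q.Pm.proj m).1) (fun _ _ => rfl)
    (fun _ _ _ _ _ => Poly.pointHom_ext (Poly.comp_fst Q))
    (fun _ _ _ _ _ => Poly.pointHom_ext (Poly.comp_fst Q))

noncomputable abbrev leftInv (Q : Poly J K) : Lens Q ((Poly.unit J).comp Q) where
  op {j} b := ⟨b, trivSec Q ⟨j, b⟩⟩
  opMap f := leftInvOpMap Q f
  proj_opMap _ := rfl
  opMap_id _ := ExtHom.ext' rfl fun _ _ _ => Poly.pointHom_ext rfl
  opMap_comp _ _ := ExtHom.ext' rfl fun m _ _ => Poly.pointHom_ext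
    ((congrArg (fun t => (Q.Pm.proj t).1) (push_comp_inv (m := m))).trans (Poly.comp_fst Q))
  pm {i b} y := Q.Pm.pushEl (j := (y.idx, b)) (j' := (i, b))
        (inv (show i ⟶ y.idx from y.el), 𝟙 _) y.arg
  pmMap f y y' m h := leftMap (x := ⟨_, y⟩) (y := ⟨_, y'⟩) m
  proj_pmMap f y y' m h := Prod.ext (leftMap_fst (x := ⟨_, y⟩) (y := ⟨_, y'⟩) m) (leftMap_snd (x := ⟨_, y⟩) (y := ⟨_, y'⟩) m (congrArg ExtHom.base h))
  pmMap_id {i b} y h := leftMap_id _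
  pmMap_comp {_ _ _ b b' b''} f g _ _ _ m n hm hn h := leftMap_comp _ _

end Lens
end Unit

section Unit

variable {I J K : Type u} [Groupoid.{u} I] [Groupoid.{u} J] [Groupoid.{u} K]

namespace Lens

noncomputable abbrev leftHomInvApp (Q : Poly J K) {w w' : ((Poly.unit J).comp Q).Op.Tot}
    (f : w ⟶ w') : (⟨w.base, ⟨w.el.fst, trivSec Q _⟩⟩ : ((Poly.unit J).comp Q).Op.Tot) ⟶ w' :=
  ExtHom.mk (w := ⟨w.base, ⟨w.el.fst, trivSec Q _⟩⟩) (w' := w') (ExtHom.base (w := w) (w' := w') f)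
    (fun m _ => Poly.pointHom (Q.Pm.proj m).1) (fun _ _ => rfl)
    (fun _ _ _ _ _ => Poly.pointHom_ext (Poly.comp_fst Q))
    (fun _ n _ hn _ => Poly.pointHom_ext ((Poly.comp_fst Q).trans
      (congrArg (CategoryStruct.comp _) ((secOf w').proj_map n hn).symm)))

theorem left_fst {Q : Poly J K} {x y : ((Poly.unit J).comp Q).Pm.Tot} (m : x ⟶ y) :
    (Q.Pm.proj (inv (leftPush x) ≫ CompHom.arg (x := x) (y := y) m)).1 =
      (CompHom.base (x := x) (y := y) m).1 ≫ leftEl y := by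
  rw [Poly.comp_fst, GFam.proj_inv, GFam.proj_push, prod_inv_fst]
  change inv (inv (leftEl x)) ≫ _ = _
  rw [IsIso.inv_inv]
  exact left_w m

theorem left_snd {Q : Poly J K} {x y : ((Poly.unit J).comp Q).Pm.Tot} (m : x ⟶ y)
    {f : opOf x.base.2 ⟶ opOf y.base.2}
    (h : ExtHom.base (w := x.base.2) (w' := y.base.2) (CompHom.base (x := x) (y := y) m).2 = f) :
    (Q.Pm.proj (inv (leftPush x) ≫ CompHom.arg (x := x) (y := y) m)).2 = f := by
  have := CompHom.arg_snd m h
  simp [this]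

theorem left_arg_comp {Q : Poly J K} {x y z : ((Poly.unit J).comp Q).Pm.Tot} (m : x ⟶ y)
    (n : y ⟶ z) : inv (leftPush x) ≫ CompHom.arg (x := x) (y := z) (m ≫ n) =
      leftMap m ≫ inv (leftPush y) ≫ CompHom.arg (x := y) (y := z) n := by
  have : CompHom.arg (x := x) (y := z) (m ≫ n) = CompHom.arg (x := x) (y := y) m ≫
    CompHom.arg (x := y) (y := z) n := rfl
  simp [leftMap, this]

noncomputable abbrev leftHomInvPm (Q : Poly J K) {i i' : J} {b b' : ((Poly.unit J).comp Q).Op.Tot}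
    (f : b ⟶ b') {y : ((Poly.unit J).comp Q).Pm.El (i, ((leftHom Q).comp (leftInv Q)).ob b)}
    {y' : ((Poly.unit J).comp Q).Pm.El (i', b')} (m : ((Poly.unit J).comp Q).Pm.Hom y y')
    (h : (((Poly.unit J).comp Q).Pm.proj m).2 = leftHomInvApp Q f) :
    ((Poly.unit J).comp Q).Pm.Hom (j := (i, b)) (j' := (i', b'))
      (((leftHom Q).comp (leftInv Q)).pm y) y' :=
  have h₁ := left_snd (x := ⟨_, y⟩) (y := ⟨_, y'⟩) m (congrArg ExtHom.base h)
  CompHom.mk (x := ⟨_, ((leftHom Q).comp (leftInv Q)).pm y⟩) (y := ⟨_, y'⟩)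
    ((CompHom.base (x := ⟨_, y⟩) (y := ⟨_, y'⟩) m).1, f)
    (inv (leftPush ⟨_, y⟩) ≫ CompHom.arg (x := ⟨_, y⟩) (y := ⟨_, y'⟩) m) h₁
    (Poly.unitHom (b := (i, ⟨i, _⟩)) (b' := (i', ⟨y'.idx, _⟩)) 
      ((CompHom.base (x := ⟨_, y⟩) (y := ⟨_, y'⟩) m).1, ExtHom.map (w := b) (w' := b') f _ h₁)
      (u := 𝟙 i) (v := leftEl ⟨_, y'⟩)
      ((Category.id_comp _).trans ((ExtHom.proj_map (w := b) (w' := b') f _ h₁).trans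
        (left_fst (x := ⟨_, y⟩) (y := ⟨_, y'⟩) m)))) rfl

noncomputable def leftHomInv (Q : Poly J K) :
    Cell ((leftHom Q).comp (leftInv Q)) (Lens.id _) where
  app f := leftHomInvApp Q f
  proj_app _ := rfl
  app_left f g := ExtHom.ext' rfl fun m _ _ => Poly.pointHom_ext
    ((congrArg (fun t => (Q.Pm.proj t).1) (push_comp_inv (m := m))).trans (Poly.comp_fst Q))
  app_right f g := ExtHom.ext' rfl fun m h _ => Poly.pointHom_ext
    ((congrArg (fun t => (Q.Pm.proj t).1) (push_comp_inv (m := m))).trans ((Poly.comp_fst Q).trans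
      (congrArg (CategoryStruct.comp _) (ExtHom.proj_map g _ (proj_push_inv_comp h)).symm)))
  pm f _ _ m h := leftHomInvPm Q f m h
  proj_pm _ _ _ _ _ := rfl
  pm_left {_ _ _ b b' b''} f g y y' y'' m n hm hn h :=
    have e₁ := congrArg (· ≫ (CompHom.base (x := ⟨_, y'⟩) (y := ⟨_, y''⟩) n).1)
      (leftMap_fst (x := ⟨_, y⟩) (y := ⟨_, y'⟩) m).symm
    have e₂ := left_arg_comp (x := ⟨_, y⟩) (y := ⟨_, y'⟩) (z := ⟨_, y''⟩) m n
    CompHom.ext (Prod.ext e₁ rfl) e₂ (SetHom.ext (Prod.ext e₁ (ExtHom.comp_map' f g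
      (left_snd (x := ⟨_, y⟩) (y := ⟨_, y''⟩) _ (congrArg ExtHom.base h)) _ _ e₂
      (leftMap_snd (x := ⟨_, y⟩) (y := ⟨_, y'⟩) m (congrArg ExtHom.base hm))
      (left_snd (x := ⟨_, y'⟩) (y := ⟨_, y''⟩) n (congrArg ExtHom.base hn)))))
  pm_right {_ _ _ b b' b''} f g y y' y'' m n hm hn h :=
    have h₁ := left_snd (x := ⟨_, y⟩) (y := ⟨_, y'⟩) m (congrArg ExtHom.base hm)
    CompHom.ext
      (Prod.ext rfl (congrArg (CategoryStruct.comp f) (show g = (CompHom.base n).2 from hn.symm)))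
      (Category.assoc _ _ _).symm
      (SetHom.ext (Prod.ext (congrArg (CategoryStruct.comp (CompHom.base (x := ⟨_, y⟩) (y := ⟨_, y'⟩) m).1)
        (CompHom.el_fst (x := ⟨_, y'⟩) (y := ⟨_, y''⟩) n).symm)
      ((ExtHom.comp_map' f g (left_snd (x := ⟨_, y⟩) (y := ⟨_, y''⟩) _ (congrArg ExtHom.base h)) _ _
        (Category.assoc _ _ _).symm h₁
        (CompHom.arg_snd (x := ⟨_, y'⟩) (y := ⟨_, y''⟩) n (congrArg ExtHom.base hn))).trans
        (congrArg (CategoryStruct.comp (ExtHom.map (w := b) (w' := b') f _ h₁))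
          (CompHom.el_snd (x := ⟨_, y'⟩) (y := ⟨_, y''⟩) n hn).symm))))

noncomputable def leftInvHom (Q : Poly J K) :
    Cell ((leftInv Q).comp (leftHom Q)) (Lens.id _) where
  app f := f
  proj_app _ := rfl
  app_left f g := rfl
  app_right f g := rfl
  pm {i _ b _} f y _ m h := inv (leftPush (Q := Q) ⟨(i, ⟨b.base, ⟨b.el, trivSec Q _⟩⟩), ⟨i, y, (𝟙 i : i ⟶ i)⟩⟩) ≫ m
  proj_pm {i _ b _} f y _ m h := by
    refine (Q.Pm.proj_comp _ _).trans ?_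
    rw [GFam.proj_inv, GFam.proj_push]
    refine Prod.ext ?_ ?_
    · rw [prod_comp_fst, prod_inv_fst]
      change inv (inv (𝟙 i)) ≫ (Q.Pm.proj m).1 = _
      simp
    · rw [prod_comp_snd, prod_inv_snd, h]
      change inv (𝟙 b) ≫ f = _
      simp
  pm_left f g _ _ _ m n hm hn h := by
    dsimp only [leftMap]
    simp
  pm_right f g _ _ _ m n hm hn h := (Category.assoc _ _ _).symm
end Lens
end Unit

section Unit

variable {I J K : Type u} [Groupoid.{u} I] [Groupoid.{u} J] [Groupoid.{u} K]

theorem CompHom.id_el {P : Poly I J} {Q : Poly J K} {x : (P.comp Q).Pm.Tot} :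
    CompHom.el (x := x) (y := x) (𝟙 x) = 𝟙 _ := rfl

namespace Lens

section
variable {P : Poly I J}

/-- The projection to `J` of a morphism of operations of a composite with the identity. -/
noncomputable abbrev rproj {w w' : (P.comp (Poly.unit J)).Op.Tot} (f : w ⟶ w') : w.base ⟶ w'.base :=
  (P.comp (Poly.unit J)).Op.proj f

/-- The value of a morphism of operations on a commutative square. -/
noncomputable abbrev rsq {w w' : (P.comp (Poly.unit J)).Op.Tot} (f : w ⟶ w') {i i' : J}
    (u : i ⟶ w.base) (v : i' ⟶ w'.base) (t : i ⟶ i') (h : u ≫ rproj f = t ≫ v) :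
    P.Op.Hom ((secOf w).obj (j := i) u) ((secOf w').obj (j := i') v) :=
  ExtHom.map (w := w) (w' := w') f
    (Poly.unitHom (b := (i, opOf w)) (b' := (i', opOf w')) (t, ExtHom.base (w := w) (w' := w') f) h) rfl

theorem rsq_comp {w w' w'' : (P.comp (Poly.unit J)).Op.Tot} (f : w ⟶ w') (g : w' ⟶ w'')
    {i i' i'' : J} (u : i ⟶ w.base) (v : i' ⟶ w'.base) (x : i'' ⟶ w''.base) (t : i ⟶ i')
    (t' : i' ⟶ i'') (t'' : i ⟶ i'') (ht : t'' = t ≫ t') (h : u ≫ rproj f = t ≫ v)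
    (h' : v ≫ rproj g = t' ≫ x) (h'' : u ≫ rproj (f ≫ g) = t'' ≫ x) :
    rsq (f ≫ g) u x t'' h'' = rsq f u v t h ≫ rsq g v x t' h' := by
  subst ht
  exact ExtHom.comp_map' f g _
    (Poly.unitHom (b := (i, opOf w)) (b' := (i', opOf w')) (t, ExtHom.base (w := w) (w' := w') f) h)
    (Poly.unitHom (b := (i', opOf w')) (b' := (i'', opOf w'')) (t', ExtHom.base (w := w') (w' := w'') g) h')
    rfl rfl rfl

theorem rmap_w {w w' : (P.comp (Poly.unit J)).Op.Tot} (f : w ⟶ w') {i i' : J}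
    {u : (Poly.unit J).Pm.El (i, opOf w)} {v : (Poly.unit J).Pm.El (i', opOf w')}
    (m : (Poly.unit J).Pm.Hom u v) (hm : ((Poly.unit J).Pm.proj m).2 = ExtHom.base (w := w) (w' := w') f) :
    (show i ⟶ w.base from u) ≫ rproj f = ((Poly.unit J).Pm.proj m).1 ≫ (show i' ⟶ w'.base from v) :=
  (congrArg (CategoryStruct.comp (show i ⟶ w.base from u)) (congrArg (Poly.unit J).Op.proj hm).symm).trans
    (Poly.unitHom_w (b := (i, opOf w)) (b' := (i', opOf w')) m)

theorem map_eq_rsq {w w' : (P.comp (Poly.unit J)).Op.Tot} (f : w ⟶ w') {i i' : J}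
    {u : (Poly.unit J).Pm.El (i, opOf w)} {v : (Poly.unit J).Pm.El (i', opOf w')}
    (m : (Poly.unit J).Pm.Hom u v) (hm : ((Poly.unit J).Pm.proj m).2 = ExtHom.base (w := w) (w' := w') f) :
    ExtHom.map (w := w) (w' := w') f m hm = rsq f u v ((Poly.unit J).Pm.proj m).1 (rmap_w f m hm) :=
  have e : m = Poly.unitHom (b := (i, opOf w)) (b' := (i', opOf w'))
      (((Poly.unit J).Pm.proj m).1, ExtHom.base (w := w) (w' := w') f) (rmap_w f m hm) :=
    SetHom.ext (Prod.ext rfl hm)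
  ExtHom.map_eq (w := w) (w' := w') f e hm rfl

/-- The value of a morphism of operations on the square between identities. -/
noncomputable abbrev rone {w w' : (P.comp (Poly.unit J)).Op.Tot} (f : w ⟶ w') :
    P.Op.Hom ((secOf w).obj (j := w.base) (𝟙 w.base)) ((secOf w').obj (j := w'.base) (𝟙 w'.base)) :=
  rsq f (𝟙 w.base) (𝟙 w'.base) (rproj f) ((Category.id_comp _).trans (Category.comp_id _).symm)

end

noncomputable abbrev rightHomPmMap (P : Poly I J) {i i' : I} {b b' : (P.comp (Poly.unit J)).Op.Tot}
    (f : b ⟶ b') {y : P.Pm.El (i, ⟨b.base, b.el.snd.obj (j := b.base) (𝟙 b.base)⟩)}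
    {y' : P.Pm.El (i', ⟨b'.base, b'.el.snd.obj (j := b'.base) (𝟙 b'.base)⟩)} (m : P.Pm.Hom y y')
    (h : (P.Pm.proj m).2 = rone f) :
    (P.comp (Poly.unit J)).Pm.Hom (j := (i, b)) (j' := (i', b'))
      ⟨b.base, 𝟙 b.base, y⟩ ⟨b'.base, 𝟙 b'.base, y'⟩ :=
  CompHom.mk (x := ⟨(i, b), ⟨b.base, 𝟙 b.base, y⟩⟩) (y := ⟨(i', b'), ⟨b'.base, 𝟙 b'.base, y'⟩⟩)
    ((P.Pm.proj m).1, f)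
    (Poly.unitHom (b := (b.base, opOf b)) (b' := (b'.base, opOf b'))
      (rproj f, ExtHom.base (w := b) (w' := b') f)
      ((Category.id_comp _).trans (Category.comp_id _).symm)) rfl m (Prod.ext rfl h)

noncomputable abbrev rightHom (P : Poly I J) : Lens (P.comp (Poly.unit J)) P where
  op {j} w := w.snd.obj (j := j) (𝟙 j)
  opMap f := rone f
  proj_opMap f := ExtHom.proj_map ..
  opMap_id w := w.el.snd.map_id _ _
  opMap_comp f g := rsq_comp f g _ _ _ _ _ _ rfl _ _ _
  pm {i b} y := ⟨b.base, 𝟙 b.base, y⟩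
  pmMap f _ _ m h := rightHomPmMap P f m h
  proj_pmMap f _ _ m h := rfl
  pmMap_id {i b} y h := CompHom.ext (Prod.ext (Poly.id_fst P) rfl) rfl rfl
  pmMap_comp f g _ _ _ m n hm hn h := CompHom.ext (Prod.ext (Poly.comp_fst P) rfl) rfl rfl

section
variable {P : Poly I J}

noncomputable abbrev rpush (b : P.Op.Tot) {i : J} (x : i ⟶ b.base) :
    P.Op.Hom b.el (P.Op.pushEl (inv x) b.el) :=
  P.Op.push (inv x) b.el

noncomputable abbrev rmap {b b' : P.Op.Tot} (f : b ⟶ b') {i i' : J} (x : i ⟶ b.base)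
    (x' : i' ⟶ b'.base) : P.Op.Hom (P.Op.pushEl (inv x) b.el) (P.Op.pushEl (inv x') b'.el) :=
  inv (rpush b x) ≫ f ≫ rpush b' x'

theorem proj_rmap {b b' : P.Op.Tot} (f : b ⟶ b') {i i' : J} (x : i ⟶ b.base)
    (x' : i' ⟶ b'.base) (m : (Poly.unit J).Pm.Hom (j := (i, ⟨b.base, PUnit.unit⟩)) (j' := (i', ⟨b'.base, PUnit.unit⟩)) x x')
    (h : ((Poly.unit J).Pm.proj m).2 = Poly.pointHom (P.Op.proj f)) :
    P.Op.proj (rmap f x x') = ((Poly.unit J).Pm.proj m).1 := by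
  have := Poly.unitHom_w m
  rw [h] at this
  change x ≫ P.Op.proj f = _ at this
  rw [rmap, GFam.proj_comp, GFam.proj_comp, GFam.proj_inv, GFam.proj_push, GFam.proj_push, IsIso.inv_inv, ← Category.assoc]
  exact (IsIso.comp_inv_eq _).2 this

theorem rmap_comp {b b' b'' : P.Op.Tot} (f : b ⟶ b') (g : b' ⟶ b'') {i i' i'' : J} (x : i ⟶ b.base)
    (x' : i' ⟶ b'.base) (x'' : i'' ⟶ b''.base) {k : b ⟶ b''} (h : k = f ≫ g) :
    rmap k x x'' = rmap f x x' ≫ rmap g x' x'' := by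
  subst h; simp [rmap]

theorem rmap_id (b : P.Op.Tot) {i : J} (x : i ⟶ b.base) : rmap (𝟙 b) x x = 𝟙 _ := by
  simp [rmap]

noncomputable abbrev rightSec (b : P.Op.Tot) : Sec (Poly.unit J) P.Op ⟨b.base, PUnit.unit⟩ where
  obj x := P.Op.pushEl (inv (show _ ⟶ b.base from x)) b.el
  map m h := rmap (𝟙 b) _ _
  proj_map m h := proj_rmap (𝟙 b) _ _ m (h.trans (Poly.pointHom_ext (P.Op.proj_id b).symm))
  map_id x h := rmap_id b _
  map_comp m n hm hn h := rmap_comp _ _ _ _ _ (Category.comp_id _).symm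

noncomputable abbrev rightInvOpMap {b b' : P.Op.Tot} (f : b ⟶ b') :
    (P.comp (Poly.unit J)).Op.Hom (j := b.base) (j' := b'.base) ⟨PUnit.unit, rightSec b⟩ ⟨PUnit.unit, rightSec b'⟩ :=
  ExtHom.mk (w := ⟨b.base, ⟨PUnit.unit, rightSec b⟩⟩) (w' := ⟨b'.base, ⟨PUnit.unit, rightSec b'⟩⟩)
    (Poly.pointHom (P.Op.proj f)) (fun m h => rmap f _ _) (fun m h => proj_rmap f _ _ m h)
    (fun _ _ _ _ _ => rmap_comp _ _ _ _ _ (Category.id_comp _).symm)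
    (fun _ _ _ _ _ => rmap_comp _ _ _ _ _ (Category.comp_id _).symm)

/-- The operation of `P` given by a parameter of the composite with the identity. -/
noncomputable abbrev rback {b : P.Op.Tot} {i : I} (y : (P.comp (Poly.unit J)).Pm.El (i, ⟨b.base, ⟨PUnit.unit, rightSec b⟩⟩)) :
    P.Pm.Hom (j := (i, ⟨y.idx, P.Op.pushEl (inv (show y.idx ⟶ b.base from y.arg)) b.el⟩)) (j' := (i, b)) y.el
      (P.Pm.pushEl (j := (i, ⟨y.idx, P.Op.pushEl (inv (show y.idx ⟶ b.base from y.arg)) b.el⟩))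
        (j' := (i, b)) (𝟙 i, inv (rpush b y.arg)) y.el) :=
  P.Pm.push _ _

theorem rback_inv_comp {b : P.Op.Tot} {i : I}
    (y : (P.comp (Poly.unit J)).Pm.El (i, ⟨b.base, ⟨PUnit.unit, rightSec b⟩⟩)) {z : P.Pm.Tot}
    (m : (⟨_, y.el⟩ : P.Pm.Tot) ⟶ z) : P.Pm.proj (inv (rback y) ≫ m) =
      ((P.Pm.proj m).1, rpush b y.arg ≫ (P.Pm.proj m).2) := by
  rw [GFam.proj_comp, GFam.proj_inv, GFam.proj_push]
  refine Prod.ext ?_ ?_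
  · rw [prod_comp_fst, prod_inv_fst]
    change inv (𝟙 i) ≫ _ = _
    simp
  · rw [prod_comp_snd, prod_inv_snd]
    change inv (inv (rpush b y.arg)) ≫ _ = _
    rw [IsIso.inv_inv]

noncomputable abbrev rightInvPmMap {b b' : P.Op.Tot} {i i' : I}
    {y : (P.comp (Poly.unit J)).Pm.El (i, ⟨b.base, ⟨PUnit.unit, rightSec b⟩⟩)}
    {y' : (P.comp (Poly.unit J)).Pm.El (i', ⟨b'.base, ⟨PUnit.unit, rightSec b'⟩⟩)}
    (m : (P.comp (Poly.unit J)).Pm.Hom y y') :=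
  inv (rback y) ≫ CompHom.el (x := ⟨_, y⟩) (y := ⟨_, y'⟩) m ≫ rback y'

theorem proj_rightInvPmMap {b b' : P.Op.Tot} (f : b ⟶ b') {i i' : I}
    {y : (P.comp (Poly.unit J)).Pm.El (i, ⟨b.base, ⟨PUnit.unit, rightSec b⟩⟩)}
    {y' : (P.comp (Poly.unit J)).Pm.El (i', ⟨b'.base, ⟨PUnit.unit, rightSec b'⟩⟩)}
    (m : (P.comp (Poly.unit J)).Pm.Hom y y')
    (h : ((P.comp (Poly.unit J)).Pm.proj m).2 = rightInvOpMap f) :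
    P.Pm.proj (rightInvPmMap m) = ((CompHom.base (x := ⟨_, y⟩) (y := ⟨_, y'⟩) m).1, f) := by
  have e : (P.Pm.proj (CompHom.el (x := ⟨_, y⟩) (y := ⟨_, y'⟩) m)).2 = rmap f y.arg y'.arg :=
    CompHom.el_snd (x := ⟨_, y⟩) (y := ⟨_, y'⟩) m h
  have e' := CompHom.el_fst (x := ⟨_, y⟩) (y := ⟨_, y'⟩) m
  rw [rback_inv_comp, P.Pm.proj_comp, GFam.proj_push]
  refine Prod.ext ?_ ?_
  · exact (Category.comp_id _).trans e'
  · change rpush b y.arg ≫ (P.Pm.proj (CompHom.el (x := ⟨_, y⟩) (y := ⟨_, y'⟩) m)).2 ≫ inv (rpush b' y'.arg) = f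
    rw [e]
    simp [rmap]

end

noncomputable abbrev rightInv (P : Poly I J) : Lens P (P.comp (Poly.unit J)) where
  op {j} b := ⟨PUnit.unit, rightSec ⟨j, b⟩⟩
  opMap f := rightInvOpMap f
  proj_opMap _ := rfl
  opMap_id b := ExtHom.ext' (Poly.pointHom_ext (P.Op.proj_id b)) fun _ _ _ => rfl
  opMap_comp f g := ExtHom.ext' (Poly.pointHom_ext (P.Op.proj_comp f g)) fun _ _ _ =>
    rmap_comp _ _ _ _ _ rfl
  pm {i b} y := P.Pm.pushEl (j := (i, ⟨y.idx, P.Op.pushEl (inv (show y.idx ⟶ b.base from y.arg)) b.el⟩))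
        (j' := (i, b)) (𝟙 i, inv (rpush b y.arg)) y.el
  pmMap f y y' m h := rightInvPmMap m
  proj_pmMap f y y' m h := proj_rightInvPmMap f m h
  pmMap_id {i b} y h := by
    have := CompHom.id_el (P := P) (Q := Poly.unit J) (x := ⟨_, y⟩)
    simp [rightInvPmMap, this]
  pmMap_comp {_ _ _ b b' b''} f g y y' y'' m n hm hn h := by
    have : CompHom.el (x := ⟨_, y⟩) (y := ⟨_, y''⟩) (m ≫ n) =
      CompHom.el (x := ⟨_, y⟩) (y := ⟨_, y'⟩) m ≫ CompHom.el (x := ⟨_, y'⟩) (y := ⟨_, y''⟩) n := rfl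
    simp [rightInvPmMap, this]

end Lens
end Unit

section Unit

variable {I J K : Type u} [Groupoid.{u} I] [Groupoid.{u} J] [Groupoid.{u} K]

namespace Lens

section
variable {P : Poly I J}

theorem rone_w {w w' : (P.comp (Poly.unit J)).Op.Tot} (f : w ⟶ w') {i' : J} (v : i' ⟶ w'.base) :
    𝟙 w.base ≫ rproj f = (rproj f ≫ inv v) ≫ v := by
  simp

/-- The value of a morphism of operations on the square from an identity. -/
noncomputable abbrev rfrom {w w' : (P.comp (Poly.unit J)).Op.Tot} (f : w ⟶ w') {i' : J}
    (v : i' ⟶ w'.base) :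
    P.Op.Hom ((secOf w).obj (j := w.base) (𝟙 w.base)) ((secOf w').obj (j := i') v) :=
  rsq f (𝟙 w.base) v (rproj f ≫ inv v) (rone_w f v)

theorem rfrom_one {w w' w'' : (P.comp (Poly.unit J)).Op.Tot} (f : w ⟶ w') (g : w' ⟶ w'') {i'' : J}
    (v : i'' ⟶ w''.base) : rfrom (f ≫ g) v = rone f ≫ rfrom g v :=
  rsq_comp f g _ _ _ _ _ _ ((congrArg (· ≫ inv v) ((P.comp (Poly.unit J)).Op.proj_comp f g)).trans
    (Category.assoc _ _ _)) _ _ _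

theorem rfrom_w {w w' w'' : (P.comp (Poly.unit J)).Op.Tot} (f : w ⟶ w') (g : w' ⟶ w'')
    {i' i'' : J} (x : i' ⟶ w'.base) (v : i'' ⟶ w''.base)
    (m : (Poly.unit J).Pm.Hom (j := (i', opOf w')) (j' := (i'', opOf w'')) x v)
    (hm : ((Poly.unit J).Pm.proj m).2 = ExtHom.base (w := w') (w' := w'') g) :
    rproj (f ≫ g) ≫ inv v = (rproj f ≫ inv x) ≫ ((Poly.unit J).Pm.proj m).1 := by
  have e : inv x ≫ ((Poly.unit J).Pm.proj m).1 = rproj g ≫ inv v := by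
    rw [IsIso.inv_comp_eq, ← Category.assoc]
    exact (IsIso.eq_comp_inv _).2 (rmap_w g m hm).symm
  rw [Category.assoc, e]
  exact ((congrArg (· ≫ inv v) ((P.comp (Poly.unit J)).Op.proj_comp f g)).trans
    (Category.assoc _ _ _))

theorem rfrom_comp {w w' w'' : (P.comp (Poly.unit J)).Op.Tot} (f : w ⟶ w') (g : w' ⟶ w'')
    {i' i'' : J} (x : i' ⟶ w'.base) (v : i'' ⟶ w''.base)
    (m : (Poly.unit J).Pm.Hom (j := (i', opOf w')) (j' := (i'', opOf w'')) x v)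
    (hm : ((Poly.unit J).Pm.proj m).2 = ExtHom.base (w := w') (w' := w'') g) :
    rfrom (f ≫ g) v = rfrom f x ≫ ExtHom.map (w := w') (w' := w'') g m hm :=
  (rsq_comp f g _ _ _ _ _ _ (rfrom_w f g x v m hm) _ _ _).trans
    (congrArg (CategoryStruct.comp (rfrom f x)) (map_eq_rsq g m hm).symm)

theorem rfrom_sec {w w' : (P.comp (Poly.unit J)).Op.Tot} (f : w ⟶ w')
    {i' i'' : J} (x : i' ⟶ w'.base) (v : i'' ⟶ w'.base)
    (m : (Poly.unit J).Pm.Hom (j := (i', opOf w')) (j' := (i'', opOf w')) x v)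
    (hm : ((Poly.unit J).Pm.proj m).2 = 𝟙 _) :
    rfrom f v = rfrom f x ≫ (secOf w').map m hm :=
  (congrArg (fun t => rfrom t v) (Category.comp_id f).symm).trans (rfrom_comp f (𝟙 w') x v m hm)

/-- The operation `a (𝟙)` underlying an operation `a` of the composite with the identity. -/
noncomputable abbrev rop (w : (P.comp (Poly.unit J)).Op.Tot) : P.Op.Tot :=
  ⟨w.base, (secOf w).obj (j := w.base) (𝟙 w.base)⟩

theorem proj_rfrom {w w' : (P.comp (Poly.unit J)).Op.Tot} (f : w ⟶ w') {i i' : J}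
    (x : i ⟶ w.base) (x' : i' ⟶ w'.base)
    (m : (Poly.unit J).Pm.Hom (j := (i, opOf w)) (j' := (i', opOf w')) x x')
    (hm : ((Poly.unit J).Pm.proj m).2 = ExtHom.base (w := w) (w' := w') f) :
    P.Op.proj (inv (rpush (rop w) x) ≫ rfrom f x') = ((Poly.unit J).Pm.proj m).1 := by
  have e : P.Op.proj (rfrom f x') = rproj f ≫ inv x' := ExtHom.proj_map ..
  rw [GFam.proj_comp, GFam.proj_inv, GFam.proj_push, e, IsIso.inv_inv, ← Category.assoc]
  exact (IsIso.comp_inv_eq _).2 (rmap_w f m hm)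

noncomputable abbrev rightHomInvApp {w w' : (P.comp (Poly.unit J)).Op.Tot} (f : w ⟶ w') :
    (⟨w.base, ⟨PUnit.unit, rightSec (rop w)⟩⟩ : (P.comp (Poly.unit J)).Op.Tot) ⟶ w' :=
  ExtHom.mk (w := ⟨w.base, ⟨PUnit.unit, rightSec (rop w)⟩⟩) (w' := w')
    (ExtHom.base (w := w) (w' := w') f)
    (fun {_ _ x x'} _ _ => inv (rpush (rop w) x) ≫ rfrom f x')
    (fun m h => proj_rfrom f _ _ m h)
    (fun {_ _ _ x x' x''} m n hm hn h => by
      change _ = rmap (𝟙 (rop w)) x x' ≫ inv (rpush (rop w) x') ≫ rfrom f x''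
      simp [rmap])
    (fun {_ _ _ x x' x''} m n hm hn h =>
      (congrArg (CategoryStruct.comp _) (rfrom_sec f x' x'' n hn)).trans (Category.assoc _ _ _).symm)

noncomputable abbrev rightHomInvPm {i i' : I} {b b' : (P.comp (Poly.unit J)).Op.Tot}
    (f : b ⟶ b') {y : (P.comp (Poly.unit J)).Pm.El (i, ((rightHom P).comp (rightInv P)).ob b)}
    {y' : (P.comp (Poly.unit J)).Pm.El (i', b')} (m : (P.comp (Poly.unit J)).Pm.Hom y y')
    (h : ((P.comp (Poly.unit J)).Pm.proj m).2 = rightHomInvApp f) :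
    (P.comp (Poly.unit J)).Pm.Hom (j := (i, b)) (j' := (i', b'))
      (((rightHom P).comp (rightInv P)).pm y) y' :=
  CompHom.mk (x := ⟨_, ((rightHom P).comp (rightInv P)).pm y⟩) (y := ⟨_, y'⟩)
    ((CompHom.base (x := ⟨_, y⟩) (y := ⟨_, y'⟩) m).1, f)
    (Poly.unitHom (b := (b.base, opOf b)) (b' := (y'.idx, opOf b'))
      (rproj f ≫ inv (show y'.idx ⟶ b'.base from y'.arg), ExtHom.base (w := b) (w' := b') f)
      (u := 𝟙 b.base) (v := y'.arg) (rone_w f y'.arg))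
    rfl
    (inv (rback (b := rop b) y) ≫ CompHom.el (x := ⟨_, y⟩) (y := ⟨_, y'⟩) m)
    (by
      have e : (P.Pm.proj (CompHom.el (x := ⟨_, y⟩) (y := ⟨_, y'⟩) m)).2 =
          inv (rpush (rop b) y.arg) ≫ rfrom f y'.arg :=
        CompHom.el_snd (x := ⟨_, y⟩) (y := ⟨_, y'⟩) m h
      have e' := CompHom.el_fst (x := ⟨_, y⟩) (y := ⟨_, y'⟩) m
      refine (rback_inv_comp (b := rop b) y _).trans (Prod.ext e' ?_)
      exact (IsIso.eq_inv_comp _).1 e)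

end

theorem rmap_cancel {P : Poly I J} {b b' : P.Op.Tot} (f : b ⟶ b') {i i' : J} (x : i ⟶ b.base)
    (x' : i' ⟶ b'.base) {z : P.Op.Tot} (k : b' ⟶ z) :
    inv (rpush b x) ≫ f ≫ k = rmap f x x' ≫ inv (rpush b' x') ≫ k := by
  simp [rmap]

theorem rightInvPmMap_cancel {P : Poly I J} {b b' : P.Op.Tot} {i i' : I}
    {y : (P.comp (Poly.unit J)).Pm.El (i, ⟨b.base, ⟨PUnit.unit, rightSec b⟩⟩)}
    {y' : (P.comp (Poly.unit J)).Pm.El (i', ⟨b'.base, ⟨PUnit.unit, rightSec b'⟩⟩)}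
    (m : (P.comp (Poly.unit J)).Pm.Hom y y') {z : P.Pm.Tot}
    (n : (⟨_, y'.el⟩ : P.Pm.Tot) ⟶ z) :
    inv (rback y) ≫ CompHom.el (x := ⟨_, y⟩) (y := ⟨_, y'⟩) m ≫ n =
      rightInvPmMap m ≫ inv (rback y') ≫ n := by
  simp [rightInvPmMap]

noncomputable def rightHomInv (P : Poly I J) :
    Cell ((rightHom P).comp (rightInv P)) (Lens.id _) where
  app f := rightHomInvApp f
  proj_app _ := rfl
  app_left {w w' w''} f g := ExtHom.ext' (Poly.pointHom_ext
      (((P.comp (Poly.unit J)).Op.proj_comp f g).trans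
        (congrArg (· ≫ rproj g) ((rightHom P).proj_opMap f).symm))) fun {_ _ x x'} m _ _ => by
    exact (congrArg (CategoryStruct.comp (inv (rpush (rop w) x))) (rfrom_one f g x')).trans
      (rmap_cancel (rone f) _ _ (rfrom g x'))
  app_right {w w' w''} f g := ExtHom.ext' rfl fun {_ _ x x'} m h _ =>
    (congrArg (CategoryStruct.comp (inv (rpush (rop w) x))) (rfrom_comp f g _ x' (inv (push _ x) ≫ m)
      (proj_push_inv_comp h))).trans (Category.assoc _ _ _).symm
  pm f _ _ m h := rightHomInvPm f m h
  proj_pm _ _ _ _ _ := rfl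
  pm_left f g y y' y'' m n hm hn h :=
    have e₁ : (CompHom.base (x := ⟨_, y⟩) (y := ⟨_, y'⟩) m).1 = (P.Pm.proj (rightInvPmMap (b := rop _) (b' := rop _) m)).1 :=
      (congrArg Prod.fst (proj_rightInvPmMap (b := rop _) (b' := rop _) (rone f) m hm)).symm
    CompHom.ext (Prod.ext (congrArg (· ≫ (CompHom.base (x := ⟨_, y'⟩) (y := ⟨_, y''⟩) n).1) e₁) rfl)
      (SetHom.ext (Prod.ext (Category.assoc _ _ _) rfl))
      (rightInvPmMap_cancel (b := rop _) (b' := rop _) m (CompHom.el (x := ⟨_, y'⟩) (y := ⟨_, y''⟩) n))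
  pm_right f g y y' y'' m n hm hn h :=
    have e₂ := CompHom.arg_snd (x := ⟨_, y'⟩) (y := ⟨_, y''⟩) n (congrArg ExtHom.base hn)
    CompHom.ext
      (Prod.ext rfl (congrArg (CategoryStruct.comp f) (show g = (CompHom.base n).2 from hn.symm)))
      (SetHom.ext (Prod.ext (rfrom_w f g y'.arg y''.arg (CompHom.arg (x := ⟨_, y'⟩) (y := ⟨_, y''⟩) n) e₂)
        (congrArg (CategoryStruct.comp _) e₂.symm))) (Category.assoc _ _ _).symm

noncomputable def rightInvHom (P : Poly I J) :
    Cell ((rightInv P).comp (rightHom P)) (Lens.id _) where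
  app {b _} f := inv (rpush b (𝟙 b.base)) ≫ f
  proj_app {b _} f := by
    rw [GFam.proj_comp, GFam.proj_inv, GFam.proj_push]
    simp
  app_left {b b' _} f g := by
    change inv (rpush b (𝟙 b.base)) ≫ f ≫ g = rmap f _ _ ≫ inv (rpush b' (𝟙 b'.base)) ≫ g
    simp [rmap]
  app_right f g := (Category.assoc _ _ _).symm
  pm {i _ b _} f y _ m h := inv (rback (b := b) ⟨b.base, 𝟙 b.base, y⟩) ≫ m
  proj_pm {i _ b _} f y _ m h := (rback_inv_comp (b := b) ⟨b.base, 𝟙 b.base, y⟩ m).trans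
    (Prod.ext rfl ((IsIso.eq_inv_comp _).1 h))
  pm_left f g _ _ _ m n hm hn h := by
    dsimp only [rightInvPmMap]
    simp
  pm_right f g _ _ _ m n hm hn h := (Category.assoc _ _ _).symm
end Lens
end Unit

namespace Lens

section
variable {I J : Type u} [Groupoid.{u} I] [Groupoid.{u} J] {P Q : Poly I J}

theorem congr_pmMap (φ : Lens P Q)
    (pmMap : ∀ {i i' : I} {b b' : P.Op.Tot} (f : b ⟶ b') {y : Q.Pm.El (i, φ.ob b)}
      {y' : Q.Pm.El (i', φ.ob b')} (m : Q.Pm.Hom y y'),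
      (Q.Pm.proj m).2 = φ.opMap f → P.Pm.Hom (φ.pm y) (φ.pm y')) (h₁ h₂ h₃)
    (h : ∀ {i i' : I} {b b' : P.Op.Tot} (f : b ⟶ b') {y : Q.Pm.El (i, φ.ob b)}
      {y' : Q.Pm.El (i', φ.ob b')} (m : Q.Pm.Hom y y') (h : (Q.Pm.proj m).2 = φ.opMap f),
      φ.pmMap f m h = pmMap f m h) :
    φ = Lens.mk φ.op φ.opMap φ.proj_opMap φ.opMap_id φ.opMap_comp φ.pm pmMap h₁ h₂ h₃ := by
  obtain ⟨op, opMap, a, b, c, pm, pmMap', d, e, g⟩ := φ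
  have : @pmMap' = @pmMap := by
    funext i i' b b' f y y' m hm
    exact h f m hm
  subst this
  rfl

end

section
variable {I J K L M : Type u} [Groupoid.{u} I] [Groupoid.{u} J] [Groupoid.{u} K]
  [Groupoid.{u} L] [Groupoid.{u} M]

theorem assoc_naturality_left {P P' : Poly I J} (φ : Lens P P') (Q : Poly J K) (R : Poly K L) :
    ((φ.whiskerRight Q).whiskerRight R).comp (assocHom P' Q R) =
      (assocHom P Q R).comp (φ.whiskerRight (Q.comp R)) := (rfl)

theorem assoc_naturality_mid (P : Poly I J) {Q Q' : Poly J K} (φ : Lens Q Q') (R : Poly K L) :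
    ((Lens.whiskerLeft P φ).whiskerRight R).comp (assocHom P Q' R) =
      (assocHom P Q R).comp (Lens.whiskerLeft P (φ.whiskerRight R)) := (rfl)

theorem assoc_naturality_right (P : Poly I J) (Q : Poly J K) {R R' : Poly K L} (φ : Lens R R') :
    (Lens.whiskerLeft (P.comp Q) φ).comp (assocHom P Q R') =
      (assocHom P Q R).comp (Lens.whiskerLeft P (Lens.whiskerLeft Q φ)) := (rfl)

theorem left_naturality {Q Q' : Poly J K} (φ : Lens Q Q') :
    (Lens.whiskerLeft (Poly.unit J) φ).comp (leftHom Q') = (leftHom Q).comp φ := by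
  refine congr_pmMap _ _ _ _ _ fun {_ _ b b'} f {_ _} m h => ?_
  have e := (φ.pmMap_fst (f := (leftHom Q).opMap f) (m := m) (h := h)).symm
  exact CompHom.ext (Prod.ext e rfl) rfl (SetHom.ext (Prod.ext e rfl))

theorem right_naturality {P P' : Poly I J} (φ : Lens P P') :
    (φ.whiskerRight (Poly.unit J)).comp (rightHom P') = (rightHom P).comp φ := by
  refine congr_pmMap _ _ _ _ _ fun {_ _ b b'} f {_ _} m h => ?_
  have e := (φ.pmMap_fst (f := (rightHom P).opMap f) (m := m) (h := h)).symm
  exact CompHom.ext (Prod.ext e rfl) rfl rfl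

end
end Lens

noncomputable section HomCategory

variable {I J K L M : Type u} [Groupoid.{u} I] [Groupoid.{u} J] [Groupoid.{u} K]
  [Groupoid.{u} L] [Groupoid.{u} M]

/-- Two morphisms of polynomials are identified when there is an identification between them. -/
instance Lens.setoid (P Q : Poly I J) : Setoid (Lens P Q) where
  r φ ψ := Nonempty (φ ⟶ ψ)
  iseqv :=
    { refl := fun φ => ⟨𝟙 φ⟩
      symm := fun ⟨T⟩ => ⟨inv T⟩
      trans := fun ⟨T⟩ ⟨U⟩ => ⟨T ≫ U⟩ }

/-- Morphisms of polynomials up to identification. -/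
def PolyHom (P Q : Poly I J) : Type u := Quotient (Lens.setoid P Q)

namespace PolyHom

def mk {P Q : Poly I J} (φ : Lens P Q) : PolyHom P Q := Quotient.mk _ φ

theorem ind {P Q : Poly I J} {p : PolyHom P Q → Prop} (h : ∀ φ, p (mk φ)) (f : PolyHom P Q) : p f :=
  Quotient.ind h f

theorem sound {P Q : Poly I J} {φ ψ : Lens P Q} (T : Cell φ ψ) : mk φ = mk ψ :=
  Quotient.sound ⟨T⟩

def id (P : Poly I J) : PolyHom P P := mk (Lens.id P)

def comp {P Q R : Poly I J} : PolyHom P Q → PolyHom Q R → PolyHom P R :=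
  Quotient.map₂ Lens.comp fun φ _ ⟨T⟩ _ ψ' ⟨U⟩ => ⟨(show φ.comp _ ⟶ φ.comp _ from Cell.precomp φ U) ≫ (Cell.postcomp T ψ' : _)⟩

theorem mk_comp {P Q R : Poly I J} (φ : Lens P Q) (ψ : Lens Q R) :
    comp (mk φ) (mk ψ) = mk (φ.comp ψ) := rfl

def whiskerLeft (P : Poly I J) {Q Q' : Poly J K} :
    PolyHom Q Q' → PolyHom (P.comp Q) (P.comp Q') :=
  Quotient.map (Lens.whiskerLeft P) fun _ _ ⟨T⟩ => ⟨Cell.whiskerLeft P T⟩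

def whiskerRight {P P' : Poly I J} (f : PolyHom P P') (Q : Poly J K) :
    PolyHom (P.comp Q) (P'.comp Q) :=
  Quotient.map (sa := Lens.setoid P P') (sb := Lens.setoid (P.comp Q) (P'.comp Q))
    (fun φ => Lens.whiskerRight φ Q) (fun _ _ h => h.elim fun T => ⟨Cell.whiskerRight T Q⟩) f

end PolyHom

/-- The category of polynomials from `I` to `J` and morphisms up to identification. Its
isomorphisms are the equivalences of polynomials, up to identification. -/
instance : Category (Poly I J) where
  Hom := PolyHom
  id := PolyHom.id
  comp := PolyHom.comp
  id_comp := PolyHom.ind fun _ => congrArg PolyHom.mk rfl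
  comp_id := PolyHom.ind fun _ => congrArg PolyHom.mk rfl
  assoc f g h := by
    revert f g h
    exact PolyHom.ind fun _ => PolyHom.ind fun _ => PolyHom.ind fun _ => congrArg PolyHom.mk rfl

namespace Poly

abbrev ofLens {P Q : Poly I J} (φ : Lens P Q) : P ⟶ Q := PolyHom.mk φ

theorem ofLens_comp {P Q R : Poly I J} (φ : Lens P Q) (ψ : Lens Q R) :
    ofLens φ ≫ ofLens ψ = ofLens (φ.comp ψ) := rfl

def assocIso (P : Poly I J) (Q : Poly J K) (R : Poly K L) :
    (P.comp Q).comp R ≅ P.comp (Q.comp R) where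
  hom := ofLens (Lens.assocHom P Q R)
  inv := ofLens (Lens.assocInv P Q R)
  hom_inv_id := PolyHom.sound (Lens.assocHomInv P Q R)
  inv_hom_id := PolyHom.sound (Lens.assocInvHom P Q R)

def leftIso (P : Poly I J) : (Poly.unit I).comp P ≅ P where
  hom := ofLens (Lens.leftHom P)
  inv := ofLens (Lens.leftInv P)
  hom_inv_id := PolyHom.sound (Lens.leftHomInv P)
  inv_hom_id := PolyHom.sound (Lens.leftInvHom P)

def rightIso (P : Poly I J) : P.comp (Poly.unit J) ≅ P where
  hom := ofLens (Lens.rightHom P)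
  inv := ofLens (Lens.rightInv P)
  hom_inv_id := PolyHom.sound (Lens.rightHomInv P)
  inv_hom_id := PolyHom.sound (Lens.rightInvHom P)
end Poly
end HomCategory

section Triangle

variable {I J K : Type u} [Groupoid.{u} I] [Groupoid.{u} J] [Groupoid.{u} K]

namespace Lens

theorem rsq_congr {P : Poly I J} {w w' : (P.comp (Poly.unit J)).Op.Tot} (f : w ⟶ w') {i i' : J}
    (u : i ⟶ w.base) (v : i' ⟶ w'.base) {t t' : i ⟶ i'} (e : t = t') (h : u ≫ rproj f = t ≫ v)
    (h' : u ≫ rproj f = t' ≫ v) : rsq f u v t h = rsq f u v t' h' := by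
  subst e; rfl

section
variable (P : Poly I J) (Q : Poly J K)

noncomputable abbrev triLeft : Lens ((P.comp (Poly.unit J)).comp Q) (P.comp Q) :=
  (assocHom P (Poly.unit J) Q).comp (Lens.whiskerLeft P (leftHom Q))

noncomputable abbrev triRight : Lens ((P.comp (Poly.unit J)).comp Q) (P.comp Q) :=
  (rightHom P).whiskerRight Q

theorem tri_map {w w' : ((P.comp (Poly.unit J)).comp Q).Op.Tot} (f : w ⟶ w') {j j' : J}
    {x : Q.Pm.El (j, opOf w)} {x' : Q.Pm.El (j', opOf w')} (m : Q.Pm.Hom x x')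
    (h : (Q.Pm.proj m).2 = ExtHom.base (w := w) (w' := w') f) :
    ExtHom.map (w := (triLeft P Q).ob w) (w' := (triLeft P Q).ob w') ((triLeft P Q).opMap f) m h =
      rone (ExtHom.map (w := w) (w' := w') f m h) :=
  rsq_congr (ExtHom.map (w := w) (w' := w') f m h) _ _ (ExtHom.proj_map (w := w) (w' := w') f m h).symm
    ((Category.id_comp _).trans ((ExtHom.proj_map (w := w) (w' := w') f m h).trans
      (Category.comp_id _).symm)) _

noncomputable abbrev triApp {w w' : ((P.comp (Poly.unit J)).comp Q).Op.Tot} (f : w ⟶ w') :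
    (triLeft P Q).ob w ⟶ (triRight P Q).ob w' :=
  ExtHom.mk (w := (triLeft P Q).ob w) (w' := (triRight P Q).ob w') (ExtHom.base (w := w) (w' := w') f)
    (fun m h => rone (ExtHom.map (w := w) (w' := w') f m h))
    (fun m h => ExtHom.proj_map (w := (triRight P Q).ob w) (w' := (triRight P Q).ob w')
      ((triRight P Q).opMap f) m h)
    (fun m n hm hn h => (ExtHom.map_left (w := (triRight P Q).ob w) (w' := (triRight P Q).ob w')
      ((triRight P Q).opMap f) m n hm hn h).trans (congrArg (· ≫ _) (tri_map P Q (𝟙 w) m hm).symm))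
    (fun m n hm hn h => ExtHom.map_right (w := (triRight P Q).ob w) (w' := (triRight P Q).ob w')
      ((triRight P Q).opMap f) m n hm hn h)

theorem tri_comp {w w' w'' : ((P.comp (Poly.unit J)).comp Q).Op.Tot} (f : w ⟶ w') (g : w' ⟶ w'')
    {j j' j'' : J} {x : Q.Pm.El (j, opOf w)} {x' : Q.Pm.El (j', opOf w')}
    {x'' : Q.Pm.El (j'', opOf w'')} {k : Q.Pm.Hom x x''} (m : Q.Pm.Hom x x') (n : Q.Pm.Hom x' x'')
    (hk : k = m ≫ n) (h : (Q.Pm.proj k).2 = ExtHom.base (w := w) (w' := w'') (f ≫ g))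
    (hm : (Q.Pm.proj m).2 = ExtHom.base (w := w) (w' := w') f)
    (hn : (Q.Pm.proj n).2 = ExtHom.base (w := w') (w' := w'') g) :
    rone (ExtHom.map (w := w) (w' := w'') (f ≫ g) k h) =
      rone (ExtHom.map (w := w) (w' := w') f m hm) ≫ rone (ExtHom.map (w := w') (w' := w'') g n hn) :=
  (congrArg (rightHom P).opMap (ExtHom.comp_map' f g h m n hk hm hn)).trans
    ((rightHom P).opMap_comp _ _)

theorem triApp_left {w w' w'' : ((P.comp (Poly.unit J)).comp Q).Op.Tot} (f : w ⟶ w') (g : w' ⟶ w'') :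
    triApp P Q (f ≫ g) = ExtHom.comp ((triLeft P Q).opMap f) (triApp P Q g) :=
  ExtHom.ext' rfl fun {_ _ x x'} m h h' =>
    (tri_comp P Q f g (push _ x) (inv (push _ x) ≫ m) push_comp_inv h proj_push_snd
      (proj_push_inv_comp h)).trans (congrArg (· ≫ _) (tri_map P Q f _ proj_push_snd).symm)

theorem triApp_right {w w' w'' : ((P.comp (Poly.unit J)).comp Q).Op.Tot} (f : w ⟶ w') (g : w' ⟶ w'') :
    triApp P Q (f ≫ g) = ExtHom.comp (triApp P Q f) ((triRight P Q).opMap g) :=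
  ExtHom.ext' rfl fun {_ _ x x'} m h h' =>
    tri_comp P Q f g (push _ x) (inv (push _ x) ≫ m) push_comp_inv h proj_push_snd
      (proj_push_inv_comp h)

noncomputable abbrev triPm {i i' : I} {b b' : ((P.comp (Poly.unit J)).comp Q).Op.Tot} (f : b ⟶ b')
    {y : (P.comp Q).Pm.El (i, (triLeft P Q).ob b)} {y' : (P.comp Q).Pm.El (i', (triRight P Q).ob b')}
    (m : (P.comp Q).Pm.Hom y y') (h : ((P.comp Q).Pm.proj m).2 = triApp P Q f) :
    ((P.comp (Poly.unit J)).comp Q).Pm.Hom (j := (i, b)) (j' := (i', b'))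
      ((triLeft P Q).pm y) ((triRight P Q).pm y') :=
  have h₁ : (Q.Pm.proj (CompHom.arg (x := ⟨_, y⟩) (y := ⟨_, y'⟩) m)).2 =
      ExtHom.base (w := b) (w' := b') f :=
    CompHom.arg_snd (x := ⟨_, y⟩) (y := ⟨_, y'⟩) m (congrArg ExtHom.base h)
  CompHom.mk (x := ⟨_, (triLeft P Q).pm y⟩) (y := ⟨_, (triRight P Q).pm y'⟩)
    ((CompHom.base (x := ⟨_, y⟩) (y := ⟨_, y'⟩) m).1, f)
    (CompHom.arg (x := ⟨_, y⟩) (y := ⟨_, y'⟩) m) h₁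
    (rightHomPmMap P (ExtHom.map (w := b) (w' := b') f _ h₁)
      (CompHom.el (x := ⟨_, y⟩) (y := ⟨_, y'⟩) m) (CompHom.el_snd (x := ⟨_, y⟩) (y := ⟨_, y'⟩) m h))
    (Prod.ext (CompHom.el_fst (x := ⟨_, y⟩) (y := ⟨_, y'⟩) m) rfl)

theorem tri_pmMap {i i' : I} {b b' : ((P.comp (Poly.unit J)).comp Q).Op.Tot} (f : b ⟶ b')
    {y : (P.comp Q).Pm.El (i, (triLeft P Q).ob b)} {y' : (P.comp Q).Pm.El (i', (triLeft P Q).ob b')}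
    (m : (P.comp Q).Pm.Hom y y') (h : ((P.comp Q).Pm.proj m).2 = (triLeft P Q).opMap f)
    (h₁ : (Q.Pm.proj (CompHom.arg (x := ⟨_, y⟩) (y := ⟨_, y'⟩) m)).2 =
      ExtHom.base (w := b) (w' := b') f)
    (h₂ : (P.Pm.proj (CompHom.el (x := ⟨_, y⟩) (y := ⟨_, y'⟩) m)).2 =
      rone (ExtHom.map (w := b) (w' := b') f _ h₁)) :
    CompHom.el (x := ⟨_, (triLeft P Q).pm y⟩) (y := ⟨_, (triLeft P Q).pm y'⟩)
        ((triLeft P Q).pmMap f m h) =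
      rightHomPmMap P (ExtHom.map (w := b) (w' := b') f _ h₁)
        (CompHom.el (x := ⟨_, y⟩) (y := ⟨_, y'⟩) m) h₂ :=
  CompHom.ext (Prod.ext (CompHom.el_fst (x := ⟨_, y⟩) (y := ⟨_, y'⟩) m).symm rfl)
    (SetHom.ext (Prod.ext (ExtHom.proj_map (w := b) (w' := b') f _ h₁).symm rfl)) rfl

noncomputable def triangle : Cell (triLeft P Q) (triRight P Q) where
  app f := triApp P Q f
  proj_app _ := rfl
  app_left f g := triApp_left P Q f g
  app_right f g := triApp_right P Q f g
  pm f _ _ m h := triPm P Q f m h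
  proj_pm _ _ _ _ _ := rfl
  pm_left {_ _ _ b b' b''} f g y y' y'' m n hm hn h :=
    have h₁ : (Q.Pm.proj (CompHom.arg (x := ⟨_, y⟩) (y := ⟨_, y'⟩) m)).2 =
        ExtHom.base (w := b) (w' := b') f :=
      CompHom.arg_snd (x := ⟨_, y⟩) (y := ⟨_, y'⟩) m (congrArg ExtHom.base hm)
    have h₁' : (Q.Pm.proj (CompHom.arg (x := ⟨_, y'⟩) (y := ⟨_, y''⟩) n)).2 =
        ExtHom.base (w := b') (w' := b'') g :=
      CompHom.arg_snd (x := ⟨_, y'⟩) (y := ⟨_, y''⟩) n (congrArg ExtHom.base hn)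
    have h₁'' : (Q.Pm.proj (CompHom.arg (x := ⟨_, y⟩) (y := ⟨_, y''⟩) (m ≫ n))).2 =
        ExtHom.base (w := b) (w' := b'') (f ≫ g) :=
      CompHom.arg_snd (x := ⟨_, y⟩) (y := ⟨_, y''⟩) _ (congrArg ExtHom.base h)
    have h₂ : (P.Pm.proj (CompHom.el (x := ⟨_, y⟩) (y := ⟨_, y'⟩) m)).2 =
        rone (ExtHom.map (w := b) (w' := b') f _ h₁) :=
      (CompHom.el_snd (x := ⟨_, y⟩) (y := ⟨_, y'⟩) m hm).trans (tri_map P Q f _ h₁)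
    CompHom.ext rfl rfl (((rightHom P).pmMap_comp' _ _ _ _ _
      (ExtHom.comp_map' f g h₁'' _ _ rfl h₁ h₁') rfl h₂
      (CompHom.el_snd (x := ⟨_, y'⟩) (y := ⟨_, y''⟩) n hn)).trans
        (congrArg (· ≫ CompHom.el (x := ⟨_, (triLeft P Q).pm y'⟩) (y := ⟨_, (triRight P Q).pm y''⟩)
          (triPm P Q g n hn)) (tri_pmMap P Q f m hm h₁ h₂).symm))
  pm_right {_ _ _ b b' b''} f g y y' y'' m n hm hn h :=
    have h₁ : (Q.Pm.proj (CompHom.arg (x := ⟨_, y⟩) (y := ⟨_, y'⟩) m)).2 =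
        ExtHom.base (w := b) (w' := b') f :=
      CompHom.arg_snd (x := ⟨_, y⟩) (y := ⟨_, y'⟩) m (congrArg ExtHom.base hm)
    have h₁' : (Q.Pm.proj (CompHom.arg (x := ⟨_, y'⟩) (y := ⟨_, y''⟩) n)).2 =
        ExtHom.base (w := b') (w' := b'') g :=
      CompHom.arg_snd (x := ⟨_, y'⟩) (y := ⟨_, y''⟩) n (congrArg ExtHom.base hn)
    have h₁'' : (Q.Pm.proj (CompHom.arg (x := ⟨_, y⟩) (y := ⟨_, y''⟩) (m ≫ n))).2 =
        ExtHom.base (w := b) (w' := b'') (f ≫ g) :=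
      CompHom.arg_snd (x := ⟨_, y⟩) (y := ⟨_, y''⟩) _ (congrArg ExtHom.base h)
    CompHom.ext rfl rfl ((rightHom P).pmMap_comp' _ _ _ _ _
      (ExtHom.comp_map' f g h₁'' _ _ rfl h₁ h₁') rfl
      (CompHom.el_snd (x := ⟨_, y⟩) (y := ⟨_, y'⟩) m hm)
      (CompHom.el_snd (x := ⟨_, y'⟩) (y := ⟨_, y''⟩) n hn))

end
end Lens
end Triangle

namespace Lens

theorem pentagon {I J K L M : Type u} [Groupoid.{u} I] [Groupoid.{u} J] [Groupoid.{u} K]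
    [Groupoid.{u} L] [Groupoid.{u} M] (P : Poly I J) (Q : Poly J K) (R : Poly K L)
    (S : Poly L M) :
    ((assocHom P Q R).whiskerRight S).comp
        ((assocHom P (Q.comp R) S).comp (Lens.whiskerLeft P (assocHom Q R S))) =
      (assocHom (P.comp Q) R S).comp (assocHom P Q (R.comp S)) := (rfl)

end Lens

noncomputable section BicategoryLaws

variable {I J K L M : Type u} [Groupoid.{u} I] [Groupoid.{u} J] [Groupoid.{u} K]
  [Groupoid.{u} L] [Groupoid.{u} M]

theorem eq_conj_of_comp_eq {C : Type*} [Category C] {a b c d : C} (α : a ≅ b) (β : c ≅ d)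
    {f : a ⟶ c} {g : b ⟶ d} (h : f ≫ β.hom = α.hom ≫ g) : f = α.hom ≫ g ≫ β.inv := by
  rw [← Category.assoc, ← h, Category.assoc, Iso.hom_inv_id, Category.comp_id]

theorem eq_conj_of_comp_eq' {C : Type*} [Category C] {a b c d : C} (α : a ≅ b) (β : c ≅ d)
    {f : a ⟶ c} {g : b ⟶ d} (h : f ≫ β.hom = α.hom ≫ g) : g = α.inv ≫ f ≫ β.hom := by
  rw [h, ← Category.assoc, Iso.inv_hom_id, Category.id_comp]

namespace PolyHom

theorem whiskerLeft_mk (P : Poly I J) {Q Q' : Poly J K} (φ : Lens Q Q') :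
    whiskerLeft P (mk φ) = mk (Lens.whiskerLeft P φ) := (rfl)

theorem whiskerRight_mk {P P' : Poly I J} (φ : Lens P P') (Q : Poly J K) :
    whiskerRight (mk φ) Q = mk (φ.whiskerRight Q) := (rfl)

theorem whiskerLeft_comp (P : Poly I J) {Q Q' Q'' : Poly J K} (η : PolyHom Q Q')
    (θ : PolyHom Q' Q'') : whiskerLeft P (comp η θ) = comp (whiskerLeft P η) (whiskerLeft P θ) := by
  revert η θ
  refine ind fun φ => ind fun ψ => ?_
  rw [whiskerLeft_mk, whiskerLeft_mk, mk_comp, mk_comp, whiskerLeft_mk]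
  exact sound (Cell.whiskerLeftComp P φ ψ)

theorem whiskerRight_comp {P P' P'' : Poly I J} (η : PolyHom P P') (θ : PolyHom P' P'')
    (Q : Poly J K) : whiskerRight (comp η θ) Q = comp (whiskerRight η Q) (whiskerRight θ Q) := by
  revert η θ
  refine ind fun φ => ind fun ψ => ?_
  rw [whiskerRight_mk, whiskerRight_mk, mk_comp, mk_comp, whiskerRight_mk, Lens.whiskerRight_comp]

theorem left_naturality {Q Q' : Poly J K} (η : PolyHom Q Q') :
    comp (whiskerLeft (Poly.unit J) η) (mk (Lens.leftHom Q')) = comp (mk (Lens.leftHom Q)) η := by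
  revert η
  refine ind fun φ => ?_
  rw [whiskerLeft_mk, mk_comp, mk_comp, Lens.left_naturality]

theorem right_naturality {P P' : Poly I J} (η : PolyHom P P') :
    comp (whiskerRight η (Poly.unit J)) (mk (Lens.rightHom P')) =
      comp (mk (Lens.rightHom P)) η := by
  revert η
  refine ind fun φ => ?_
  rw [whiskerRight_mk, mk_comp, mk_comp, Lens.right_naturality]

theorem assoc_naturality_left {P P' : Poly I J} (η : PolyHom P P') (Q : Poly J K) (R : Poly K L) :
    comp (whiskerRight (whiskerRight η Q) R) (mk (Lens.assocHom P' Q R)) =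
      comp (mk (Lens.assocHom P Q R)) (whiskerRight η (Q.comp R)) := by
  revert η
  refine ind fun φ => ?_
  rw [whiskerRight_mk, whiskerRight_mk, whiskerRight_mk, mk_comp, mk_comp,
    Lens.assoc_naturality_left]

theorem assoc_naturality_mid (P : Poly I J) {Q Q' : Poly J K} (η : PolyHom Q Q') (R : Poly K L) :
    comp (whiskerRight (whiskerLeft P η) R) (mk (Lens.assocHom P Q' R)) =
      comp (mk (Lens.assocHom P Q R)) (whiskerLeft P (whiskerRight η R)) := by
  revert η
  refine ind fun φ => ?_
  rw [whiskerLeft_mk, whiskerRight_mk, whiskerRight_mk, whiskerLeft_mk, mk_comp, mk_comp,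
    Lens.assoc_naturality_mid]

theorem assoc_naturality_right (P : Poly I J) (Q : Poly J K) {R R' : Poly K L}
    (η : PolyHom R R') :
    comp (whiskerLeft (P.comp Q) η) (mk (Lens.assocHom P Q R')) =
      comp (mk (Lens.assocHom P Q R)) (whiskerLeft P (whiskerLeft Q η)) := by
  revert η
  refine ind fun φ => ?_
  rw [whiskerLeft_mk, whiskerLeft_mk, whiskerLeft_mk, mk_comp, mk_comp,
    Lens.assoc_naturality_right]

theorem whisker_exchange {P P' : Poly I J} {Q Q' : Poly J K} (η : PolyHom P P')
    (θ : PolyHom Q Q') :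
    comp (whiskerLeft P θ) (whiskerRight η Q') = comp (whiskerRight η Q) (whiskerLeft P' θ) := by
  revert η θ
  refine ind fun φ => ind fun ψ => ?_
  rw [whiskerLeft_mk, whiskerRight_mk, whiskerRight_mk, whiskerLeft_mk, mk_comp, mk_comp,
    Lens.whisker_exchange]

theorem comp_mk₃ {P Q R S P' : Poly I J} {a : Lens P Q} {b : Lens Q R} {c : Lens R S}
    {d : Lens P P'} {e : Lens P' S} (h : a.comp (b.comp c) = d.comp e) {f : PolyHom P Q}
    {g : PolyHom R S} (hf : f = mk a) (hg : g = mk c) :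
    comp f (comp (mk b) g) = comp (mk d) (mk e) := by
  subst hf hg
  exact congrArg mk h

theorem comp_mk₂ {P Q R : Poly I J} {a : Lens P Q} {b : Lens Q R} {c : Lens P R}
    (T : Cell (a.comp b) c) {f : PolyHom Q R} {g : PolyHom P R} (hf : f = mk b) (hg : g = mk c) :
    comp (mk a) f = g := by
  subst hf hg
  exact sound T

theorem pentagon (P : Poly I J) (Q : Poly J K) (R : Poly K L) (S : Poly L M) :
    comp (whiskerRight (mk (Lens.assocHom P Q R)) S)
        (comp (mk (Lens.assocHom P (Q.comp R) S)) (whiskerLeft P (mk (Lens.assocHom Q R S)))) =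
      comp (mk (Lens.assocHom (P.comp Q) R S)) (mk (Lens.assocHom P Q (R.comp S))) :=
  comp_mk₃ (Lens.pentagon P Q R S) (whiskerRight_mk _ _) (whiskerLeft_mk _ _)

theorem triangle (P : Poly I J) (Q : Poly J K) :
    comp (mk (Lens.assocHom P (Poly.unit J) Q)) (whiskerLeft P (mk (Lens.leftHom Q))) =
      whiskerRight (mk (Lens.rightHom P)) Q :=
  comp_mk₂ (Lens.triangle P Q) (whiskerLeft_mk _ _) (whiskerRight_mk _ _)

end PolyHom

end BicategoryLaws

/-- The objects of the bicategory of polynomials: groupoids. -/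
structure PolyGrpd : Type (u + 1) where
  of ::
  carrier : Type u
  [str : Groupoid.{u} carrier]

attribute [instance] PolyGrpd.str

/-- The bicategory of groupoids, polynomials and morphisms of polynomials up to identification. -/
noncomputable instance : Bicategory.{u, u + 1} PolyGrpd.{u} where
  Hom X Y := Poly X.carrier Y.carrier
  id X := Poly.unit X.carrier
  comp P Q := Poly.comp P Q
  homCategory X Y := inferInstanceAs (Category (Poly X.carrier Y.carrier))
  whiskerLeft P _ _ η := PolyHom.whiskerLeft P η
  whiskerRight η Q := PolyHom.whiskerRight η Q
  associator P Q R := Poly.assocIso P Q R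
  leftUnitor P := Poly.leftIso P
  rightUnitor P := Poly.rightIso P
  whiskerLeft_id _ _ := congrArg PolyHom.mk Lens.whiskerLeft_id
  whiskerLeft_comp P _ _ _ η θ := PolyHom.whiskerLeft_comp P η θ
  id_whiskerLeft η := eq_conj_of_comp_eq (Poly.leftIso _) (Poly.leftIso _)
    (PolyHom.left_naturality η)
  comp_whiskerLeft P Q _ _ η := eq_conj_of_comp_eq (Poly.assocIso P Q _) (Poly.assocIso P Q _)
    (PolyHom.assoc_naturality_right P Q η)
  id_whiskerRight _ _ := congrArg PolyHom.mk Lens.whiskerRight_id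
  comp_whiskerRight η θ Q := PolyHom.whiskerRight_comp η θ Q
  whiskerRight_id η := eq_conj_of_comp_eq (Poly.rightIso _) (Poly.rightIso _)
    (PolyHom.right_naturality η)
  whiskerRight_comp η Q R := eq_conj_of_comp_eq' (Poly.assocIso _ Q R) (Poly.assocIso _ Q R)
    (PolyHom.assoc_naturality_left η Q R)
  whisker_assoc P _ _ η R := eq_conj_of_comp_eq (Poly.assocIso P _ R) (Poly.assocIso P _ R)
    (PolyHom.assoc_naturality_mid P η R)
  whisker_exchange η θ := PolyHom.whisker_exchange η θ
  pentagon P Q R S := PolyHom.pentagon P Q R S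
  triangle P Q := PolyHom.triangle P Q

noncomputable section Coproduct

variable {I J K : Type u} [Groupoid.{u} I] [Groupoid.{u} J] [Groupoid.{u} K]

/-- The coproduct of two groupoids. -/
instance sumGroupoid : Groupoid.{u} (J ⊕ K) :=
  { CategoryTheory.sum J K with
    inv := fun {X Y} f =>
      match X, Y, f with
      | .inl _, .inl _, f => ULift.up (inv f.down)
      | .inr _, .inr _, f => ULift.up (inv f.down)
    inv_comp := fun {X Y} f =>
      match X, Y, f with
      | .inl _, .inl _, f => congrArg ULift.up (IsIso.inv_hom_id f.down)
      | .inr _, .inr _, f => congrArg ULift.up (IsIso.inv_hom_id f.down)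
    comp_inv := fun {X Y} f =>
      match X, Y, f with
      | .inl _, .inl _, f => congrArg ULift.up (IsIso.hom_inv_id f.down)
      | .inr _, .inr _, f => congrArg ULift.up (IsIso.hom_inv_id f.down) }

/-- The sets of isomorphisms `inl j ≅ inl j'`, with no element over `inr k`. -/
def SetFam.pathInl (J K : Type u) [Groupoid.{u} J] [Groupoid.{u} K] :
    SetFam ((J ⊕ K) × (point J).toGFam.Tot) where
  El b :=
    match b.1 with
    | .inl j => j ⟶ b.2.base
    | .inr _ => PEmpty
  act {b b'} f u :=
    match b, b', f, u with
    | (.inl _, _), (.inl _, _), f, u => inv f.1.down ≫ u ≫ (point J).toGFam.proj f.2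
  act_id {b} u := by
    obtain ⟨j | k, b⟩ := b
    · change inv (𝟙 j) ≫ u ≫ (point J).toGFam.proj (𝟙 b) = u
      rw [GFam.proj_id]
      simp
    · exact u.elim
  act_comp {b b' b''} f g u := by
    obtain ⟨j | k, b⟩ := b
    · obtain ⟨j' | k', b'⟩ := b'
      · obtain ⟨j'' | k'', b''⟩ := b''
        · change inv (f.1.down ≫ g.1.down) ≫ u ≫ (point J).toGFam.proj (f.2 ≫ g.2) =
            inv g.1.down ≫ (inv f.1.down ≫ u ≫ _) ≫ _
          rw [GFam.proj_comp]
          simp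
        · exact g.1.elim
      · exact f.1.elim
    · exact u.elim

/-- The sets of isomorphisms `inr k ≅ inr k'`, with no element over `inl j`. -/
def SetFam.pathInr (J K : Type u) [Groupoid.{u} J] [Groupoid.{u} K] :
    SetFam ((J ⊕ K) × (point K).toGFam.Tot) where
  El b :=
    match b.1 with
    | .inl _ => PEmpty
    | .inr k => k ⟶ b.2.base
  act {b b'} f u :=
    match b, b', f, u with
    | (.inr _, _), (.inr _, _), f, u => inv f.1.down ≫ u ≫ (point K).toGFam.proj f.2
  act_id {b} u := by
    obtain ⟨j | k, b⟩ := b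
    · exact u.elim
    · change inv (𝟙 k) ≫ u ≫ (point K).toGFam.proj (𝟙 b) = u
      rw [GFam.proj_id]
      simp
  act_comp {b b' b''} f g u := by
    obtain ⟨j | k, b⟩ := b
    · exact u.elim
    · obtain ⟨j' | k', b'⟩ := b'
      · exact f.1.elim
      · obtain ⟨j'' | k'', b''⟩ := b''
        · exact g.1.elim
        · change inv (f.1.down ≫ g.1.down) ≫ u ≫ (point K).toGFam.proj (f.2 ≫ g.2) =
            inv g.1.down ≫ (inv f.1.down ≫ u ≫ _) ≫ _
          rw [GFam.proj_comp]
          simp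

/-- The first projection: one operation of each colour `j`, whose parameters of colour `inl j'`
are the identifications of `j'` with `j`, and which has no parameter of colour `inr k`. -/
def Poly.projl (J K : Type u) [Groupoid.{u} J] [Groupoid.{u} K] : Poly (J ⊕ K) J where
  Op := (SetFam.point J).toGFam
  Pm := (SetFam.pathInl J K).toGFam

/-- The second projection. -/
def Poly.projr (J K : Type u) [Groupoid.{u} J] [Groupoid.{u} K] : Poly (J ⊕ K) K where
  Op := (SetFam.point K).toGFam
  Pm := (SetFam.pathInr J K).toGFam

namespace GFam

/-- The elements of the copairing of two families. -/
def CopairEl (A : GFam J) (B : GFam K) : J ⊕ K → Type u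
  | .inl j => A.El j
  | .inr k => B.El k

/-- The morphisms between elements of the copairing of two families: those of `A`, and those
of `B`. -/
def CopairHom (A : GFam J) (B : GFam K) : Total (CopairEl A B) → Total (CopairEl A B) → Type u
  | ⟨.inl _, a⟩, ⟨.inl _, a'⟩ => A.Hom a a'
  | ⟨.inl _, _⟩, ⟨.inr _, _⟩ => PEmpty
  | ⟨.inr _, _⟩, ⟨.inl _, _⟩ => PEmpty
  | ⟨.inr _, b⟩, ⟨.inr _, b'⟩ => B.Hom b b'

instance (A : GFam J) (B : GFam K) : Groupoid.{u} (Total (CopairEl A B)) where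
  Hom := CopairHom A B
  id
    | ⟨.inl j, a⟩ => 𝟙 (⟨j, a⟩ : A.Tot)
    | ⟨.inr k, b⟩ => 𝟙 (⟨k, b⟩ : B.Tot)
  comp {x y z} f g :=
    match x, y, z, f, g with
    | ⟨.inl _, _⟩, ⟨.inl _, _⟩, ⟨.inl _, _⟩, f, g => CategoryStruct.comp (obj := A.Tot) f g
    | ⟨.inr _, _⟩, ⟨.inr _, _⟩, ⟨.inr _, _⟩, f, g => CategoryStruct.comp (obj := B.Tot) f g
  inv {x y} f :=
    match x, y, f with
    | ⟨.inl _, _⟩, ⟨.inl _, _⟩, f => Groupoid.inv (obj := A.Tot) f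
    | ⟨.inr _, _⟩, ⟨.inr _, _⟩, f => Groupoid.inv (obj := B.Tot) f
  id_comp {x y} f :=
    match x, y, f with
    | ⟨.inl _, _⟩, ⟨.inl _, _⟩, f => Category.id_comp (obj := A.Tot) f
    | ⟨.inr _, _⟩, ⟨.inr _, _⟩, f => Category.id_comp (obj := B.Tot) f
  comp_id {x y} f :=
    match x, y, f with
    | ⟨.inl _, _⟩, ⟨.inl _, _⟩, f => Category.comp_id (obj := A.Tot) f
    | ⟨.inr _, _⟩, ⟨.inr _, _⟩, f => Category.comp_id (obj := B.Tot) f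
  assoc {x y z t} f g h :=
    match x, y, z, t, f, g, h with
    | ⟨.inl _, _⟩, ⟨.inl _, _⟩, ⟨.inl _, _⟩, ⟨.inl _, _⟩, f, g, h =>
        Category.assoc (obj := A.Tot) f g h
    | ⟨.inr _, _⟩, ⟨.inr _, _⟩, ⟨.inr _, _⟩, ⟨.inr _, _⟩, f, g, h =>
        Category.assoc (obj := B.Tot) f g h
  inv_comp {x y} f :=
    match x, y, f with
    | ⟨.inl _, _⟩, ⟨.inl _, _⟩, f => Groupoid.inv_comp (obj := A.Tot) f
    | ⟨.inr _, _⟩, ⟨.inr _, _⟩, f => Groupoid.inv_comp (obj := B.Tot) f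
  comp_inv {x y} f :=
    match x, y, f with
    | ⟨.inl _, _⟩, ⟨.inl _, _⟩, f => Groupoid.comp_inv (obj := A.Tot) f
    | ⟨.inr _, _⟩, ⟨.inr _, _⟩, f => Groupoid.comp_inv (obj := B.Tot) f

/-- The family over `J ⊕ K` which is `A` over `J` and `B` over `K`. -/
def copair (A : GFam J) (B : GFam K) : GFam (J ⊕ K) where
  El := CopairEl A B
  proj {x y} f :=
    match x, y, f with
    | ⟨.inl _, _⟩, ⟨.inl _, _⟩, f => ULift.up (A.proj f)
    | ⟨.inr _, _⟩, ⟨.inr _, _⟩, f => ULift.up (B.proj f)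
  proj_id
    | ⟨.inl _, _⟩ => congrArg ULift.up (A.proj_id _)
    | ⟨.inr _, _⟩ => congrArg ULift.up (B.proj_id _)
  proj_comp {x y z} f g :=
    match x, y, z, f, g with
    | ⟨.inl _, _⟩, ⟨.inl _, _⟩, ⟨.inl _, _⟩, f, g => congrArg ULift.up (A.proj_comp f g)
    | ⟨.inr _, _⟩, ⟨.inr _, _⟩, ⟨.inr _, _⟩, f, g => congrArg ULift.up (B.proj_comp f g)
  exists_lift {j j'} f x :=
    match j, j', f, x with
    | .inl _, .inl _, f, x =>
        let ⟨y, m, h⟩ := A.exists_lift f.down x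
        ⟨y, m, congrArg ULift.up h⟩
    | .inr _, .inr _, f, x =>
        let ⟨y, m, h⟩ := B.exists_lift f.down x
        ⟨y, m, congrArg ULift.up h⟩

end GFam

namespace Poly

/-- The parameters of the pairing of two polynomials. -/
def PairEl (P : Poly I J) (Q : Poly I K) : I × (P.Op.copair Q.Op).Tot → Type u
  | (i, ⟨.inl j, c⟩) => P.Pm.El (i, ⟨j, c⟩)
  | (i, ⟨.inr k, c⟩) => Q.Pm.El (i, ⟨k, c⟩)

/-- The morphisms of parameters of the pairing of two polynomials: those of `P`, and those
of `Q`. -/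
def PairHom (P : Poly I J) (Q : Poly I K) : Total (PairEl P Q) → Total (PairEl P Q) → Type u
  | ⟨(_, ⟨.inl _, _⟩), p⟩, ⟨(_, ⟨.inl _, _⟩), p'⟩ => P.Pm.Hom p p'
  | ⟨(_, ⟨.inl _, _⟩), _⟩, ⟨(_, ⟨.inr _, _⟩), _⟩ => PEmpty
  | ⟨(_, ⟨.inr _, _⟩), _⟩, ⟨(_, ⟨.inl _, _⟩), _⟩ => PEmpty
  | ⟨(_, ⟨.inr _, _⟩), q⟩, ⟨(_, ⟨.inr _, _⟩), q'⟩ => Q.Pm.Hom q q'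

instance (P : Poly I J) (Q : Poly I K) : Groupoid.{u} (Total (PairEl P Q)) where
  Hom := PairHom P Q
  id
    | ⟨(i, ⟨.inl j, c⟩), p⟩ => 𝟙 (⟨(i, ⟨j, c⟩), p⟩ : P.Pm.Tot)
    | ⟨(i, ⟨.inr k, c⟩), q⟩ => 𝟙 (⟨(i, ⟨k, c⟩), q⟩ : Q.Pm.Tot)
  comp {x y z} f g :=
    match x, y, z, f, g with
    | ⟨(_, ⟨.inl _, _⟩), _⟩, ⟨(_, ⟨.inl _, _⟩), _⟩, ⟨(_, ⟨.inl _, _⟩), _⟩, f, g =>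
        CategoryStruct.comp (obj := P.Pm.Tot) f g
    | ⟨(_, ⟨.inr _, _⟩), _⟩, ⟨(_, ⟨.inr _, _⟩), _⟩, ⟨(_, ⟨.inr _, _⟩), _⟩, f, g =>
        CategoryStruct.comp (obj := Q.Pm.Tot) f g
  inv {x y} f :=
    match x, y, f with
    | ⟨(_, ⟨.inl _, _⟩), _⟩, ⟨(_, ⟨.inl _, _⟩), _⟩, f => Groupoid.inv (obj := P.Pm.Tot) f
    | ⟨(_, ⟨.inr _, _⟩), _⟩, ⟨(_, ⟨.inr _, _⟩), _⟩, f => Groupoid.inv (obj := Q.Pm.Tot) f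
  id_comp {x y} f :=
    match x, y, f with
    | ⟨(_, ⟨.inl _, _⟩), _⟩, ⟨(_, ⟨.inl _, _⟩), _⟩, f => Category.id_comp (obj := P.Pm.Tot) f
    | ⟨(_, ⟨.inr _, _⟩), _⟩, ⟨(_, ⟨.inr _, _⟩), _⟩, f => Category.id_comp (obj := Q.Pm.Tot) f
  comp_id {x y} f :=
    match x, y, f with
    | ⟨(_, ⟨.inl _, _⟩), _⟩, ⟨(_, ⟨.inl _, _⟩), _⟩, f => Category.comp_id (obj := P.Pm.Tot) f
    | ⟨(_, ⟨.inr _, _⟩), _⟩, ⟨(_, ⟨.inr _, _⟩), _⟩, f => Category.comp_id (obj := Q.Pm.Tot) f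
  assoc {x y z t} f g h :=
    match x, y, z, t, f, g, h with
    | ⟨(_, ⟨.inl _, _⟩), _⟩, ⟨(_, ⟨.inl _, _⟩), _⟩, ⟨(_, ⟨.inl _, _⟩), _⟩, ⟨(_, ⟨.inl _, _⟩), _⟩,
        f, g, h => Category.assoc (obj := P.Pm.Tot) f g h
    | ⟨(_, ⟨.inr _, _⟩), _⟩, ⟨(_, ⟨.inr _, _⟩), _⟩, ⟨(_, ⟨.inr _, _⟩), _⟩, ⟨(_, ⟨.inr _, _⟩), _⟩,
        f, g, h => Category.assoc (obj := Q.Pm.Tot) f g h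
  inv_comp {x y} f :=
    match x, y, f with
    | ⟨(_, ⟨.inl _, _⟩), _⟩, ⟨(_, ⟨.inl _, _⟩), _⟩, f => Groupoid.inv_comp (obj := P.Pm.Tot) f
    | ⟨(_, ⟨.inr _, _⟩), _⟩, ⟨(_, ⟨.inr _, _⟩), _⟩, f => Groupoid.inv_comp (obj := Q.Pm.Tot) f
  comp_inv {x y} f :=
    match x, y, f with
    | ⟨(_, ⟨.inl _, _⟩), _⟩, ⟨(_, ⟨.inl _, _⟩), _⟩, f => Groupoid.comp_inv (obj := P.Pm.Tot) f
    | ⟨(_, ⟨.inr _, _⟩), _⟩, ⟨(_, ⟨.inr _, _⟩), _⟩, f => Groupoid.comp_inv (obj := Q.Pm.Tot) f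

/-- The pairing of two polynomials. Its operations of colour `inl j` are those of `P` of colour
`j`, its operations of colour `inr k` are those of `Q` of colour `k`, and its parameters are those
of `P` and of `Q`. -/
def pair (P : Poly I J) (Q : Poly I K) : Poly I (J ⊕ K) where
  Op := P.Op.copair Q.Op
  Pm :=
    { El := PairEl P Q
      proj := fun {x y} f =>
        match x, y, f with
        | ⟨(_, ⟨.inl _, _⟩), _⟩, ⟨(_, ⟨.inl _, _⟩), _⟩, f => ((P.Pm.proj f).1, (P.Pm.proj f).2)
        | ⟨(_, ⟨.inr _, _⟩), _⟩, ⟨(_, ⟨.inr _, _⟩), _⟩, f => ((Q.Pm.proj f).1, (Q.Pm.proj f).2)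
      proj_id := fun x =>
        match x with
        | ⟨(i, ⟨.inl j, c⟩), p⟩ => P.Pm.proj_id ⟨(i, ⟨j, c⟩), p⟩
        | ⟨(i, ⟨.inr k, c⟩), q⟩ => Q.Pm.proj_id ⟨(i, ⟨k, c⟩), q⟩
      proj_comp := fun {x y z} f g =>
        match x, y, z, f, g with
        | ⟨(_, ⟨.inl _, _⟩), _⟩, ⟨(_, ⟨.inl _, _⟩), _⟩, ⟨(_, ⟨.inl _, _⟩), _⟩, f, g =>
            P.Pm.proj_comp f g
        | ⟨(_, ⟨.inr _, _⟩), _⟩, ⟨(_, ⟨.inr _, _⟩), _⟩, ⟨(_, ⟨.inr _, _⟩), _⟩, f, g =>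
            Q.Pm.proj_comp f g
      exists_lift := fun {j j'} f x =>
        match j, j', f, x with
        | (i, ⟨.inl j, c⟩), (i', ⟨.inl j', c'⟩), f, x =>
            P.Pm.exists_lift (j := (i, ⟨j, c⟩)) (j' := (i', ⟨j', c'⟩)) (f.1, f.2) x
        | (i, ⟨.inr k, c⟩), (i', ⟨.inr k', c'⟩), f, x =>
            Q.Pm.exists_lift (j := (i, ⟨k, c⟩)) (j' := (i', ⟨k', c'⟩)) (f.1, f.2) x }

end Poly

end Coproduct

namespace Cell

variable {I J K : Type u} [Groupoid.{u} I] [Groupoid.{u} J] [Groupoid.{u} K]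
  {P P' : Poly I J} {φ ψ χ : Lens P P'}

theorem whiskerRight_comp_app (T : Cell φ ψ) (U : Cell ψ χ) (Q : Poly J K)
    {w w' : (P.comp Q).Op.Tot} (f : w ⟶ w') :
    (whiskerRight (comp T U) Q).app f = (comp (whiskerRight T Q) (whiskerRight U Q)).app f :=
  ExtHom.ext' (Category.id_comp _).symm fun {_ _ x _} m h h' =>
    comp_app T U (ExtHom.map (w := w) (w' := w) (𝟙 w) (push (𝟙 (opOf w)) x) proj_push_snd)
      (ExtHom.map (w := w) (w' := w') f (inv (push (𝟙 (opOf w)) x) ≫ m) (proj_push_inv_comp h'))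
      (ExtHom.map_left' (w := w) (w' := w') f h _ _ push_comp_inv proj_push_snd
        (proj_push_inv_comp h'))

theorem whiskerRight_comp_pm (T : Cell φ ψ) (U : Cell ψ χ) (Q : Poly J K)
    {w w' : (P.comp Q).Op.Tot} (f : w ⟶ w') {i i₁ i' : I}
    {y : (P'.comp Q).Pm.El (i, (φ.whiskerRight Q).ob w)}
    {z : (P'.comp Q).Pm.El (i₁, (ψ.whiskerRight Q).ob w)}
    {y' : (P'.comp Q).Pm.El (i', (χ.whiskerRight Q).ob w')}
    (A : (P'.comp Q).Pm.Hom y z) (B : (P'.comp Q).Pm.Hom z y')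
    (h : ((P'.comp Q).Pm.proj (A ≫ B)).2 = (whiskerRight (comp T U) Q).app f)
    (hA : ((P'.comp Q).Pm.proj A).2 = (whiskerRight T Q).app (𝟙 w))
    (hB : ((P'.comp Q).Pm.proj B).2 = (whiskerRight U Q).app f) :
    (whiskerRight (comp T U) Q).pm f (A ≫ B) h =
      (whiskerRight T Q).pm (𝟙 w) A hA ≫ (whiskerRight U Q).pm f B hB :=
  have h₁ : (Q.Pm.proj (CompHom.arg (x := ⟨_, y⟩) (y := ⟨_, z⟩) A)).2 =
      ExtHom.base (w := w) (w' := w) (𝟙 w) :=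
    CompHom.arg_snd (x := ⟨_, y⟩) (y := ⟨_, z⟩) A (congrArg ExtHom.base hA)
  have h₂ : (Q.Pm.proj (CompHom.arg (x := ⟨_, z⟩) (y := ⟨_, y'⟩) B)).2 =
      ExtHom.base (w := w) (w' := w') f :=
    CompHom.arg_snd (x := ⟨_, z⟩) (y := ⟨_, y'⟩) B (congrArg ExtHom.base hB)
  have h₃ : (Q.Pm.proj (CompHom.arg (x := ⟨_, y⟩) (y := ⟨_, y'⟩) (A ≫ B))).2 =
      ExtHom.base (w := w) (w' := w') f :=
    CompHom.arg_snd (x := ⟨_, y⟩) (y := ⟨_, y'⟩) (A ≫ B) (congrArg ExtHom.base h)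
  CompHom.ext (Prod.ext rfl (Category.id_comp f).symm) rfl
    (comp_pm T U (CompHom.el_snd (x := ⟨_, y⟩) (y := ⟨_, y'⟩) (A ≫ B) h)
      (ExtHom.map (w := w) (w' := w) (𝟙 w) _ h₁)
      (ExtHom.map (w := w) (w' := w') f _ h₂)
      (CompHom.el (x := ⟨_, y⟩) (y := ⟨_, z⟩) A) (CompHom.el (x := ⟨_, z⟩) (y := ⟨_, y'⟩) B)
      (ExtHom.map_left' (w := w) (w' := w') f h₃ _ _ rfl h₁ h₂) rfl
      (CompHom.el_snd (x := ⟨_, y⟩) (y := ⟨_, z⟩) A hA)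
      (CompHom.el_snd (x := ⟨_, z⟩) (y := ⟨_, y'⟩) B hB))

theorem whiskerRight_comp (T : Cell φ ψ) (U : Cell ψ χ) (Q : Poly J K) :
    whiskerRight (comp T U) Q = comp (whiskerRight T Q) (whiskerRight U Q) := by
  refine ext' (fun f => whiskerRight_comp_app T U Q f) fun {i i' w w'} f {y y'} m h h' => ?_
  let A : (P'.comp Q).Pm.Hom (j := (i, (φ.whiskerRight Q).ob w)) y
      (pushEl ((whiskerRight T Q).app (𝟙 w)) y) := push ((whiskerRight T Q).app (𝟙 w)) y
  have hA : ((P'.comp Q).Pm.proj A).2 = (whiskerRight T Q).app (𝟙 w) := proj_push_snd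
  let B : (P'.comp Q).Pm.Hom (j := (i, (ψ.whiskerRight Q).ob w))
      (pushEl ((whiskerRight T Q).app (𝟙 w)) y) y' := inv A ≫ m
  have hB : ((P'.comp Q).Pm.proj B).2 = (whiskerRight U Q).app f := proj_push_inv_comp h'
  have hm : m = A ≫ B := push_comp_inv
  clear_value A B
  subst hm
  exact (whiskerRight_comp_pm T U Q f A B h hA hB).trans
    (comp_pm (whiskerRight T Q) (whiskerRight U Q) h' (𝟙 w) f A B (Category.id_comp f).symm rfl
      hA hB).symm

end Cell

noncomputable section Cartesian

open Bicategory

/-- The functor given by post-composition with two morphisms out of an object `X`. -/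
def postcompPair {B : Type*} [Bicategory B] {X J K : B} (p : X ⟶ J) (q : X ⟶ K) (I : B) :
    (I ⟶ X) ⥤ (I ⟶ J) × (I ⟶ K) :=
  (postcomp I p).prod' (postcomp I q)

/-- `T` is a terminal object: all categories of morphisms to `T` are equivalent to the point. -/
def IsTerminalObj {B : Type*} [Bicategory B] (T : B) : Prop :=
  ∀ I : B, (Functor.star.{0} (I ⟶ T)).IsEquivalence

/-- `X` is a product of `J` and `K`, with projections `p` and `q`. -/
def IsProductObj {B : Type*} [Bicategory B] {X J K : B} (p : X ⟶ J) (q : X ⟶ K) : Prop :=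
  ∀ I : B, (postcompPair p q I).IsEquivalence

/-- A bicategory is cartesian when it has a terminal object and binary products. -/
structure IsCartesianBicat (B : Type*) [Bicategory B] : Prop where
  exists_terminal : ∃ T : B, IsTerminalObj T
  exists_product : ∀ J K : B, ∃ (X : B) (p : X ⟶ J) (q : X ⟶ K), IsProductObj p q

/-- The bicategory of groupoids, polynomials in groupoids and equivalences of polynomials, up to
identification: only the invertible morphisms of polynomials are kept. All its categories of
morphisms are groupoids. -/
abbrev PolyBicat : Type (u + 1) := Pith PolyGrpd.{u}

/-- A groupoid, as an object of the bicategory of polynomials. -/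
abbrev PolyBicat.of (J : Type u) [Groupoid.{u} J] : PolyBicat.{u} := ⟨PolyGrpd.of J⟩

/-- A polynomial, as a morphism of the bicategory of polynomials. -/
abbrev PolyBicat.hom {I J : Type u} [Groupoid.{u} I] [Groupoid.{u} J] (P : Poly I J) :
    PolyBicat.of I ⟶ PolyBicat.of J := ⟨P⟩

/-- Post-composition by a polynomial `Q`, from the groupoid of morphisms `P ⟶ P'` and their
identifications to the groupoid of morphisms `P · Q ⟶ P' · Q` and their identifications. -/
def Lens.whiskerRightFunctor {I J K : Type u} [Groupoid.{u} I] [Groupoid.{u} J] [Groupoid.{u} K]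
    (P P' : Poly I J) (Q : Poly J K) : Lens P P' ⥤ Lens (P.comp Q) (P'.comp Q) where
  obj φ := φ.whiskerRight Q
  map T := Cell.whiskerRight T Q
  map_id φ := rfl
  map_comp T U := Cell.whiskerRight_comp T U Q

/-- The action on morphisms of polynomials, and on their identifications, of the post-composition
with the two projections. -/
def Lens.compProj {I J K : Type u} [Groupoid.{u} I] [Groupoid.{u} J] [Groupoid.{u} K]
    (R R' : Poly I (J ⊕ K)) :
    Lens R R' ⥤ Lens (R.comp (Poly.projl J K)) (R'.comp (Poly.projl J K)) ×
      Lens (R.comp (Poly.projr J K)) (R'.comp (Poly.projr J K)) :=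
  (Lens.whiskerRightFunctor R R' _).prod' (Lens.whiskerRightFunctor R R' _)

end Cartesian

end GrpdPoly

/-! No arrow of `J ⊕ K` joins the two summands. Hence a polynomial `R : I → J ⊕ K` amounts to its
restriction to `J` together with its restriction to `K`, with no condition linking them, and the
same holds for morphisms of polynomials and for identifications between these. Restriction leaves
the operations over a given colour and their parameters untouched, so the decomposition is strict:
`Lens.glue` and `Cell.glue` invert restriction on the nose, and `Lens.restrPair` is an equivalence
almost by definition.

The theorem is about composition with the projections, not about restriction, so the substance is a
comparison between the two. Let `F` be the inclusion of `J`. The parameters of colour `l` of the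
operation of `projl` over `j` are the arrows `l ⟶ F j`; in other words `projl` is the identity
polynomial of `J ⊕ K`, restricted along `F`. Composition commutes with restriction of output
colours, and the identity polynomial is a right unit, whence R · projl ≃ R · (unit restricted) ≃ (R
· unit) restricted ≃ R restricted. This is `Lens.restrComparison_isEquiv`, stated for any fully
faithful `F` and any family of sets that `F` represents, so that it serves both projections.

The claim made before identifying 2-cells needs this comparison to be natural in morphisms and in
their identifications. The first two equivalences are natural by definition; the last one is the
right unitor, treated in `Cell.rightHom_naturality`. Composing with an equivalence, on either side,
is an equivalence between groupoids of morphisms (`Lens.IsEquiv.post`, `Lens.IsEquiv.pre`). The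
resulting square `Lens.compProjIso` and cancellation of equivalences give
`Lens.compProj_isEquivalence`.

Passing to classes of morphisms shifts everything by one level: fullness of `Lens.compProj` makes
the functor between hom-categories faithful, and its essential surjectivity makes that functor full.
Since a fully faithful functor lifts isomorphisms, both properties survive when only the invertible
morphisms are kept. Essential surjectivity on polynomials comes from `Poly.pair`, whose restrictions
are the two given polynomials; this also shows that the inverse can be chosen with `Poly.pair` as
its value on objects.

The empty groupoid is terminal: a polynomial without output colours has no operations, so morphisms
and identifications exist and are unique for lack of anything to specify. -/

namespace GrpdPoly

/-! ### Restriction of polynomials along a fully faithful functor of output colours. -/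

section Restriction

variable {I J L : Type u} [Groupoid.{u} I] [Groupoid.{u} J] [Groupoid.{u} L]

/-- The elements of the restriction of a family along `F`. -/
abbrev GFam.RestrEl (F : J ⥤ L) (A : GFam L) (j : J) : Type u := A.El (F.obj j)

/-- An element of the restriction of a family, as an element of this family. -/
abbrev GFam.restrOb (F : J ⥤ L) (A : GFam L) (x : Total (A.RestrEl F)) : A.Tot :=
  ⟨F.obj x.base, x.el⟩

/-- This is the structure induced from `A.Tot`. In the pullback along a general functor an arrow
would be an arrow of `J` together with a lift of its image; when `F` is fully faithful the first
component is determined by the second, and dropping it keeps later equations definitional. -/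
instance GFam.restrGroupoid (F : J ⥤ L) (A : GFam L) : Groupoid.{u} (Total (A.RestrEl F)) where
  Hom x y := A.restrOb F x ⟶ A.restrOb F y
  id x := 𝟙 (A.restrOb F x)
  comp f g := CategoryStruct.comp (obj := A.Tot) f g
  id_comp f := Category.id_comp (obj := A.Tot) f
  comp_id f := Category.comp_id (obj := A.Tot) f
  assoc f g h := Category.assoc (obj := A.Tot) f g h
  inv f := Groupoid.inv (obj := A.Tot) f
  inv_comp f := Groupoid.inv_comp (obj := A.Tot) f
  comp_inv f := Groupoid.comp_inv (obj := A.Tot) f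

/-- The restriction of a family along a fully faithful functor. -/
abbrev GFam.restr {F : J ⥤ L} (hF : F.FullyFaithful) (A : GFam L) : GFam J where
  El := A.RestrEl F
  -- The only place where full faithfulness enters the data: `A.proj m` is an arrow between values
  -- of `F`.
  proj m := hF.preimage (A.proj m)
  proj_id x := (congrArg hF.preimage (A.proj_id _)).trans hF.preimage_id
  proj_comp f g := (congrArg hF.preimage (A.proj_comp f g)).trans (hF.preimage_comp _ _)
  exists_lift f x :=
    let ⟨y, m, h⟩ := A.exists_lift (F.map f) x
    ⟨y, m, (congrArg hF.preimage h).trans (hF.preimage_map f)⟩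

/-- The elements of the restriction of the parameters of a polynomial. -/
abbrev Poly.RestrPmEl {F : J ⥤ L} (hF : F.FullyFaithful) (R : Poly I L)
    (b : I × (R.Op.restr hF).Tot) : Type u :=
  R.Pm.El (b.1, R.Op.restrOb F b.2)

abbrev Poly.restrPmOb {F : J ⥤ L} (hF : F.FullyFaithful) (R : Poly I L)
    (x : Total (R.RestrPmEl hF)) : R.Pm.Tot :=
  ⟨(x.base.1, R.Op.restrOb F x.base.2), x.el⟩

/-- Parameters see the output colour only through their operation, so the same induced structure
serves, and the input colours in `I` are unaffected. -/
instance Poly.restrPmGroupoid {F : J ⥤ L} (hF : F.FullyFaithful) (R : Poly I L) :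
    Groupoid.{u} (Total (R.RestrPmEl hF)) where
  Hom x y := R.restrPmOb hF x ⟶ R.restrPmOb hF y
  id x := 𝟙 (R.restrPmOb hF x)
  comp f g := CategoryStruct.comp (obj := R.Pm.Tot) f g
  id_comp f := Category.id_comp (obj := R.Pm.Tot) f
  comp_id f := Category.comp_id (obj := R.Pm.Tot) f
  assoc f g h := Category.assoc (obj := R.Pm.Tot) f g h
  inv f := Groupoid.inv (obj := R.Pm.Tot) f
  inv_comp f := Groupoid.inv_comp (obj := R.Pm.Tot) f
  comp_inv f := Groupoid.comp_inv (obj := R.Pm.Tot) f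

/-- The restriction of a polynomial along a fully faithful functor to its groupoid of colours. -/
abbrev Poly.restr {F : J ⥤ L} (hF : F.FullyFaithful) (R : Poly I L) : Poly I J where
  Op := R.Op.restr hF
  Pm :=
    { El := R.RestrPmEl hF
      -- The pair is rebuilt so that its second component can be read as an arrow of the restricted
      -- operations, which it is by definition.
      proj := fun m => ((R.Pm.proj m).1, (R.Pm.proj m).2)
      proj_id := fun x => R.Pm.proj_id (R.restrPmOb hF x)
      proj_comp := fun f g => R.Pm.proj_comp f g
      exists_lift := fun {b b'} f x =>
        R.Pm.exists_lift (j := (b.1, R.Op.restrOb F b.2)) (j' := (b'.1, R.Op.restrOb F b'.2))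
          (f.1, f.2) x }

variable {F : J ⥤ L} (hF : F.FullyFaithful) {R R' R'' : Poly I L}

/-- The restriction of a morphism of polynomials. -/
abbrev Lens.restr (φ : Lens R R') : Lens (R.restr hF) (R'.restr hF) where
  op {j} x := φ.op (j := F.obj j) x
  opMap {b b'} f := φ.opMap (b := R.Op.restrOb F b) (b' := R.Op.restrOb F b') f
  proj_opMap {b b'} f :=
    congrArg hF.preimage (φ.proj_opMap (b := R.Op.restrOb F b) (b' := R.Op.restrOb F b') f)
  opMap_id b := φ.opMap_id (R.Op.restrOb F b)
  opMap_comp {b b' b''} f g := φ.opMap_comp (b := R.Op.restrOb F b) (b' := R.Op.restrOb F b')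
    (b'' := R.Op.restrOb F b'') f g
  pm {_ b} y := φ.pm (b := R.Op.restrOb F b) y
  pmMap {_ _ b b'} f _ _ m h :=
    φ.pmMap (b := R.Op.restrOb F b) (b' := R.Op.restrOb F b') f m h
  proj_pmMap {_ _ b b'} f _ _ m h :=
    φ.proj_pmMap (b := R.Op.restrOb F b) (b' := R.Op.restrOb F b') f m h
  pmMap_id {_ b} y h := φ.pmMap_id (b := R.Op.restrOb F b) y h
  pmMap_comp {_ _ _ b b' b''} f g _ _ _ m n hm hn h :=
    φ.pmMap_comp (b := R.Op.restrOb F b) (b' := R.Op.restrOb F b') (b'' := R.Op.restrOb F b'')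
      f g m n hm hn h

/-- The restriction of an identification between morphisms of polynomials. -/
abbrev Cell.restr {φ ψ : Lens R R'} (T : Cell φ ψ) : Cell (φ.restr hF) (ψ.restr hF) where
  app {b b'} f := T.app (b := R.Op.restrOb F b) (b' := R.Op.restrOb F b') f
  proj_app {b b'} f :=
    congrArg hF.preimage (T.proj_app (b := R.Op.restrOb F b) (b' := R.Op.restrOb F b') f)
  app_left {b b' b''} f g := T.app_left (b := R.Op.restrOb F b) (b' := R.Op.restrOb F b')
    (b'' := R.Op.restrOb F b'') f g
  app_right {b b' b''} f g := T.app_right (b := R.Op.restrOb F b) (b' := R.Op.restrOb F b')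
    (b'' := R.Op.restrOb F b'') f g
  pm {_ _ b b'} f _ _ m h := T.pm (b := R.Op.restrOb F b) (b' := R.Op.restrOb F b') f m h
  proj_pm {_ _ b b'} f _ _ m h :=
    T.proj_pm (b := R.Op.restrOb F b) (b' := R.Op.restrOb F b') f m h
  pm_left {_ _ _ b b' b''} f g _ _ _ m n hm hn h :=
    T.pm_left (b := R.Op.restrOb F b) (b' := R.Op.restrOb F b') (b'' := R.Op.restrOb F b'')
      f g m n hm hn h
  pm_right {_ _ _ b b' b''} f g _ _ _ m n hm hn h :=
    T.pm_right (b := R.Op.restrOb F b) (b' := R.Op.restrOb F b') (b'' := R.Op.restrOb F b'')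
      f g m n hm hn h

/-- Composites of cells involve chosen lifts `push`. The lifts for `R'` and for its restriction are
chosen from existence statements that agree by definition, so proof irrelevance makes the choices
coincide and no comparison is needed. -/
theorem Cell.restr_comp {φ ψ χ : Lens R R'} (T : Cell φ ψ) (U : Cell ψ χ) :
    (T.comp U).restr hF = (T.restr hF).comp (U.restr hF) := rfl

variable (R R') in
def Lens.restrFunctor : Lens R R' ⥤ Lens (R.restr hF) (R'.restr hF) where
  obj φ := φ.restr hF
  map T := Cell.restr hF T
  map_id _ := rfl
  map_comp T U := Cell.restr_comp hF T U

end Restriction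

/-! ### Functoriality of whiskering, and the interchange law for cells. -/

section Formal

variable {I J K : Type u} [Groupoid.{u} I] [Groupoid.{u} J] [Groupoid.{u} K]
  {P P' P'' P''' : Poly I J}

namespace Cell

/-- `ψ.pmMap` turns the factorization of `m` used by the composite on the right into a factorization
of `ψ.pmMap m`, and `comp_pm` allows the composite on the left to be computed from any
factorization. -/
theorem postcomp_comp {φ φ' φ'' : Lens P P'} (T : Cell φ φ') (U : Cell φ' φ'') (ψ : Lens P' P'') :
    (T.comp U).postcomp ψ = (T.postcomp ψ).comp (U.postcomp ψ) := by
  refine ext' (fun {b b'} f => ψ.opMap_comp _ _) fun {i i' b b'} f {y y'} m h h' => ?_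
  exact comp_pm T U ψ.pmMap_snd (𝟙 b) f _ _ (Category.id_comp f).symm
    (ψ.pmMap_comp' _ _ _ _ _ (comp_app T U (𝟙 b) f (Category.id_comp f).symm) push_comp_inv
      proj_push_snd (proj_push_inv_comp h')) _ _

/-- Independence of the factorization again, now applied to `φ.opMap f` written as `φ.opMap (𝟙 b) ≫
φ.opMap f`; `φ.pmMap_comp'` then splits the result. -/
theorem precomp_comp (φ : Lens P P') {ψ ψ' ψ'' : Lens P' P''} (T : Cell ψ ψ') (U : Cell ψ' ψ'') :
    (T.comp U).precomp φ = (T.precomp φ).comp (U.precomp φ) := by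
  refine ext' (fun {b b'} f => comp_app T U _ _ ?_) fun {i i' b b'} f {y y'} m h h' => ?_
  · exact (congrArg φ.opMap (Category.id_comp f).symm).trans (φ.opMap_comp _ _)
  · refine φ.pmMap_comp' _ _ _ _ _ (Category.id_comp f).symm
      (comp_pm T U _ (φ.opMap (𝟙 b)) (φ.opMap f) _ _
        ((congrArg φ.opMap (Category.id_comp f).symm).trans (φ.opMap_comp _ _)) push_comp_inv
        proj_push_snd (proj_push_inv_comp h')) ?_ ?_

/-- Both sides are the horizontal composite of `T` and `U`, whose value on operations is `U.app
(T.app f)`. Naturality of the two cells on the right of `T` gives one side, naturality on the left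
gives the other. -/
theorem exchange {φ φ' : Lens P P'} {ψ ψ' : Lens P' P''} (T : Cell φ φ') (U : Cell ψ ψ') :
    (T.postcomp ψ).comp (U.precomp φ') = (U.precomp φ).comp (T.postcomp ψ') := by
  refine ext' (fun {b b'} f => ?_) fun {i i' b b'} f {y y'} m h h' => ?_
  · exact (U.app_left' (k := T.app f) _ _ (T.app_right' _ _ (Category.id_comp f).symm)).symm.trans
      (U.app_right' _ _ (T.app_left' _ _ (Category.id_comp f).symm))
  · have e : (P''.Pm.proj m).2 = U.app (T.app f) :=
      h.trans (U.app_left' (k := T.app f) _ _ (T.app_right' _ _ (Category.id_comp f).symm)).symm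
    -- The intermediate value is the horizontal composite on parameters: `U` acts first, over `T.app
    -- f`, since parameters travel backwards.
    refine Eq.trans (b := T.pm f (U.pm (T.app f) m e) U.pm_snd) ?_ ?_
    · exact (T.pm_right' _ _ _ _ _ (Category.id_comp f).symm
        (U.pm_left' _ _ _ _ _ (T.app_right' _ _ (Category.id_comp f).symm) push_comp_inv
          proj_push_snd (proj_push_inv_comp h)) _ _).symm
    · exact (T.pm_left' _ _ _ _ _ (Category.id_comp f).symm
        (U.pm_right' _ _ _ _ _ (T.app_left' _ _ (Category.id_comp f).symm) push_comp_inv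
          proj_push_snd (proj_push_inv_comp h')) _ _)

end Cell
end Formal

/-! ### Equivalences of polynomials, and composition with them. -/

noncomputable section Formal

variable {I J K L : Type u} [Groupoid.{u} I] [Groupoid.{u} J] [Groupoid.{u} K] [Groupoid.{u} L]
  {P P' P'' : Poly I J}

namespace Lens

/-- Composition with a morphism of polynomials on the right. -/
def postFunctor (P : Poly I J) (ψ : Lens P' P'') : Lens P P' ⥤ Lens P P'' where
  obj φ := φ.comp ψ
  map T := Cell.postcomp T ψ
  map_id _ := rfl
  map_comp T U := Cell.postcomp_comp T U ψ

/-- Composition with a morphism of polynomials on the left. -/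
def preFunctor (φ : Lens P P') (P'' : Poly I J) : Lens P' P'' ⥤ Lens P P'' where
  obj ψ := φ.comp ψ
  map T := Cell.precomp φ T
  map_id _ := rfl
  map_comp T U := Cell.precomp_comp φ T U

/-- Whiskering gives the components, which are invertible because all cells are; `Cell.exchange` is
exactly their naturality. The companion `preFunctorIso` reads the same law in the other variable. -/
def postFunctorIso (P : Poly I J) {ψ ψ' : Lens P' P''} (U : Cell ψ ψ') :
    postFunctor P ψ ≅ postFunctor P ψ' :=
  NatIso.ofComponents (fun φ => Groupoid.isoEquivHom _ _ |>.symm (Cell.precomp φ U))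
    fun T => Cell.exchange T U

def preFunctorIso {φ φ' : Lens P P'} (T : Cell φ φ') (P'' : Poly I J) :
    preFunctor φ P'' ≅ preFunctor φ' P'' :=
  NatIso.ofComponents (fun ψ => Groupoid.isoEquivHom _ _ |>.symm (Cell.postcomp T ψ))
    fun U => (Cell.exchange T U).symm

/-- A morphism of polynomials is an equivalence when it is invertible up to identification. -/
def IsEquiv (φ : Lens P P') : Prop :=
  ∃ ψ : Lens P' P, Nonempty (Cell (φ.comp ψ) (Lens.id P)) ∧ Nonempty (Cell (ψ.comp φ) (Lens.id P'))

namespace IsEquiv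

theorem comp {φ : Lens P P'} {ψ : Lens P' P''} (hφ : φ.IsEquiv) (hψ : ψ.IsEquiv) :
    (φ.comp ψ).IsEquiv := by
  obtain ⟨φ', ⟨T⟩, ⟨T'⟩⟩ := hφ
  obtain ⟨ψ', ⟨U⟩, ⟨U'⟩⟩ := hψ
  -- The inner pair `ψ`, `ψ'` is contracted first, then the outer one. Composition of lenses is
  -- associative and unital by definition, so no coherence cells intervene.
  exact ⟨ψ'.comp φ', ⟨Cell.comp (Cell.precomp φ (Cell.postcomp U φ')) T⟩,
    ⟨Cell.comp (Cell.precomp ψ' (Cell.postcomp T' ψ)) U'⟩⟩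

/-- Restriction preserves identities and composites of lenses by definition, hence the restricted
cells already have the required ends. -/
theorem restr {F : J ⥤ L} (hF : F.FullyFaithful) {R R' : Poly I L} {φ : Lens R R'}
    (hφ : φ.IsEquiv) : (φ.restr hF).IsEquiv := by
  obtain ⟨φ', ⟨T⟩, ⟨T'⟩⟩ := hφ
  exact ⟨φ'.restr hF, ⟨Cell.restr hF T⟩, ⟨Cell.restr hF T'⟩⟩

/-- Left whiskering preserves composites only up to the cell `Cell.whiskerLeftComp`, and identities
up to an equation that is not definitional. The cell is inverted and composed with the whiskered
witness; the equation is used to rewrite the target. -/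
theorem whiskerLeft (P : Poly I J) {Q Q' : Poly J K} {φ : Lens Q Q'} (hφ : φ.IsEquiv) :
    (Lens.whiskerLeft P φ).IsEquiv := by
  obtain ⟨φ', ⟨T⟩, ⟨T'⟩⟩ := hφ
  have e := @Lens.whiskerLeft_id _ _ _ _ _ _ P Q
  have e' := @Lens.whiskerLeft_id _ _ _ _ _ _ P Q'
  exact ⟨Lens.whiskerLeft P φ',
    ⟨e ▸ (Cell.symm (Cell.whiskerLeftComp P φ φ')).comp (Cell.whiskerLeft P T)⟩,
    ⟨e' ▸ (Cell.symm (Cell.whiskerLeftComp P φ' φ)).comp (Cell.whiskerLeft P T')⟩⟩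

/-- The quasi-inverse is composition with a quasi-inverse of `ψ`. The cells that witness
invertibility supply unit and counit, because composing with `ψ.comp ψ'` is by definition composing
twice. -/
theorem post (P : Poly I J) {ψ : Lens P' P''} (hψ : ψ.IsEquiv) :
    (postFunctor P ψ).IsEquivalence := by
  obtain ⟨ψ', ⟨U⟩, ⟨U'⟩⟩ := hψ
  exact (CategoryTheory.Equivalence.mk (postFunctor P ψ) (postFunctor P ψ')
    (postFunctorIso P U).symm (postFunctorIso P U')).isEquivalence_functor

theorem pre {φ : Lens P P'} (hφ : φ.IsEquiv) (P'' : Poly I J) :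
    (preFunctor φ P'').IsEquivalence := by
  obtain ⟨φ', ⟨T⟩, ⟨T'⟩⟩ := hφ
  -- Pre-composition reverses the order of composition, so here the unit comes from `T'` and the
  -- counit from `T`.
  exact (CategoryTheory.Equivalence.mk (preFunctor φ P'') (preFunctor φ' P'')
    (preFunctorIso T' P'').symm (preFunctorIso T P'')).isEquivalence_functor

/-- The isomorphism of polynomials, up to identification, given by an equivalence. -/
theorem nonempty_iso {φ : Lens P P'} (hφ : φ.IsEquiv) : Nonempty (P ≅ P') := by
  obtain ⟨φ', ⟨T⟩, ⟨T'⟩⟩ := hφ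
  exact ⟨⟨Poly.ofLens φ, Poly.ofLens φ', PolyHom.sound T, PolyHom.sound T'⟩⟩

end IsEquiv

theorem rightHom_isEquiv (P : Poly I J) : (rightHom P).IsEquiv :=
  ⟨rightInv P, ⟨rightHomInv P⟩, ⟨rightInvHom P⟩⟩

end Lens

end Formal

/-! ### Composition commutes with restriction of the output colours. -/

noncomputable section CompRestr

variable {I J K L : Type u} [Groupoid.{u} I] [Groupoid.{u} J] [Groupoid.{u} K] [Groupoid.{u} L]
  {F : K ⥤ L} (hF : F.FullyFaithful)

namespace Lens

section
variable {Q : Poly J L} {X : GFam J}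

/-- An operation of the restricted polynomial has the same parameters as the operation of `Q` it
comes from, so sections over the two are the same data, repackaged. `extendSec` is the way back, and
`restrExtHom` and `extendExtHom` do the same for arrows. -/
abbrev restrSec {c : (Q.restr hF).Op.Tot} (a : Sec Q X (Q.Op.restrOb F c)) :
    Sec (Q.restr hF) X c where
  obj x := a.obj x
  map m h := a.map m h
  proj_map m h := a.proj_map m h
  map_id x h := a.map_id x h
  map_comp m n hm hn h := a.map_comp m n hm hn h

abbrev extendSec {c : (Q.restr hF).Op.Tot} (a : Sec (Q.restr hF) X c) :
    Sec Q X (Q.Op.restrOb F c) where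
  obj {j} x := a.obj (j := j) x
  map {j j' x x'} m h := a.map (j := j) (j' := j') (x := x) (x' := x') m h
  proj_map {j j' x x'} m h := a.proj_map (j := j) (j' := j') (x := x) (x' := x') m h
  map_id {j} x h := a.map_id (j := j) x h
  map_comp {j j' j'' x x' x''} m n hm hn h :=
    a.map_comp (j := j) (j' := j') (j'' := j'') (x := x) (x' := x') (x'' := x'') m n hm hn h

abbrev restrExtHom {w w' : Total (ExtEl (Q.restr hF) X)}
    (f : ExtHom (⟨F.obj w.base, ⟨w.el.fst, extendSec hF w.el.snd⟩⟩ : Total (ExtEl Q X))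
      ⟨F.obj w'.base, ⟨w'.el.fst, extendSec hF w'.el.snd⟩⟩) : ExtHom w w' where
  base := f.base
  map m h := f.map m h
  proj_map m h := f.proj_map m h
  map_left m n hm hn h := f.map_left m n hm hn h
  map_right m n hm hn h := f.map_right m n hm hn h

abbrev extendExtHom {w w' : Total (ExtEl (Q.restr hF) X)} (f : ExtHom w w') :
    ExtHom (⟨F.obj w.base, ⟨w.el.fst, extendSec hF w.el.snd⟩⟩ : Total (ExtEl Q X))
      ⟨F.obj w'.base, ⟨w'.el.fst, extendSec hF w'.el.snd⟩⟩ where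
  base := f.base
  map {j j' x x'} m h := f.map (j := j) (j' := j') (x := x) (x' := x') m h
  proj_map {j j' x x'} m h := f.proj_map (j := j) (j' := j') (x := x) (x' := x') m h
  map_left {j j' j'' x x' x''} m n hm hn h := f.map_left (j := j) (j' := j') (j'' := j'')
    (x := x) (x' := x') (x'' := x'') m n hm hn h
  map_right {j j' j'' x x' x''} m n hm hn h := f.map_right (j := j) (j' := j') (j'' := j'')
    (x := x) (x' := x') (x'' := x'') m n hm hn h

end

/-- Composition commutes with restriction. -/
abbrev compRestrHom (P : Poly I J) (Q : Poly J L) :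
    Lens (P.comp (Q.restr hF)) ((P.comp Q).restr hF) where
  op {k} c := ⟨c.fst, extendSec hF (c := ⟨k, c.fst⟩) c.snd⟩
  opMap {w w'} f := extendExtHom hF (w := w) (w' := w') f
  proj_opMap f := rfl
  opMap_id w := rfl
  opMap_comp f g := rfl
  pm y := ⟨y.idx, y.arg, y.el⟩
  pmMap {_ _ w w'} f x x' m h :=
    { base :=
        ((CompHom.base (x := ⟨(_, ⟨F.obj w.base, _⟩), x⟩)
          (y := ⟨(_, ⟨F.obj w'.base, _⟩), x'⟩) m).1, f)
      arg := CompHom.arg (x := ⟨(_, ⟨F.obj w.base, _⟩), x⟩) (y := ⟨(_, ⟨F.obj w'.base, _⟩), x'⟩) m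
      arg_proj := (CompHom.arg_proj (x := ⟨(_, ⟨F.obj w.base, _⟩), x⟩)
        (y := ⟨(_, ⟨F.obj w'.base, _⟩), x'⟩) m).trans (congrArg ExtHom.base h)
      el := CompHom.el (x := ⟨(_, ⟨F.obj w.base, _⟩), x⟩) (y := ⟨(_, ⟨F.obj w'.base, _⟩), x'⟩) m
      el_proj := (CompHom.el_proj (x := ⟨(_, ⟨F.obj w.base, _⟩), x⟩)
        (y := ⟨(_, ⟨F.obj w'.base, _⟩), x'⟩) m).trans
        (Prod.ext rfl (ExtHom.map_congr h rfl _ _)) }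
  proj_pmMap f _ _ m h := rfl
  pmMap_id y h := rfl
  pmMap_comp f g _ _ _ m n hm hn h := rfl

abbrev compRestrInv (P : Poly I J) (Q : Poly J L) :
    Lens ((P.comp Q).restr hF) (P.comp (Q.restr hF)) where
  op {k} c := ⟨c.fst, restrSec hF (c := ⟨k, c.fst⟩) c.snd⟩
  opMap {w w'} f := restrExtHom hF
    (w := ⟨w.base, ⟨w.el.fst, restrSec hF (c := ⟨w.base, w.el.fst⟩) w.el.snd⟩⟩)
    (w' := ⟨w'.base, ⟨w'.el.fst, restrSec hF (c := ⟨w'.base, w'.el.fst⟩) w'.el.snd⟩⟩) f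
  proj_opMap f := rfl
  opMap_id w := rfl
  opMap_comp f g := rfl
  pm y := ⟨y.idx, y.arg, y.el⟩
  pmMap {_ _ w w'} f x x' m h :=
    { base := ((CompHom.base (x := ⟨_, x⟩) (y := ⟨_, x'⟩) m).1, f)
      arg := CompHom.arg (x := ⟨_, x⟩) (y := ⟨_, x'⟩) m
      arg_proj := (CompHom.arg_proj (x := ⟨_, x⟩) (y := ⟨_, x'⟩) m).trans (congrArg ExtHom.base h)
      el := CompHom.el (x := ⟨_, x⟩) (y := ⟨_, x'⟩) m
      el_proj := (CompHom.el_proj (x := ⟨_, x⟩) (y := ⟨_, x'⟩) m).trans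
        (Prod.ext rfl (ExtHom.map_congr h rfl _ _)) }
  proj_pmMap f _ _ m h := rfl
  pmMap_id y h := rfl
  pmMap_comp f g _ _ _ m n hm hn h := rfl

/-- The two lenses are strictly inverse. On operations and on parameters the round trips are
identities by definition; on arrows of parameters they overwrite the underlying arrow of operations
by the given `f`, which the hypothesis `h` identifies with the original one. -/
theorem compRestrHom_isEquiv (P : Poly I J) (Q : Poly J L) : (compRestrHom hF P Q).IsEquiv := by
  have e : (compRestrHom hF P Q).comp (compRestrInv hF P Q) = Lens.id _ :=
    congr_pmMap _ _ _ _ _ fun f _ _ m h => CompHom.ext (Prod.ext rfl h.symm) rfl rfl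
  have e' : (compRestrInv hF P Q).comp (compRestrHom hF P Q) = Lens.id _ :=
    congr_pmMap _ _ _ _ _ fun f _ _ m h => CompHom.ext (Prod.ext rfl h.symm) rfl rfl
  exact ⟨compRestrInv hF P Q, ⟨e ▸ Cell.id _⟩, ⟨e' ▸ Cell.id _⟩⟩

end Lens

end CompRestr

/-! ### The two inclusions into a coproduct of groupoids. -/

noncomputable section Coproj

variable {I J K L : Type u} [Groupoid.{u} I] [Groupoid.{u} J] [Groupoid.{u} K] [Groupoid.{u} L]

/-- The inclusion of the first summand. -/
abbrev inlFunctor (J K : Type u) [Groupoid.{u} J] [Groupoid.{u} K] : J ⥤ J ⊕ K where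
  obj j := .inl j
  map f := ULift.up f
  map_id _ := rfl
  map_comp _ _ := rfl

abbrev inrFunctor (J K : Type u) [Groupoid.{u} J] [Groupoid.{u} K] : K ⥤ J ⊕ K where
  obj k := .inr k
  map f := ULift.up f
  map_id _ := rfl
  map_comp _ _ := rfl

/-- An arrow of `J ⊕ K` between two objects of the same summand is by definition a lifted arrow of
that summand. -/
abbrev inlFullyFaithful (J K : Type u) [Groupoid.{u} J] [Groupoid.{u} K] :
    (inlFunctor J K).FullyFaithful where
  preimage f := ULift.down f
  map_preimage _ := rfl
  preimage_map _ := rfl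

abbrev inrFullyFaithful (J K : Type u) [Groupoid.{u} J] [Groupoid.{u} K] :
    (inrFunctor J K).FullyFaithful where
  preimage f := ULift.down f
  map_preimage _ := rfl
  preimage_map _ := rfl

end Coproj

/-! ### Naturality of the right unitor in morphisms and in identifications. -/

noncomputable section RightUnit

variable {I J K L : Type u} [Groupoid.{u} I] [Groupoid.{u} J] [Groupoid.{u} K] [Groupoid.{u} L]
  {P P' : Poly I J}

/-- The two ways around the naturality square agree by definition except in the input colour
recorded by an arrow of parameters: one reads it after `φ`, the other before. `φ` preserves colours,
which is `pmMap_fst`. This defect is why `rightHomNat` below is not simply an identity cell. -/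
theorem Lens.rightHom_pmMap (φ : Lens P P') {i i' : I} {b b' : (P.comp (Poly.unit J)).Op.Tot}
    (f : b ⟶ b') {y : P'.Pm.El (i, ((rightHom P).comp φ).ob b)}
    {y' : P'.Pm.El (i', ((rightHom P).comp φ).ob b')} (m : P'.Pm.Hom y y')
    (h : (P'.Pm.proj m).2 = ((rightHom P).comp φ).opMap f) :
    ((rightHom P).comp φ).pmMap f m h =
      ((φ.whiskerRight (Poly.unit J)).comp (rightHom P')).pmMap f m h :=
  have e := φ.pmMap_fst (f := (rightHom P).opMap f) (m := m) (h := h)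
  CompHom.ext (Prod.ext e rfl) rfl rfl

/-- The naturality of the right unitor, as an identification. -/
def Cell.rightHomNat (φ : Lens P P') :
    Cell ((φ.whiskerRight (Poly.unit J)).comp (Lens.rightHom P')) ((Lens.rightHom P).comp φ) where
  app f := ((Lens.rightHom P).comp φ).opMap f
  proj_app f := ((Lens.rightHom P).comp φ).proj_opMap f
  app_left f g := ((Lens.rightHom P).comp φ).opMap_comp f g
  app_right f g := ((Lens.rightHom P).comp φ).opMap_comp f g
  pm f _ _ m h := ((Lens.rightHom P).comp φ).pmMap f m h
  proj_pm f _ _ m h := ((Lens.rightHom P).comp φ).proj_pmMap f m h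
  pm_left f g _ _ _ m n hm hn h := (((Lens.rightHom P).comp φ).pmMap_comp f g m n hm hn h).trans
    (congrArg (· ≫ ((Lens.rightHom P).comp φ).pmMap g n hn) (Lens.rightHom_pmMap φ f m hm))
  pm_right f g _ _ _ m n hm hn h := ((Lens.rightHom P).comp φ).pmMap_comp f g m n hm hn h

/-- Composites may be evaluated on any factorization. Factoring `f` as `f ≫ 𝟙` on the left and as `𝟙
≫ f` on the right makes `rightHomNat` act on an identity, where it disappears, and leaves `T` on
both sides. -/
theorem Cell.rightHom_naturality_app {φ ψ : Lens P P'} (T : Cell φ ψ)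
    {b b' : (P.comp (Poly.unit J)).Op.Tot} (f : b ⟶ b') :
    (Cell.comp (Cell.postcomp (Cell.whiskerRight T (Poly.unit J)) (Lens.rightHom P'))
      (Cell.rightHomNat ψ)).app f =
    (Cell.comp (Cell.rightHomNat φ) (Cell.precomp (Lens.rightHom P) T)).app f :=
  (comp_app _ _ f (𝟙 b') (Category.comp_id f).symm).trans
    (((congrArg (CategoryStruct.comp _) (((Lens.rightHom P).comp ψ).opMap_id b')).trans
      (Category.comp_id _)).trans
    (((comp_app (Cell.rightHomNat φ) (Cell.precomp (Lens.rightHom P) T) (𝟙 b) f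
      (Category.id_comp f).symm).trans
      ((congrArg (· ≫ _) (((Lens.rightHom P).comp φ).opMap_id b)).trans
      (Category.id_comp _))).symm))

/-- Needed because the product property is also claimed before 2-cells are identified: the right
unitor must be compatible with every `T`, not only with classes of morphisms. On parameters too,
factoring through an identity removes `rightHomNat`. -/
theorem Cell.rightHom_naturality {φ ψ : Lens P P'} (T : Cell φ ψ) :
    Cell.comp (Cell.postcomp (Cell.whiskerRight T (Poly.unit J)) (Lens.rightHom P'))
      (Cell.rightHomNat ψ) =
    Cell.comp (Cell.rightHomNat φ) (Cell.precomp (Lens.rightHom P) T) := by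
  refine ext' (fun f => rightHom_naturality_app T f) fun {i i' b b'} f {y y'} m h h' => ?_
  have e : (P'.Pm.proj m).2 = (Cell.precomp (Lens.rightHom P) T).app f :=
    h'.trans ((comp_app (Cell.rightHomNat φ) (Cell.precomp (Lens.rightHom P) T) (𝟙 b) f
      (Category.id_comp f).symm).trans
      ((congrArg (· ≫ _) (((Lens.rightHom P).comp φ).opMap_id b)).trans
      (Category.id_comp _)))
  -- Identity parameters lie over the identity component of `rightHomNat`, so they may serve as one
  -- factor in `comp_pm`.
  have hid : ∀ (χ : Lens P P') {i : I} {b : (P.comp (Poly.unit J)).Op.Tot}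
      (y : P'.Pm.El (i, ((Lens.rightHom P).comp χ).ob b)),
      (P'.Pm.proj (𝟙 (⟨_, y⟩ : P'.Pm.Tot))).2 = (Cell.rightHomNat χ).app (𝟙 b) := fun χ i b y =>
    (congrArg Prod.snd (P'.Pm.proj_id _)).trans (((Lens.rightHom P).comp χ).opMap_id b).symm
  -- Both composites are compared with the value of `T` whiskered by `rightHom P`.
  refine Eq.trans (b := (Cell.precomp (Lens.rightHom P) T).pm f m e) ?_ ?_
  · refine (comp_pm (Cell.postcomp (Cell.whiskerRight T (Poly.unit J)) (Lens.rightHom P'))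
      (Cell.rightHomNat ψ) h f (𝟙 b') m (𝟙 (⟨_, y'⟩ : P'.Pm.Tot)) (Category.comp_id f).symm
      (Category.comp_id m).symm e (hid ψ y')).trans ?_
    refine Eq.trans (congrArg (CategoryStruct.comp _)
      (((Lens.rightHom P).comp ψ).pmMap_id y' (hid ψ y'))) ((Category.comp_id _).trans ?_)
    -- The only discrepancy left is the recorded input colour, which `T` preserves.
    have e' := T.pm_fst (f := (Lens.rightHom P).opMap f) (m := m) (h := e)
    exact CompHom.ext (Prod.ext e'.symm rfl) rfl rfl
  · refine ((comp_pm (Cell.rightHomNat φ) (Cell.precomp (Lens.rightHom P) T) h' (𝟙 b) f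
      (𝟙 (⟨_, y⟩ : P'.Pm.Tot)) m (Category.id_comp f).symm
      (Category.id_comp m).symm (hid φ y) e).trans ?_).symm
    exact (congrArg (· ≫ _) (((Lens.rightHom P).comp φ).pmMap_id y (hid φ y))).trans
      (Category.id_comp _)

end RightUnit

/-! ### Families of sets represented by a functor, as restrictions of the identity polynomial. -/

noncomputable section Represented

variable {J L : Type u} [Groupoid.{u} J] [Groupoid.{u} L]

/-- The polynomial with one operation of each colour, whose parameters form a family of sets. -/
abbrev Poly.ofSets (A : SetFam (L × (SetFam.point J).toGFam.Tot)) : Poly L J where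
  Op := (SetFam.point J).toGFam
  Pm := A.toGFam

/-- A family of sets represented by a functor `F`: it is identified with the family of the arrows
`l ⟶ F j`. -/
structure SetFam.Represented (A : SetFam (L × (SetFam.point J).toGFam.Tot)) (F : J ⥤ L) where
  arrow : ∀ {b : L × (SetFam.point J).toGFam.Tot}, A.El b → (b.1 ⟶ F.obj b.2.base)
  el : ∀ {b : L × (SetFam.point J).toGFam.Tot}, (b.1 ⟶ F.obj b.2.base) → A.El b
  arrow_el : ∀ {b : L × (SetFam.point J).toGFam.Tot} (u : b.1 ⟶ F.obj b.2.base), arrow (el u) = u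
  el_arrow : ∀ {b : L × (SetFam.point J).toGFam.Tot} (u : A.El b), el (arrow u) = u
  arrow_act : ∀ {b b' : L × (SetFam.point J).toGFam.Tot} (f : b ⟶ b') (u : A.El b),
    f.1 ≫ arrow (A.act f u) = arrow u ≫ F.map ((SetFam.point J).toGFam.proj f.2)

namespace SetFam.Represented

variable {A : SetFam (L × (SetFam.point J).toGFam.Tot)} {F : J ⥤ L} (r : A.Represented F)
  (hF : F.FullyFaithful)

/-- `arrow` is injective and `f.1` is invertible, so a commutative square between the representing
arrows determines the action. With the converse `arrow_w`, arrows between parameters are exactly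
commutative squares; `homOf` builds them that way. -/
theorem act_eq {b b' : L × (SetFam.point J).toGFam.Tot} (f : b ⟶ b') {u : A.El b} {u' : A.El b'}
    (h : r.arrow u ≫ F.map ((SetFam.point J).toGFam.proj f.2) = f.1 ≫ r.arrow u') :
    A.act f u = u' := by
  have e : r.arrow (A.act f u) = r.arrow u' := by
    rw [← cancel_epi f.1, r.arrow_act, h]
  rw [← r.el_arrow (A.act f u), e, r.el_arrow]

theorem arrow_w {x y : A.toGFam.Tot} (m : x ⟶ y) :
    r.arrow x.el ≫ F.map ((SetFam.point J).toGFam.proj (A.toGFam.proj m).2) =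
      (A.toGFam.proj m).1 ≫ r.arrow y.el := by
  rw [← r.arrow_act]
  exact congrArg (fun t => (A.toGFam.proj m).1 ≫ r.arrow t) (SetHom.act_eq m)

abbrev homOf {x y : A.toGFam.Tot} (f : x.base ⟶ y.base)
    (h : r.arrow x.el ≫ F.map ((SetFam.point J).toGFam.proj f.2) = f.1 ≫ r.arrow y.el) : x ⟶ y :=
  SetHom.mk f (r.act_eq f h)

end SetFam.Represented

namespace Lens

variable {A : SetFam (L × (SetFam.point J).toGFam.Tot)} {F : J ⥤ L} (r : A.Represented F)
  (hF : F.FullyFaithful)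

/-- The restricted identity polynomial has one operation over `j`, whose parameters of colour `l`
are the arrows `l ⟶ F j`: this is what representability of `A` provides. Parameters are mapped
backwards, hence `el` here and `arrow` in `ofRestrUnit`. -/
abbrev toRestrUnit : Lens (Poly.ofSets A) ((Poly.unit L).restr hF) where
  op _ := PUnit.unit
  opMap {b b'} f := Poly.pointHom (J := L) (x := ⟨F.obj b.base, PUnit.unit⟩)
    (y := ⟨F.obj b'.base, PUnit.unit⟩) (F.map (SetHom.base f))
  proj_opMap f := hF.preimage_map _
  opMap_id b := Poly.pointHom_ext (F.map_id _)
  opMap_comp f g := Poly.pointHom_ext (F.map_comp _ _)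
  pm {i b} y := r.el (b := (i, b)) y
  pmMap {i i' b b'} f y y' m h := r.homOf (x := ⟨(i, b), r.el (b := (i, b)) y⟩)
    (y := ⟨(i', b'), r.el (b := (i', b')) y'⟩) (((Poly.unit L).Pm.proj m).1, f) (by
      -- An arrow between parameters of the identity polynomial is a commutative square in `L`; by
      -- `h` its side on the output colours is `F.map` of the arrow below `f`.
      have e := Poly.unitHom_w (b := (i, ⟨F.obj b.base, PUnit.unit⟩))
        (b' := (i', ⟨F.obj b'.base, PUnit.unit⟩)) m
      have e' : ((Poly.unit L).Pm.proj m).2 = _ := h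
      rw [e'] at e
      exact (congrArg (· ≫ _) (r.arrow_el (b := (i, b)) y)).trans
        (e.trans (congrArg (CategoryStruct.comp _) (r.arrow_el (b := (i', b')) y').symm)))
  proj_pmMap f y y' m h := rfl
  pmMap_id {i b} y h := SetHom.ext rfl
  pmMap_comp f g _ _ _ m n hm hn h := SetHom.ext rfl

abbrev ofRestrUnit : Lens ((Poly.unit L).restr hF) (Poly.ofSets A) where
  op _ := PUnit.unit
  opMap {b b'} f := SetHom.mk (A := SetFam.point J) (x := ⟨b.base, PUnit.unit⟩)
    (y := ⟨b'.base, PUnit.unit⟩) (((Poly.unit L).restr hF).Op.proj f) rfl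
  proj_opMap f := rfl
  opMap_id b := SetHom.ext (((Poly.unit L).restr hF).Op.proj_id b)
  opMap_comp f g := SetHom.ext (((Poly.unit L).restr hF).Op.proj_comp f g)
  pm {i b} y := r.arrow (b := (i, ⟨b.base, PUnit.unit⟩)) y
  pmMap {i i' b b'} f y y' m h := Poly.unitHom (b := (i, ⟨F.obj b.base, b.el⟩))
    (b' := (i', ⟨F.obj b'.base, b'.el⟩)) (((Poly.ofSets A).Pm.proj m).1, f)
    (u := r.arrow (b := (i, ⟨b.base, PUnit.unit⟩)) y)
    (v := r.arrow (b := (i', ⟨b'.base, PUnit.unit⟩)) y') (by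
      have e := r.arrow_w (x := ⟨(i, ⟨b.base, PUnit.unit⟩), y⟩)
        (y := ⟨(i', ⟨b'.base, PUnit.unit⟩), y'⟩) m
      have e' : (A.toGFam.proj m).2 = _ := h
      rw [e'] at e
      refine Eq.trans ?_ e
      exact congrArg (CategoryStruct.comp _) (hF.map_preimage _).symm)
  proj_pmMap f y y' m h := rfl
  pmMap_id {i b} y h := SetHom.ext rfl
  pmMap_comp f g _ _ _ m n hm hn h := SetHom.ext rfl

/-- On parameters the round trip is `el (arrow y)`, equal to `y` but not by definition. The cell
joins the two by the arrow that `homOf` makes from the square given by `arrow_el`, so nothing is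
transported along an equation. `ofToRestrUnit` does the same for `arrow (el y)`. -/
def toOfRestrUnit : Cell ((toRestrUnit r hF).comp (ofRestrUnit r hF)) (Lens.id _) where
  app f := f
  proj_app _ := rfl
  -- The round trip on arrows of operations applies `F.map` and then its preimage.
  app_left {b b' b''} f g := SetHom.ext (congrArg (· ≫ SetHom.base g) (hF.preimage_map _).symm)
  app_right f g := rfl
  pm {i i' b b'} f y y' m h := r.homOf
    (x := ⟨(i, b), r.el (b := (i, b)) (r.arrow (b := (i, b)) y)⟩) (y := ⟨(i', b'), y'⟩)
    ((A.toGFam.proj m).1, f) (by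
      have e := r.arrow_w (x := ⟨(i, ⟨b.base, PUnit.unit⟩), y⟩)
        (y := ⟨(i', ⟨b'.base, PUnit.unit⟩), y'⟩) m
      have e' : (A.toGFam.proj m).2 = f := h
      rw [e'] at e
      exact (congrArg (· ≫ _) (r.arrow_el (b := (i, b)) _)).trans e)
  proj_pm f y y' m h := rfl
  pm_left f g _ _ _ m n hm hn h := SetHom.ext rfl
  pm_right f g _ _ _ m n hm hn h := SetHom.ext (Prod.ext rfl
    (congrArg (CategoryStruct.comp f) (show g = (A.toGFam.proj n).2 from hn.symm)))

def ofToRestrUnit : Cell ((ofRestrUnit r hF).comp (toRestrUnit r hF)) (Lens.id _) where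
  app f := f
  proj_app _ := rfl
  -- In this direction the preimage is taken first, so fullness of `F` is used instead of
  -- faithfulness.
  app_left {b b' b''} f g := SetHom.ext (congrArg (· ≫ SetHom.base g) (hF.map_preimage _).symm)
  app_right f g := rfl
  pm {i i' b b'} f y y' m h := Poly.unitHom (b := (i, ⟨F.obj b.base, b.el⟩))
    (b' := (i', ⟨F.obj b'.base, b'.el⟩)) (((Poly.unit L).Pm.proj m).1, f)
    (u := r.arrow (b := (i, ⟨b.base, PUnit.unit⟩)) (r.el (b := (i, ⟨b.base, PUnit.unit⟩)) y))
    (v := y') (by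
      have e := Poly.unitHom_w (b := (i, ⟨F.obj b.base, PUnit.unit⟩))
        (b' := (i', ⟨F.obj b'.base, PUnit.unit⟩)) m
      have e' : ((Poly.unit L).Pm.proj m).2 = f := h
      exact (congrArg (· ≫ _) (r.arrow_el (b := (i, ⟨b.base, PUnit.unit⟩)) _)).trans
        ((congrArg (fun t => (show i ⟶ F.obj b.base from y) ≫ (Poly.unit L).Op.proj t)
          e').symm.trans e))
  proj_pm f y y' m h := rfl
  pm_left f g _ _ _ m n hm hn h := SetHom.ext rfl
  pm_right f g _ _ _ m n hm hn h := SetHom.ext (Prod.ext rfl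
    (congrArg (CategoryStruct.comp (obj := (Poly.unit L).Op.Tot) f)
      (show g = ((Poly.unit L).Pm.proj n).2 from hn.symm)))

theorem toRestrUnit_isEquiv : (toRestrUnit r hF).IsEquiv :=
  ⟨ofRestrUnit r hF, ⟨toOfRestrUnit r hF⟩, ⟨ofToRestrUnit r hF⟩⟩

end Lens

/-- The parameters of the first projection are represented by the first inclusion. -/
def SetFam.pathInlRepresented (J K : Type u) [Groupoid.{u} J] [Groupoid.{u} K] :
    (SetFam.pathInl J K).Represented (inlFunctor J K) where
  arrow {b} u :=
    -- Over a colour `inr k` there is neither a parameter nor an arrow to `inl j`, so only one case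
    -- remains.
    match b, u with
    | (.inl _, _), u => ULift.up u
  el {b} u :=
    match b, u with
    | (.inl _, _), u => ULift.down u
  arrow_el {b} u := by
    obtain ⟨i | k, b⟩ := b
    · rfl
    · exact u.elim
  el_arrow {b} u := by
    obtain ⟨i | k, b⟩ := b
    · rfl
    · exact u.elim
  arrow_act {b b'} f u := by
    obtain ⟨i | k, b⟩ := b
    · obtain ⟨i' | k', b'⟩ := b'
      -- The action is pre-composition with the inverse of `f.1` and post-composition with the other
      -- side, so composing with `f.1` cancels the inverse.
      · exact congrArg ULift.up (IsIso.hom_inv_id_assoc f.1.down _)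
      · exact f.1.elim
    · exact u.elim

/-- The parameters of the second projection are represented by the second inclusion. -/
def SetFam.pathInrRepresented (J K : Type u) [Groupoid.{u} J] [Groupoid.{u} K] :
    (SetFam.pathInr J K).Represented (inrFunctor J K) where
  arrow {b} u :=
    match b, u with
    | (.inr _, _), u => ULift.up u
  el {b} u :=
    match b, u with
    | (.inr _, _), u => ULift.down u
  arrow_el {b} u := by
    obtain ⟨i | k, b⟩ := b
    · exact u.elim
    · rfl
  el_arrow {b} u := by
    obtain ⟨i | k, b⟩ := b
    · exact u.elim
    · rfl
  arrow_act {b b'} f u := by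
    obtain ⟨i | k, b⟩ := b
    · exact u.elim
    · obtain ⟨i' | k', b'⟩ := b'
      · exact f.1.elim
      · exact congrArg ULift.up (IsIso.hom_inv_id_assoc f.1.down _)

end Represented

/-! ### Post-composition with a represented family compared with restriction. -/

noncomputable section Comparison

variable {I J L : Type u} [Groupoid.{u} I] [Groupoid.{u} J] [Groupoid.{u} L]
  {A : SetFam (L × (SetFam.point J).toGFam.Tot)} {F : J ⥤ L} (r : A.Represented F)
  (hF : F.FullyFaithful)

namespace Lens

/-- Post-composition with a represented family of sets, followed by the identification of its
restriction. -/
abbrev restrComparisonAux (R : Poly I L) :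
    Lens (R.comp (Poly.ofSets A)) ((R.comp (Poly.unit L)).restr hF) :=
  (Lens.whiskerLeft R (toRestrUnit r hF)).comp (compRestrHom hF R (Poly.unit L))

/-- The comparison between the post-composition with a represented family of sets and the
restriction along the functor that represents it. -/
abbrev restrComparison (R : Poly I L) : Lens (R.comp (Poly.ofSets A)) (R.restr hF) :=
  (restrComparisonAux r hF R).comp ((rightHom R).restr hF)

/-- Three equivalences in a row: representability whiskered by `R`, commutation of composition with
restriction, and the restricted right unitor. -/
theorem restrComparison_isEquiv (R : Poly I L) : (restrComparison r hF R).IsEquiv :=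
  (((toRestrUnit_isEquiv r hF).whiskerLeft R).comp (compRestrHom_isEquiv hF R _)).comp
    ((rightHom_isEquiv R).restr hF)

end Lens

variable {R R' : Poly I L}

/-- `restrComparisonAux` is natural in `R` by definition: it leaves the operations and parameters of
`R` alone, and whiskerings on the two sides commute strictly. Only the right unitor contributes a
cell. -/
def Cell.restrComparisonNat (φ : Lens R R') :
    Cell ((φ.whiskerRight (Poly.ofSets A)).comp (Lens.restrComparison r hF R'))
      ((Lens.restrComparison r hF R).comp (φ.restr hF)) :=
  Cell.precomp (Lens.restrComparisonAux r hF R) (Cell.restr hF (Cell.rightHomNat φ))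

/-- The image of `rightHom_naturality` under restriction and whiskering, both of which preserve
composites of cells. -/
theorem Cell.restrComparison_naturality {φ ψ : Lens R R'} (T : Cell φ ψ) :
    Cell.comp (Cell.postcomp (Cell.whiskerRight T (Poly.ofSets A)) (Lens.restrComparison r hF R'))
      (Cell.restrComparisonNat r hF ψ) =
    Cell.comp (Cell.restrComparisonNat r hF φ)
      (Cell.precomp (Lens.restrComparison r hF R) (Cell.restr hF T)) :=
  ((Cell.precomp_comp (Lens.restrComparisonAux r hF R)
    (Cell.restr hF (Cell.postcomp (Cell.whiskerRight T (Poly.unit L)) (Lens.rightHom R')))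
    (Cell.restr hF (Cell.rightHomNat ψ))).symm.trans
    (congrArg (fun U => Cell.precomp (Lens.restrComparisonAux r hF R) (Cell.restr hF U))
      (Cell.rightHom_naturality T))).trans
    (Cell.precomp_comp (Lens.restrComparisonAux r hF R) (Cell.restr hF (Cell.rightHomNat φ))
      (Cell.restr hF (Cell.precomp (Lens.rightHom R) T)))

variable (R R') in
def Lens.restrComparisonIso :
    Lens.whiskerRightFunctor R R' (Poly.ofSets A) ⋙
        Lens.postFunctor _ (Lens.restrComparison r hF R') ≅
      Lens.restrFunctor hF R R' ⋙ Lens.preFunctor (Lens.restrComparison r hF R) _ :=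
  NatIso.ofComponents
    (fun φ => Groupoid.isoEquivHom _ _ |>.symm (Cell.restrComparisonNat r hF φ))
    fun T => Cell.restrComparison_naturality r hF T

end Comparison

/-! ### Gluing morphisms of polynomials over the two summands. -/

noncomputable section Glue

variable {I J K : Type u} [Groupoid.{u} I] [Groupoid.{u} J] [Groupoid.{u} K]
  {R R' : Poly I (J ⊕ K)}

/-- Such an arrow would project to an arrow of `J ⊕ K` between different summands, and there is
none. -/
theorem GFam.not_inl_inr {A : GFam (J ⊕ K)} {j : J} {k : K} {x : A.El (.inl j)} {y : A.El (.inr k)}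
    (f : A.Hom x y) : False :=
  (A.proj f : PEmpty).elim

theorem GFam.not_inr_inl {A : GFam (J ⊕ K)} {j : J} {k : K} {x : A.El (.inr k)} {y : A.El (.inl j)}
    (f : A.Hom x y) : False :=
  (A.proj f : PEmpty).elim

namespace Lens

/-- The morphism of polynomials with prescribed restrictions to the two summands. -/
abbrev glue (φ : Lens (R.restr (inlFullyFaithful J K)) (R'.restr (inlFullyFaithful J K)))
    (ψ : Lens (R.restr (inrFullyFaithful J K)) (R'.restr (inrFullyFaithful J K))) : Lens R R' where
  op {j} x :=
    match j, x with
    | .inl j, x => φ.op (j := j) x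
    | .inr k, x => ψ.op (j := k) x
  opMap {b b'} f :=
    match b, b', f with
    | ⟨.inl j, x⟩, ⟨.inl j', x'⟩, f => φ.opMap (b := ⟨j, x⟩) (b' := ⟨j', x'⟩) f
    -- Mixed cases are vacuous, here and in all fields below. This is why the two given morphisms
    -- need not satisfy any compatibility condition.
    | ⟨.inl j, x⟩, ⟨.inr k', x'⟩, f => (GFam.not_inl_inr f).elim
    | ⟨.inr k, x⟩, ⟨.inl j', x'⟩, f => (GFam.not_inr_inl f).elim
    | ⟨.inr k, x⟩, ⟨.inr k', x'⟩, f => ψ.opMap (b := ⟨k, x⟩) (b' := ⟨k', x'⟩) f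
  proj_opMap {b b'} f :=
    match b, b', f with
    | ⟨.inl j, x⟩, ⟨.inl j', x'⟩, f =>
      congrArg ULift.up (φ.proj_opMap (b := ⟨j, x⟩) (b' := ⟨j', x'⟩) f)
    | ⟨.inl j, x⟩, ⟨.inr k', x'⟩, f => (GFam.not_inl_inr f).elim
    | ⟨.inr k, x⟩, ⟨.inl j', x'⟩, f => (GFam.not_inr_inl f).elim
    | ⟨.inr k, x⟩, ⟨.inr k', x'⟩, f =>
      congrArg ULift.up (ψ.proj_opMap (b := ⟨k, x⟩) (b' := ⟨k', x'⟩) f)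
  opMap_id b :=
    match b with
    | ⟨.inl j, x⟩ => φ.opMap_id ⟨j, x⟩
    | ⟨.inr k, x⟩ => ψ.opMap_id ⟨k, x⟩
  opMap_comp {b b' b''} f g :=
    match b, b', b'', f, g with
    | ⟨.inl j, x⟩, ⟨.inl j', x'⟩, ⟨.inl j'', x''⟩, f, g =>
      φ.opMap_comp (b := ⟨j, x⟩) (b' := ⟨j', x'⟩) (b'' := ⟨j'', x''⟩) f g
    -- A composable pair that leaves a summand crosses over in its first or in its second arrow; the
    -- middle object tells which one to refute.
    | ⟨.inl j, x⟩, ⟨.inr k', x'⟩, _, f, g => (GFam.not_inl_inr f).elim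
    | ⟨.inr k, x⟩, ⟨.inl j', x'⟩, _, f, g => (GFam.not_inr_inl f).elim
    | _, ⟨.inl j', x'⟩, ⟨.inr k'', x''⟩, f, g => (GFam.not_inl_inr g).elim
    | _, ⟨.inr k', x'⟩, ⟨.inl j'', x''⟩, f, g => (GFam.not_inr_inl g).elim
    | ⟨.inr k, x⟩, ⟨.inr k', x'⟩, ⟨.inr k'', x''⟩, f, g =>
      ψ.opMap_comp (b := ⟨k, x⟩) (b' := ⟨k', x'⟩) (b'' := ⟨k'', x''⟩) f g
  pm {i b} y :=
    match b, y with
    | ⟨.inl j, x⟩, y => φ.pm (b := ⟨j, x⟩) y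
    | ⟨.inr k, x⟩, y => ψ.pm (b := ⟨k, x⟩) y
  pmMap {i i' b b'} f y y' m h :=
    match b, b', f, y, y', m, h with
    | ⟨.inl j, x⟩, ⟨.inl j', x'⟩, f, y, y', m, h =>
      φ.pmMap (b := ⟨j, x⟩) (b' := ⟨j', x'⟩) f (y := y) (y' := y') m h
    | ⟨.inl j, x⟩, ⟨.inr k', x'⟩, f, _, _, _, _ => (GFam.not_inl_inr f).elim
    | ⟨.inr k, x⟩, ⟨.inl j', x'⟩, f, _, _, _, _ => (GFam.not_inr_inl f).elim
    | ⟨.inr k, x⟩, ⟨.inr k', x'⟩, f, y, y', m, h =>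
      ψ.pmMap (b := ⟨k, x⟩) (b' := ⟨k', x'⟩) f (y := y) (y' := y') m h
  proj_pmMap {i i' b b'} f y y' m h :=
    match b, b', f, y, y', m, h with
    | ⟨.inl j, x⟩, ⟨.inl j', x'⟩, f, y, y', m, h =>
      φ.proj_pmMap (b := ⟨j, x⟩) (b' := ⟨j', x'⟩) f (y := y) (y' := y') m h
    | ⟨.inl j, x⟩, ⟨.inr k', x'⟩, f, _, _, _, _ => (GFam.not_inl_inr f).elim
    | ⟨.inr k, x⟩, ⟨.inl j', x'⟩, f, _, _, _, _ => (GFam.not_inr_inl f).elim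
    | ⟨.inr k, x⟩, ⟨.inr k', x'⟩, f, y, y', m, h =>
      ψ.proj_pmMap (b := ⟨k, x⟩) (b' := ⟨k', x'⟩) f (y := y) (y' := y') m h
  pmMap_id {i b} y h :=
    match b, y, h with
    | ⟨.inl j, x⟩, y, h => φ.pmMap_id (b := ⟨j, x⟩) y h
    | ⟨.inr k, x⟩, y, h => ψ.pmMap_id (b := ⟨k, x⟩) y h
  pmMap_comp {i i' i'' b b' b''} f g y y' y'' m n hm hn h :=
    match b, b', b'', f, g, y, y', y'', m, n, hm, hn, h with
    | ⟨.inl j, x⟩, ⟨.inl j', x'⟩, ⟨.inl j'', x''⟩, f, g, y, y', y'', m, n, hm, hn, h =>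
      φ.pmMap_comp (b := ⟨j, x⟩) (b' := ⟨j', x'⟩) (b'' := ⟨j'', x''⟩) f g
        (y := y) (y' := y') (y'' := y'') m n hm hn h
    | ⟨.inl j, x⟩, ⟨.inr k', x'⟩, _, f, _, _, _, _, _, _, _, _, _ => (GFam.not_inl_inr f).elim
    | ⟨.inr k, x⟩, ⟨.inl j', x'⟩, _, f, _, _, _, _, _, _, _, _, _ => (GFam.not_inr_inl f).elim
    | _, ⟨.inl j', x'⟩, ⟨.inr k'', x''⟩, _, g, _, _, _, _, _, _, _, _ => (GFam.not_inl_inr g).elim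
    | _, ⟨.inr k', x'⟩, ⟨.inl j'', x''⟩, _, g, _, _, _, _, _, _, _, _ => (GFam.not_inr_inl g).elim
    | ⟨.inr k, x⟩, ⟨.inr k', x'⟩, ⟨.inr k'', x''⟩, f, g, y, y', y'', m, n, hm, hn, h =>
      ψ.pmMap_comp (b := ⟨k, x⟩) (b' := ⟨k', x'⟩) (b'' := ⟨k'', x''⟩) f g
        (y := y) (y' := y') (y'' := y'') m n hm hn h

section
variable (φ : Lens (R.restr (inlFullyFaithful J K)) (R'.restr (inlFullyFaithful J K)))
    (ψ : Lens (R.restr (inrFullyFaithful J K)) (R'.restr (inrFullyFaithful J K)))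

end
end Lens
end Glue

/-! ### Gluing identifications, and the equivalence of groupoids of morphisms. -/

noncomputable section Glue

variable {I J K : Type u} [Groupoid.{u} I] [Groupoid.{u} J] [Groupoid.{u} K]
  {R R' : Poly I (J ⊕ K)}

/-- The identification with prescribed restrictions to the two summands. -/
abbrev Cell.glue {φ ψ : Lens R R'}
    (T : Cell (φ.restr (inlFullyFaithful J K)) (ψ.restr (inlFullyFaithful J K)))
    (U : Cell (φ.restr (inrFullyFaithful J K)) (ψ.restr (inrFullyFaithful J K))) : Cell φ ψ where
  app {b b'} f :=
    match b, b', f with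
    | ⟨.inl j, x⟩, ⟨.inl j', x'⟩, f => T.app (b := ⟨j, x⟩) (b' := ⟨j', x'⟩) f
    | ⟨.inl j, x⟩, ⟨.inr k', x'⟩, f => (GFam.not_inl_inr f).elim
    | ⟨.inr k, x⟩, ⟨.inl j', x'⟩, f => (GFam.not_inr_inl f).elim
    | ⟨.inr k, x⟩, ⟨.inr k', x'⟩, f => U.app (b := ⟨k, x⟩) (b' := ⟨k', x'⟩) f
  proj_app {b b'} f :=
    match b, b', f with
    | ⟨.inl j, x⟩, ⟨.inl j', x'⟩, f =>
      congrArg ULift.up (T.proj_app (b := ⟨j, x⟩) (b' := ⟨j', x'⟩) f)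
    | ⟨.inl j, x⟩, ⟨.inr k', x'⟩, f => (GFam.not_inl_inr f).elim
    | ⟨.inr k, x⟩, ⟨.inl j', x'⟩, f => (GFam.not_inr_inl f).elim
    | ⟨.inr k, x⟩, ⟨.inr k', x'⟩, f =>
      congrArg ULift.up (U.proj_app (b := ⟨k, x⟩) (b' := ⟨k', x'⟩) f)
  app_left {b b' b''} f g :=
    match b, b', b'', f, g with
    | ⟨.inl j, x⟩, ⟨.inl j', x'⟩, ⟨.inl j'', x''⟩, f, g =>
      T.app_left (b := ⟨j, x⟩) (b' := ⟨j', x'⟩) (b'' := ⟨j'', x''⟩) f g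
    | ⟨.inl j, x⟩, ⟨.inr k', x'⟩, _, f, g => (GFam.not_inl_inr f).elim
    | ⟨.inr k, x⟩, ⟨.inl j', x'⟩, _, f, g => (GFam.not_inr_inl f).elim
    | _, ⟨.inl j', x'⟩, ⟨.inr k'', x''⟩, f, g => (GFam.not_inl_inr g).elim
    | _, ⟨.inr k', x'⟩, ⟨.inl j'', x''⟩, f, g => (GFam.not_inr_inl g).elim
    | ⟨.inr k, x⟩, ⟨.inr k', x'⟩, ⟨.inr k'', x''⟩, f, g =>
      U.app_left (b := ⟨k, x⟩) (b' := ⟨k', x'⟩) (b'' := ⟨k'', x''⟩) f g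
  app_right {b b' b''} f g :=
    match b, b', b'', f, g with
    | ⟨.inl j, x⟩, ⟨.inl j', x'⟩, ⟨.inl j'', x''⟩, f, g =>
      T.app_right (b := ⟨j, x⟩) (b' := ⟨j', x'⟩) (b'' := ⟨j'', x''⟩) f g
    | ⟨.inl j, x⟩, ⟨.inr k', x'⟩, _, f, g => (GFam.not_inl_inr f).elim
    | ⟨.inr k, x⟩, ⟨.inl j', x'⟩, _, f, g => (GFam.not_inr_inl f).elim
    | _, ⟨.inl j', x'⟩, ⟨.inr k'', x''⟩, f, g => (GFam.not_inl_inr g).elim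
    | _, ⟨.inr k', x'⟩, ⟨.inl j'', x''⟩, f, g => (GFam.not_inr_inl g).elim
    | ⟨.inr k, x⟩, ⟨.inr k', x'⟩, ⟨.inr k'', x''⟩, f, g =>
      U.app_right (b := ⟨k, x⟩) (b' := ⟨k', x'⟩) (b'' := ⟨k'', x''⟩) f g
  pm {i i' b b'} f y y' m h :=
    match b, b', f, y, y', m, h with
    | ⟨.inl j, x⟩, ⟨.inl j', x'⟩, f, y, y', m, h =>
      T.pm (b := ⟨j, x⟩) (b' := ⟨j', x'⟩) f (y := y) (y' := y') m h
    | ⟨.inl j, x⟩, ⟨.inr k', x'⟩, f, _, _, _, _ => (GFam.not_inl_inr f).elim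
    | ⟨.inr k, x⟩, ⟨.inl j', x'⟩, f, _, _, _, _ => (GFam.not_inr_inl f).elim
    | ⟨.inr k, x⟩, ⟨.inr k', x'⟩, f, y, y', m, h =>
      U.pm (b := ⟨k, x⟩) (b' := ⟨k', x'⟩) f (y := y) (y' := y') m h
  proj_pm {i i' b b'} f y y' m h :=
    match b, b', f, y, y', m, h with
    | ⟨.inl j, x⟩, ⟨.inl j', x'⟩, f, y, y', m, h =>
      T.proj_pm (b := ⟨j, x⟩) (b' := ⟨j', x'⟩) f (y := y) (y' := y') m h
    | ⟨.inl j, x⟩, ⟨.inr k', x'⟩, f, _, _, _, _ => (GFam.not_inl_inr f).elim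
    | ⟨.inr k, x⟩, ⟨.inl j', x'⟩, f, _, _, _, _ => (GFam.not_inr_inl f).elim
    | ⟨.inr k, x⟩, ⟨.inr k', x'⟩, f, y, y', m, h =>
      U.proj_pm (b := ⟨k, x⟩) (b' := ⟨k', x'⟩) f (y := y) (y' := y') m h
  pm_left {i i' i'' b b' b''} f g y y' y'' m n hm hn h :=
    match b, b', b'', f, g, y, y', y'', m, n, hm, hn, h with
    | ⟨.inl j, x⟩, ⟨.inl j', x'⟩, ⟨.inl j'', x''⟩, f, g, y, y', y'', m, n, hm, hn, h =>
      T.pm_left (b := ⟨j, x⟩) (b' := ⟨j', x'⟩) (b'' := ⟨j'', x''⟩) f g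
        (y := y) (y' := y') (y'' := y'') m n hm hn h
    | ⟨.inl j, x⟩, ⟨.inr k', x'⟩, _, f, _, _, _, _, _, _, _, _, _ => (GFam.not_inl_inr f).elim
    | ⟨.inr k, x⟩, ⟨.inl j', x'⟩, _, f, _, _, _, _, _, _, _, _, _ => (GFam.not_inr_inl f).elim
    | _, ⟨.inl j', x'⟩, ⟨.inr k'', x''⟩, _, g, _, _, _, _, _, _, _, _ => (GFam.not_inl_inr g).elim
    | _, ⟨.inr k', x'⟩, ⟨.inl j'', x''⟩, _, g, _, _, _, _, _, _, _, _ => (GFam.not_inr_inl g).elim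
    | ⟨.inr k, x⟩, ⟨.inr k', x'⟩, ⟨.inr k'', x''⟩, f, g, y, y', y'', m, n, hm, hn, h =>
      U.pm_left (b := ⟨k, x⟩) (b' := ⟨k', x'⟩) (b'' := ⟨k'', x''⟩) f g
        (y := y) (y' := y') (y'' := y'') m n hm hn h
  pm_right {i i' i'' b b' b''} f g y y' y'' m n hm hn h :=
    match b, b', b'', f, g, y, y', y'', m, n, hm, hn, h with
    | ⟨.inl j, x⟩, ⟨.inl j', x'⟩, ⟨.inl j'', x''⟩, f, g, y, y', y'', m, n, hm, hn, h =>
      T.pm_right (b := ⟨j, x⟩) (b' := ⟨j', x'⟩) (b'' := ⟨j'', x''⟩) f g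
        (y := y) (y' := y') (y'' := y'') m n hm hn h
    | ⟨.inl j, x⟩, ⟨.inr k', x'⟩, _, f, _, _, _, _, _, _, _, _, _ => (GFam.not_inl_inr f).elim
    | ⟨.inr k, x⟩, ⟨.inl j', x'⟩, _, f, _, _, _, _, _, _, _, _, _ => (GFam.not_inr_inl f).elim
    | _, ⟨.inl j', x'⟩, ⟨.inr k'', x''⟩, _, g, _, _, _, _, _, _, _, _ => (GFam.not_inl_inr g).elim
    | _, ⟨.inr k', x'⟩, ⟨.inl j'', x''⟩, _, g, _, _, _, _, _, _, _, _ => (GFam.not_inr_inl g).elim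
    | ⟨.inr k, x⟩, ⟨.inr k', x'⟩, ⟨.inr k'', x''⟩, f, g, y, y', y'', m, n, hm, hn, h =>
      U.pm_right (b := ⟨k, x⟩) (b' := ⟨k', x'⟩) (b'' := ⟨k'', x''⟩) f g
        (y := y) (y' := y') (y'' := y'') m n hm hn h

/-- Every arrow of operations lies in one summand, so a cell has no values beyond those of its two
restrictions. -/
theorem Cell.eq_of_restr_eq {φ ψ : Lens R R'} {T U : Cell φ ψ}
    (hl : Cell.restr (inlFullyFaithful J K) T = Cell.restr (inlFullyFaithful J K) U)
    (hr : Cell.restr (inrFullyFaithful J K) T = Cell.restr (inrFullyFaithful J K) U) : T = U := by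
  -- A cell that can be rebuilt from its restrictions is determined by them; on each pure case the
  -- rebuilt cell agrees by definition.
  suffices ∀ V : Cell φ ψ, V = Cell.glue (Cell.restr (inlFullyFaithful J K) V)
      (Cell.restr (inrFullyFaithful J K) V) by
    rw [this T, this U, hl, hr]
  intro V
  refine Cell.ext' (fun {b b'} f => ?_) fun {i i' b b'} f {y y'} m h h' => ?_
  · obtain ⟨j | k, x⟩ := b <;> obtain ⟨j' | k', x'⟩ := b'
    · rfl
    · exact (GFam.not_inl_inr f).elim
    · exact (GFam.not_inr_inl f).elim
    · rfl
  · obtain ⟨j | k, x⟩ := b <;> obtain ⟨j' | k', x'⟩ := b'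
    · rfl
    · exact (GFam.not_inl_inr f).elim
    · exact (GFam.not_inr_inl f).elim
    · rfl

namespace Lens

variable (R R')

/-- The restrictions of morphisms of polynomials to the two summands. -/
def restrPair : Lens R R' ⥤
    Lens (R.restr (inlFullyFaithful J K)) (R'.restr (inlFullyFaithful J K)) ×
      Lens (R.restr (inrFullyFaithful J K)) (R'.restr (inrFullyFaithful J K)) :=
  (restrFunctor (inlFullyFaithful J K) R R').prod' (restrFunctor (inrFullyFaithful J K) R R')

/-- Restricting a glued morphism, or a glued cell, returns the given pair by definition: fullness
holds by `rfl` and essential surjectivity by an identity isomorphism. -/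
instance restrPair_isEquivalence : (restrPair R R').IsEquivalence where
  faithful := ⟨fun h => Cell.eq_of_restr_eq (congrArg Prod.fst h) (congrArg Prod.snd h)⟩
  full := ⟨fun f => ⟨Cell.glue f.1 f.2, rfl⟩⟩
  essSurj := ⟨fun p => ⟨glue p.1 p.2, ⟨Iso.refl p⟩⟩⟩

/-- `Poly.projl` unfolds to `Poly.ofSets` of the family `SetFam.pathInl`, so the general comparison
applies as it stands. -/
abbrev projlComparison (R : Poly I (J ⊕ K)) :
    Lens (R.comp (Poly.projl J K)) (R.restr (inlFullyFaithful J K)) :=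
  restrComparison (SetFam.pathInlRepresented J K) (inlFullyFaithful J K) R

abbrev projrComparison (R : Poly I (J ⊕ K)) :
    Lens (R.comp (Poly.projr J K)) (R.restr (inrFullyFaithful J K)) :=
  restrComparison (SetFam.pathInrRepresented J K) (inrFullyFaithful J K) R

theorem projlComparison_isEquiv (R : Poly I (J ⊕ K)) : (projlComparison R).IsEquiv :=
  restrComparison_isEquiv _ _ R

theorem projrComparison_isEquiv (R : Poly I (J ⊕ K)) : (projrComparison R).IsEquiv :=
  restrComparison_isEquiv _ _ R

def projlComparisonIso :
    whiskerRightFunctor R R' (Poly.projl J K) ⋙ postFunctor _ (projlComparison R') ≅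
      restrFunctor (inlFullyFaithful J K) R R' ⋙ preFunctor (projlComparison R) _ :=
  restrComparisonIso (SetFam.pathInlRepresented J K) (inlFullyFaithful J K) R R'

def projrComparisonIso :
    whiskerRightFunctor R R' (Poly.projr J K) ⋙ postFunctor _ (projrComparison R') ≅
      restrFunctor (inrFullyFaithful J K) R R' ⋙ preFunctor (projrComparison R) _ :=
  restrComparisonIso (SetFam.pathInrRepresented J K) (inrFullyFaithful J K) R R'

/-- The square relating post-composition with the projections to restriction to the summands, up to
the comparisons at `R'` on one side and at `R` on the other. -/
def compProjIso :
    compProj R R' ⋙ (postFunctor _ (projlComparison R')).prod (postFunctor _ (projrComparison R')) ≅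
      restrPair R R' ⋙ (preFunctor (projlComparison R) _).prod (preFunctor (projrComparison R) _) :=
  NatIso.ofComponents
    (fun φ => Iso.prod ((projlComparisonIso R R').app φ) ((projrComparisonIso R R').app φ))
    fun T => Prod.ext ((projlComparisonIso R R').hom.naturality T)
      ((projrComparisonIso R R').hom.naturality T)

theorem prod_isEquivalence {A B C D : Type*} [Category A] [Category B] [Category C] [Category D]
    (F : A ⥤ B) (G : C ⥤ D) [F.IsEquivalence] [G.IsEquivalence] : (F.prod G).IsEquivalence :=
  (F.asEquivalence.prod G.asEquivalence).isEquivalence_functor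

/-- In the square `compProjIso` the functor `restrPair` and all compositions with comparisons are
equivalences; what remains must be one as well. -/
theorem compProj_isEquivalence : (compProj R R').IsEquivalence := by
  have := (projlComparison_isEquiv R').post (R.comp (Poly.projl J K))
  have := (projrComparison_isEquiv R').post (R.comp (Poly.projr J K))
  have := (projlComparison_isEquiv R).pre (R'.restr (inlFullyFaithful J K))
  have := (projrComparison_isEquiv R).pre (R'.restr (inrFullyFaithful J K))
  have := prod_isEquivalence (postFunctor (R.comp (Poly.projl J K)) (projlComparison R'))
    (postFunctor (R.comp (Poly.projr J K)) (projrComparison R'))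
  have := prod_isEquivalence (preFunctor (projlComparison R) (R'.restr (inlFullyFaithful J K)))
    (preFunctor (projrComparison R) (R'.restr (inrFullyFaithful J K)))
  -- One path of the square is a composite of equivalences, so the isomorphic path through
  -- `compProj` is an equivalence.
  have := Functor.isEquivalence_of_iso (compProjIso R R').symm
  -- The last factor of that path is an equivalence and can be cancelled.
  exact Functor.isEquivalence_of_comp_right (compProj R R')
    ((postFunctor _ (projlComparison R')).prod (postFunctor _ (projrComparison R')))

end Lens
end Glue

/-! ### The product in the bicategory of polynomials. -/

noncomputable section Product

open Bicategory

variable {I J K : Type u} [Groupoid.{u} I] [Groupoid.{u} J] [Groupoid.{u} K]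

namespace PolyHom

variable {R R' : Poly I (J ⊕ K)}

/-- Injectivity on classes of morphisms is fullness of `Lens.compProj` one level below: equal
classes mean that identifications exist after projecting, and a pair of them lifts to an
identification of the original morphisms. -/
theorem eq_of_whiskerRight_eq {f g : PolyHom R R'}
    (hl : whiskerRight f (Poly.projl J K) = whiskerRight g (Poly.projl J K))
    (hr : whiskerRight f (Poly.projr J K) = whiskerRight g (Poly.projr J K)) : f = g := by
  obtain ⟨φ, rfl⟩ := Quotient.exists_rep f
  obtain ⟨ψ, rfl⟩ := Quotient.exists_rep g
  obtain ⟨T⟩ := Quotient.exact hl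
  obtain ⟨U⟩ := Quotient.exact hr
  have := Lens.compProj_isEquivalence R R'
  have V : (Lens.compProj R R').obj φ ⟶ (Lens.compProj R R').obj ψ := (T, U)
  exact sound ((Lens.compProj R R').preimage V)

/-- Surjectivity on classes is essential surjectivity of `Lens.compProj`: a pair of morphisms is hit
up to identification, hence exactly after passing to classes. -/
theorem exists_whiskerRight_eq (f : PolyHom (R.comp (Poly.projl J K)) (R'.comp (Poly.projl J K)))
    (g : PolyHom (R.comp (Poly.projr J K)) (R'.comp (Poly.projr J K))) :
    ∃ h : PolyHom R R', whiskerRight h (Poly.projl J K) = f ∧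
      whiskerRight h (Poly.projr J K) = g := by
  revert f g
  refine ind fun φ => ind fun ψ => ?_
  have := Lens.compProj_isEquivalence R R'
  have e := (Lens.compProj R R').objObjPreimageIso (φ, ψ)
  exact ⟨mk ((Lens.compProj R R').objPreimage (φ, ψ)), sound e.hom.1, sound e.hom.2⟩

end PolyHom

/-- A polynomial is equivalent to the restriction of a pairing to the first summand. -/
def Lens.pairRestrInl (P : Poly I J) (Q : Poly I K) :
    Lens ((Poly.pair P Q).restr (inlFullyFaithful J K)) P where
  op x := x
  opMap f := f
  proj_opMap _ := rfl
  opMap_id _ := rfl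
  opMap_comp _ _ := rfl
  pm y := y
  pmMap _ _ _ m _ := m
  proj_pmMap _ _ _ _ h := Prod.ext rfl h
  pmMap_id _ _ := rfl
  pmMap_comp _ _ _ _ _ _ _ _ _ _ := rfl

def Lens.pairRestrInlInv (P : Poly I J) (Q : Poly I K) :
    Lens P ((Poly.pair P Q).restr (inlFullyFaithful J K)) where
  op x := x
  opMap f := f
  proj_opMap _ := rfl
  opMap_id _ := rfl
  opMap_comp _ _ := rfl
  pm y := y
  pmMap _ _ _ m _ := m
  proj_pmMap _ _ _ _ h := Prod.ext rfl h
  pmMap_id _ _ := rfl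
  pmMap_comp _ _ _ _ _ _ _ _ _ _ := rfl

/-- Over `inl j` the pairing unfolds to `P`, so both lenses are the identity on all data and both
composites are identity lenses by definition. -/
theorem Lens.pairRestrInl_isEquiv (P : Poly I J) (Q : Poly I K) : (pairRestrInl P Q).IsEquiv :=
  ⟨pairRestrInlInv P Q, ⟨Cell.id (Lens.id _)⟩, ⟨Cell.id (Lens.id _)⟩⟩

def Lens.pairRestrInr (P : Poly I J) (Q : Poly I K) :
    Lens ((Poly.pair P Q).restr (inrFullyFaithful J K)) Q where
  op x := x
  opMap f := f
  proj_opMap _ := rfl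
  opMap_id _ := rfl
  opMap_comp _ _ := rfl
  pm y := y
  pmMap _ _ _ m _ := m
  proj_pmMap _ _ _ _ h := Prod.ext rfl h
  pmMap_id _ _ := rfl
  pmMap_comp _ _ _ _ _ _ _ _ _ _ := rfl

def Lens.pairRestrInrInv (P : Poly I J) (Q : Poly I K) :
    Lens Q ((Poly.pair P Q).restr (inrFullyFaithful J K)) where
  op x := x
  opMap f := f
  proj_opMap _ := rfl
  opMap_id _ := rfl
  opMap_comp _ _ := rfl
  pm y := y
  pmMap _ _ _ m _ := m
  proj_pmMap _ _ _ _ h := Prod.ext rfl h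
  pmMap_id _ _ := rfl
  pmMap_comp _ _ _ _ _ _ _ _ _ _ := rfl

theorem Lens.pairRestrInr_isEquiv (P : Poly I J) (Q : Poly I K) : (pairRestrInr P Q).IsEquiv :=
  ⟨pairRestrInrInv P Q, ⟨Cell.id (Lens.id _)⟩, ⟨Cell.id (Lens.id _)⟩⟩

/-- Composing with the projection is restricting to the summand, and the restricted pairing is `P`.
-/
theorem Poly.nonempty_pair_comp_projl_iso (P : Poly I J) (Q : Poly I K) :
    Nonempty ((Poly.pair P Q).comp (Poly.projl J K) ≅ P) :=
  ((Lens.projlComparison_isEquiv _).comp (Lens.pairRestrInl_isEquiv P Q)).nonempty_iso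

theorem Poly.nonempty_pair_comp_projr_iso (P : Poly I J) (Q : Poly I K) :
    Nonempty ((Poly.pair P Q).comp (Poly.projr J K) ≅ Q) :=
  ((Lens.projrComparison_isEquiv _).comp (Lens.pairRestrInr_isEquiv P Q)).nonempty_iso

section
variable (I J K)

/-- Post-composition with the two projections, before discarding the morphisms of polynomials
which are not invertible. -/
abbrev compProjFunctor : (PolyGrpd.of I ⟶ PolyGrpd.of (J ⊕ K)) ⥤
    (PolyGrpd.of I ⟶ PolyGrpd.of J) × (PolyGrpd.of I ⟶ PolyGrpd.of K) :=
  postcompPair (B := PolyGrpd.{u}) (X := PolyGrpd.of (J ⊕ K)) (J := PolyGrpd.of J)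
    (K := PolyGrpd.of K) (Poly.projl J K) (Poly.projr J K) (PolyGrpd.of I)

instance : (compProjFunctor I J K).Faithful :=
  ⟨fun h => PolyHom.eq_of_whiskerRight_eq (congrArg Prod.fst h) (congrArg Prod.snd h)⟩

instance : (compProjFunctor I J K).Full :=
  ⟨fun {R R'} f => by
    obtain ⟨h, hl, hr⟩ := PolyHom.exists_whiskerRight_eq (R := R) (R' := R') f.1 f.2
    exact ⟨h, Prod.ext hl hr⟩⟩

/-- Post-composition with the two projections. -/
abbrev PolyBicat.compProjFunctor : (PolyBicat.of I ⟶ PolyBicat.of (J ⊕ K)) ⥤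
    (PolyBicat.of I ⟶ PolyBicat.of J) × (PolyBicat.of I ⟶ PolyBicat.of K) :=
  postcompPair (PolyBicat.hom (Poly.projl J K)) (PolyBicat.hom (Poly.projr J K)) (PolyBicat.of I)

/-- A 2-cell of the pith is an isomorphism, determined by its underlying class of morphisms, so
faithfulness is inherited. -/
instance : (PolyBicat.compProjFunctor I J K).Faithful :=
  ⟨fun {R R' f g} h => Pith.hom₂_ext _ (PolyHom.eq_of_whiskerRight_eq
    (congrArg (fun t => t.1.iso.hom) h) (congrArg (fun t => t.2.iso.hom) h))⟩

instance : (PolyBicat.compProjFunctor I J K).Full :=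
  ⟨fun {R R'} f => by
    -- A fully faithful functor lifts isomorphisms, so the preimage of an invertible pair is
    -- invertible and belongs to the pith.
    let e : R.of ≅ R'.of := (GrpdPoly.compProjFunctor I J K).preimageIso (Iso.prod f.1.iso f.2.iso)
    have he := (GrpdPoly.compProjFunctor I J K).map_preimage (X := R.of) (Y := R'.of)
      (f.1.iso.hom, f.2.iso.hom)
    exact ⟨⟨e⟩, Prod.ext (Pith.hom₂_ext _ (congrArg Prod.fst he))
      (Pith.hom₂_ext _ (congrArg Prod.snd he))⟩⟩

end

theorem PolyBicat.nonempty_compProjFunctor_pair_iso (P : Poly I J) (Q : Poly I K) :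
    Nonempty ((PolyBicat.compProjFunctor I J K).obj (PolyBicat.hom (Poly.pair P Q)) ≅
      (PolyBicat.hom P, PolyBicat.hom Q)) := by
  obtain ⟨e⟩ := Poly.nonempty_pair_comp_projl_iso P Q
  obtain ⟨e'⟩ := Poly.nonempty_pair_comp_projr_iso P Q
  exact ⟨Iso.prod (Core.isoMk e) (Core.isoMk e')⟩

/-- With full faithfulness at hand, only objects remain, and the pairing supplies an explicit
preimage of any pair of polynomials. -/
instance PolyBicat.compProjFunctor_isEquivalence :
    (PolyBicat.compProjFunctor I J K).IsEquivalence where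
  essSurj := ⟨fun p => ⟨PolyBicat.hom (Poly.pair p.1.of p.2.of),
    PolyBicat.nonempty_compProjFunctor_pair_iso p.1.of p.2.of⟩⟩

theorem PolyBicat.isProductObj (J K : Type u) [Groupoid.{u} J] [Groupoid.{u} K] :
    IsProductObj (PolyBicat.hom (Poly.projl J K)) (PolyBicat.hom (Poly.projr J K)) :=
  -- An object of the bicategory agrees with the wrapping of its carrier by structure eta, so the
  -- statement for groupoids covers all objects.
  fun I => PolyBicat.compProjFunctor_isEquivalence (I := I.as.carrier)

/-- An equivalence has an inverse with prescribed values on objects, when these values are sent to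
the right objects up to isomorphism. -/
theorem exists_equivalence_inverse_obj {C D : Type*} [Category C] [Category D] (F : C ⥤ D)
    [F.IsEquivalence] (obj : D → C) (h : ∀ d, Nonempty (F.obj (obj d) ≅ d)) :
    ∃ e : C ≌ D, e.functor = F ∧ ∀ d, e.inverse.obj d = obj d := by
  -- Apply the inverse to `F (obj d) ≅ d` and cancel it against `F` by the unit.
  let i : ∀ d, F.asEquivalence.inverse.obj d ≅ obj d := fun d =>
    F.asEquivalence.inverse.mapIso (h d).some.symm ≪≫ (F.asEquivalence.unitIso.app (obj d)).symm
  -- The inverse is replaced by an isomorphic copy whose values on objects are literally `obj d`;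
  -- this is what allows an equation between objects and not just an isomorphism.
  exact ⟨F.asEquivalence.changeInverse (F.asEquivalence.inverse.isoCopyObj obj i), rfl,
    fun _ => rfl⟩

end Product

/-! ### Terminal objects: groupoids without objects. -/

section Terminal

open Bicategory

/-- Uniqueness of arrows gives full faithfulness over the point, and the object `X` is there only to
make the category inhabited. -/
theorem star_isEquivalence {C : Type*} [Category C] (X : C)
    (h : ∀ Y Z : C, Nonempty (Unique (Y ⟶ Z))) : (Functor.star.{0} C).IsEquivalence where
  faithful := ⟨fun {Y Z} f g _ => by
    obtain ⟨i⟩ := h Y Z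
    exact Subsingleton.elim f g⟩
  full := ⟨fun {Y Z} f => by
    obtain ⟨i⟩ := h Y Z
    exact ⟨default, Subsingleton.elim _ _⟩⟩
  essSurj := ⟨fun p => ⟨X, ⟨eqToIso (Subsingleton.elim _ _)⟩⟩⟩

variable {I T : Type u} [Groupoid.{u} I] [Groupoid.{u} T] [IsEmpty T]

/-- Any two polynomials without colours are related by a morphism. -/
def Lens.ofIsEmpty (R R' : Poly I T) : Lens R R' where
  op {j} := (IsEmpty.false j).elim
  opMap {b} := (IsEmpty.false b.base).elim
  proj_opMap {b} := (IsEmpty.false b.base).elim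
  opMap_id b := (IsEmpty.false b.base).elim
  opMap_comp {b} := (IsEmpty.false b.base).elim
  pm {_ b} := (IsEmpty.false b.base).elim
  pmMap {_ _ b} := (IsEmpty.false b.base).elim
  proj_pmMap {_ _ b} := (IsEmpty.false b.base).elim
  pmMap_id {_ b} := (IsEmpty.false b.base).elim
  pmMap_comp {_ _ _ b} := (IsEmpty.false b.base).elim

/-- Any two parallel morphisms of polynomials without colours are identified. -/
def Cell.ofIsEmpty {R R' : Poly I T} (φ ψ : Lens R R') : Cell φ ψ where
  app {b} := (IsEmpty.false b.base).elim
  proj_app {b} := (IsEmpty.false b.base).elim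
  app_left {b} := (IsEmpty.false b.base).elim
  app_right {b} := (IsEmpty.false b.base).elim
  pm {_ _ b} := (IsEmpty.false b.base).elim
  proj_pm {_ _ b} := (IsEmpty.false b.base).elim
  pm_left {_ _ _ b} := (IsEmpty.false b.base).elim
  pm_right {_ _ _ b} := (IsEmpty.false b.base).elim

theorem Cell.eq_of_isEmpty {R R' : Poly I T} {φ ψ : Lens R R'} (U V : Cell φ ψ) : U = V :=
  Cell.ext' (fun {b} => (IsEmpty.false b.base).elim) (fun {_ _ b} => (IsEmpty.false b.base).elim)

/-- Operations and parameters lie over colours of `T`, so with none available a morphism exists and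
any two are joined by exactly one identification. -/
theorem Lens.star_isEquivalence (R R' : Poly I T) : (Functor.star.{0} (Lens R R')).IsEquivalence :=
  GrpdPoly.star_isEquivalence (Lens.ofIsEmpty R R') fun φ ψ =>
    ⟨{ default := Cell.ofIsEmpty φ ψ, uniq := fun U => Cell.eq_of_isEmpty U _ }⟩

theorem PolyHom.eq_of_isEmpty {R R' : Poly I T} (f g : PolyHom R R') : f = g := by
  obtain ⟨φ, rfl⟩ := Quotient.exists_rep f
  obtain ⟨ψ, rfl⟩ := Quotient.exists_rep g
  exact sound (Cell.ofIsEmpty φ ψ)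

/-- Any two polynomials without colours are isomorphic. -/
def Poly.isoOfIsEmpty (R R' : Poly I T) : R ≅ R' where
  hom := PolyHom.mk (Lens.ofIsEmpty R R')
  inv := PolyHom.mk (Lens.ofIsEmpty R' R)
  hom_inv_id := PolyHom.eq_of_isEmpty (R := R) (R' := R) _ _
  inv_hom_id := PolyHom.eq_of_isEmpty (R := R') (R' := R') _ _

-- All polynomials to `T` are isomorphic, and the isomorphism is unique because parallel morphisms
-- are identified.
variable (T) in
theorem PolyBicat.isTerminalObj_of_isEmpty : IsTerminalObj (PolyBicat.of T) := fun I =>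
  star_isEquivalence (C := I ⟶ PolyBicat.of T)
    -- Any polynomial to `T` would do as the required object; families of points provide one.
    (PolyBicat.hom (I := I.as.carrier) ⟨(SetFam.point T).toGFam, (SetFam.point _).toGFam⟩)
    fun R R' => ⟨{ default := ⟨Poly.isoOfIsEmpty R.of R'.of⟩
                   uniq := fun _ => Pith.hom₂_ext _ (PolyHom.eq_of_isEmpty _ _) }⟩

end Terminal

end GrpdPoly

/-! ### The cartesian structure assembled. -/

theorem mainTheorem5 :
    GrpdPoly.IsCartesianBicat GrpdPoly.PolyBicat.{u} ∧
    (∃ (T : Type u) (_ : Groupoid.{u} T),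
      GrpdPoly.IsTerminalObj (GrpdPoly.PolyBicat.of T) ∧
      ∀ (I : Type u) [Groupoid.{u} I] (R R' : GrpdPoly.Poly I T),
        (Functor.star.{0} (GrpdPoly.Lens R R')).IsEquivalence) ∧
    ∀ (J K : Type u) [Groupoid.{u} J] [Groupoid.{u} K],
      GrpdPoly.IsProductObj (GrpdPoly.PolyBicat.hom (GrpdPoly.Poly.projl J K))
        (GrpdPoly.PolyBicat.hom (GrpdPoly.Poly.projr J K)) ∧
      ∀ (I : Type u) [Groupoid.{u} I],
        (∃ e : (GrpdPoly.PolyBicat.of I ⟶ GrpdPoly.PolyBicat.of (J ⊕ K)) ≌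
            (GrpdPoly.PolyBicat.of I ⟶ GrpdPoly.PolyBicat.of J) ×
              (GrpdPoly.PolyBicat.of I ⟶ GrpdPoly.PolyBicat.of K),
          e.functor = GrpdPoly.postcompPair (GrpdPoly.PolyBicat.hom (GrpdPoly.Poly.projl J K))
            (GrpdPoly.PolyBicat.hom (GrpdPoly.Poly.projr J K)) (GrpdPoly.PolyBicat.of I) ∧
          ∀ (P : GrpdPoly.Poly I J) (Q : GrpdPoly.Poly I K),
            e.inverse.obj (GrpdPoly.PolyBicat.hom P, GrpdPoly.PolyBicat.hom Q) =
              GrpdPoly.PolyBicat.hom (GrpdPoly.Poly.pair P Q)) ∧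
        ∀ R R' : GrpdPoly.Poly I (J ⊕ K), (GrpdPoly.Lens.compProj R R').IsEquivalence := by
  -- The empty groupoid serves both as the terminal object of the cartesian structure and as the `T`
  -- whose groupoids of morphisms are contractible before identification.
  refine ⟨⟨⟨GrpdPoly.PolyBicat.of (Discrete PEmpty.{u + 1}),
    GrpdPoly.PolyBicat.isTerminalObj_of_isEmpty _⟩, fun J K => ⟨_, _, _,
      GrpdPoly.PolyBicat.isProductObj J.as.carrier K.as.carrier⟩⟩,
    ⟨Discrete PEmpty.{u + 1}, inferInstance, GrpdPoly.PolyBicat.isTerminalObj_of_isEmpty _,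
      fun I _ R R' => GrpdPoly.Lens.star_isEquivalence R R'⟩,
    fun J K _ _ => ⟨GrpdPoly.PolyBicat.isProductObj J K, fun I _ => ⟨?_, fun R R' =>
      GrpdPoly.Lens.compProj_isEquivalence R R'⟩⟩⟩
  -- The inverse is prescribed to be the pairing on every pair of 1-cells, so the required equation
  -- is an instance of `h`.
  obtain ⟨e, he, h⟩ := GrpdPoly.exists_equivalence_inverse_obj
    (GrpdPoly.PolyBicat.compProjFunctor I J K)
    (fun d => GrpdPoly.PolyBicat.hom (GrpdPoly.Poly.pair d.1.of d.2.of))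
    (fun d => GrpdPoly.PolyBicat.nonempty_compProjFunctor_pair_iso d.1.of d.2.of)
  exact ⟨e, he, fun P Q => h (GrpdPoly.PolyBicat.hom P, GrpdPoly.PolyBicat.hom Q)⟩
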